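/- Let $G$ be a locally compact (Hausdorff) group and let $X$ be a locally compact Hausdorff space with a nonzero Borel measure $\mu$ that is finite on compact sets and a metric $d$ (not assumed continuous for the topology of $X$). Suppose that $(X,d,\mu)$ is a quasi-$G$-transitive metric measure space: $G$ acts measurably on $X$, the action is proper ($\{g : gK\cap K\neq\emptyset\}$ is relatively compact for every compact $K\subset X$) and cocompact ($GK=X$ for some compact $K$), it almost preserves $\mu$ (there is $C<\infty$ with $g\cdot\mu\le C\mu$ for all $g\in G$), and $d$ is $G$-invariant, proper (balls are relatively compact) and finite on compact sets (compact sets have finite diameter). For $h>0$, a viewpoint at scale $h$ is a measurable family $P=(P_x)_{x\in X}$ of probability measures on $X$ for which there are $A\ge 1$ and $c>0$ such that, for $\mu$-almost every $x$, $P_x\ll\mu$ and the density $p_x=dP_x/d\mu$ vanishes $\mu$-a.e. outside the closed ball $B(x,Ah)$ and is at least $c$ $\mu$-a.e. on $B(x,h)$. It is reversible if $\int_U P_x(V)\,d\mu(x)=\int_V P_x(U)\,d\mu(x)$ for all Borel sets $U,V$; then $Pf(x)=\int f\,dP_x$ defines a self-adjoint operator on $L^2(X,\mu)$, with spectral radius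 $\rho(P)$. The group $G$ is amenable if $L^\infty(G)$ has a left-invariant mean. Then the following hold. 1. For every $h>0$: $G$ is unimodular and amenable if and only if $\rho(P)=1$ for every reversible viewpoint $P$ at scale $h$ on $(X,d,\mu)$. 2. There is $h_0>0$ such that for every $h\ge h_0$ and every reversible viewpoint $P$ at scale $h$: $G$ is unimodular and amenable if and only if $\rho(P)=1$. 3. For every $h>0$ and every reversible viewpoint $P$ at scale $h$, one has $\rho(P)\le 1$, and $\rho(P)=1$ if and only if the discrete Laplacian $I-P$ on $L^2(X,\mu)$ has no spectral gap around zero, i.e. its spectrum meets every neighbourhood of $0$. 4. If $G$ is generated by a compact symmetric subset $S$, then $G$ is unimodular and amenable if and only if $G$, with the word metric $d_S(g,h)=\inf\{n : g^{-1}h\in S^n\}$, is not quasi-isometric to any connected graph of bounded degree with positive Cheeger constant. (The Cheeger constant of a graph is $\inf_F |\partial F|/|F|$ over the nonempty finite sets $F$ of vertices, where $\partial F$ is the set of edges joining $F$ to its complement.) -/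

import Mathlib

open MeasureTheory ProbabilityTheory
open scoped ENNReal NNReal Pointwise

universe u

/-! ### Unimodular and amenable locally compact groups -/

/-- A locally compact group is unimodular if its modular character is trivial. -/
def IsUnimodularGroup (G : Type*) [Group G] [TopologicalSpace G] [IsTopologicalGroup G]
    [LocallyCompactSpace G] : Prop :=
  ∀ g : G, Measure.modularCharacter g = 1

/-- A locally compact group is amenable if there is a left-invariant mean on `L^∞(G)`: a positive
linear functional `m` with `m 1 = 1` and `m (x ↦ f (g * x)) = m f` for all `g` and `f`. -/
def IsAmenableGroup (G : Type*) [Group G] [TopologicalSpace G] [IsTopologicalGroup G]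
    [LocallyCompactSpace G] [MeasurableSpace G] [BorelSpace G] : Prop :=
  ∃ m : Lp ℝ ∞ (Measure.haar : Measure G) →ₗ[ℝ] ℝ,
    (∀ f : Lp ℝ ∞ (Measure.haar : Measure G), 0 ≤ f → 0 ≤ m f) ∧
    m ((memLp_top_const (1 : ℝ)).toLp (fun _ : G => (1 : ℝ))) = 1 ∧
    ∀ (g : G) (f : Lp ℝ ∞ (Measure.haar : Measure G)),
      m (Lp.compMeasurePreserving (fun x : G => g * x)
        (measurePreserving_mul_left Measure.haar g) f) = m f

/-! ### Quasi-transitive metric measure spaces -/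

/-- `d` is a metric on the set `X`. It is not required to induce the given topology of `X`, nor to
be continuous. -/
structure IsMetricOn {X : Type*} (d : X → X → ℝ) : Prop where
  eq_zero_iff : ∀ x y, d x y = 0 ↔ x = y
  symm : ∀ x y, d x y = d y x
  triangle : ∀ x y z, d x z ≤ d x y + d y z

/-- `(X, d, μ)` is a quasi-transitive metric measure space for the action of the group `G` on the
locally compact Borel measure space `(X, μ)`. -/
structure IsQuasiTransitive (G : Type*) {X : Type*} [Group G] [TopologicalSpace G]
    [MeasurableSpace G] [TopologicalSpace X] [MeasurableSpace X] [MulAction G X]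
    (d : X → X → ℝ) (μ : Measure X) : Prop where
  /-- the action is measurable, in each variable separately -/
  measurable_action : MeasurableSMul G X
  /-- the action is proper -/
  proper_action : ∀ K : Set X, IsCompact K →
    IsCompact (closure {g : G | ((g • K) ∩ K).Nonempty})
  /-- the action is cocompact -/
  cocompact_action : ∃ K : Set X, IsCompact K ∧ (⋃ g : G, g • K) = Set.univ
  /-- the density of `g · μ` with respect to `μ` is bounded, uniformly in `g` -/
  almost_preserving : ∃ C : ℝ≥0, ∀ g : G, μ.map (fun x => g • x) ≤ C • μ
  /-- `d` is a metric -/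
  isMetric : IsMetricOn d
  /-- `d` is `G`-invariant -/
  invariant_metric : ∀ (g : G) (x y : X), d (g • x) (g • y) = d x y
  /-- `d` is proper: balls are relatively compact -/
  proper_metric : ∀ (x : X) (r : ℝ), IsCompact (closure {y | d x y ≤ r})
  /-- `d` is finite on compact sets: compact sets have finite diameter -/
  finite_on_compacts : ∀ K : Set X, IsCompact K → ∃ C : ℝ, ∀ x ∈ K, ∀ y ∈ K, d x y ≤ C

/-! ### Viewpoints and the associated Markov operator -/

/-- A viewpoint at scale `h`: a measurable family `(P x)` of probability measures which, for
`μ`-almost every `x`, are absolutely continuous with respect to `μ`, with a density that vanishes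
outside of the closed ball `B(x, A h)` and is at least `c` on the closed ball `B(x, h)`, for
some constants `A ≥ 1` and `c > 0` independent of `x`. -/
def IsViewpoint {X : Type*} [MeasurableSpace X] (d : X → X → ℝ) (μ : Measure X) (h : ℝ)
    (P : Kernel X X) : Prop :=
  IsMarkovKernel P ∧ ∃ A : ℝ, 1 ≤ A ∧ ∃ c : ℝ≥0, 0 < c ∧ ∀ᵐ x ∂μ,
    P x ≪ μ ∧
    (∀ᵐ y ∂μ, (P x).rnDeriv μ y ≠ 0 → d x y ≤ A * h) ∧
    (∀ᵐ y ∂μ, d x y ≤ h → (c : ℝ≥0∞) ≤ (P x).rnDeriv μ y)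

/-- A viewpoint which is reversible with respect to `μ`. -/
structure IsReversibleViewpoint {X : Type*} [MeasurableSpace X] (d : X → X → ℝ) (μ : Measure X)
    (h : ℝ) (P : Kernel X X) : Prop where
  isViewpoint : IsViewpoint d μ h P
  isReversible : P.IsReversible μ

section MarkovOperator

variable {X : Type*} [MeasurableSpace X] {μ : Measure X} {P : Kernel X X}

lemma lintegral_lintegral_of_invariant (hP : P.Invariant μ) {f : X → ℝ≥0∞} (hf : Measurable f) :
    ∫⁻ x, ∫⁻ y, f y ∂(P x) ∂μ = ∫⁻ y, f y ∂μ := by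
  rw [← Measure.lintegral_bind P.aemeasurable hf.aemeasurable, hP.def]

lemma ae_memLp_of_invariant (hP : P.Invariant μ) (f : Lp ℂ 2 μ) :
    ∀ᵐ x ∂μ, MemLp f 2 (P x) := by
  have hm : Measurable fun y => ‖f y‖ₑ ^ (2 : ℝ) :=
    (Lp.stronglyMeasurable f).measurable.enorm.pow_const _
  have h1 : ∫⁻ x, ∫⁻ y, ‖f y‖ₑ ^ (2 : ℝ) ∂(P x) ∂μ ≠ ∞ := by
    rw [lintegral_lintegral_of_invariant hP hm]
    have := (eLpNorm_lt_top_iff_lintegral_rpow_enorm_lt_top (p := 2) (f := (f : X → ℂ)) (μ := μ)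
      (by norm_num) (by norm_num)).1 (Lp.eLpNorm_lt_top f)
    simpa using this.ne
  filter_upwards [ae_lt_top (Measurable.lintegral_kernel hm) h1] with x hx
  refine ⟨(Lp.stronglyMeasurable f).aestronglyMeasurable, ?_⟩
  rw [eLpNorm_lt_top_iff_lintegral_rpow_enorm_lt_top (by norm_num) (by norm_num)]
  simpa using hx

lemma enorm_integral_rpow_le [IsMarkovKernel P] (f : Lp ℂ 2 μ) (x : X) :
    ‖∫ y, f y ∂(P x)‖ₑ ^ (2 : ℝ) ≤ ∫⁻ y, ‖f y‖ₑ ^ (2 : ℝ) ∂(P x) := by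
  have h1 : ‖∫ y, f y ∂(P x)‖ₑ ≤ eLpNorm f 2 (P x) := by
    refine (enorm_integral_le_lintegral_enorm _).trans ?_
    rw [← eLpNorm_one_eq_lintegral_enorm]
    exact eLpNorm_le_eLpNorm_of_exponent_le (by norm_num)
      (Lp.stronglyMeasurable f).aestronglyMeasurable
  refine (ENNReal.rpow_le_rpow h1 (by norm_num : (0 : ℝ) ≤ 2)).trans ?_
  rw [eLpNorm_eq_lintegral_rpow_enorm_toReal (by norm_num) (by norm_num)]
  rw [← ENNReal.rpow_mul]
  norm_num

lemma eLpNorm_integral_kernel_le [IsMarkovKernel P] (hP : P.Invariant μ) (f : Lp ℂ 2 μ) :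
    eLpNorm (fun x => ∫ y, f y ∂(P x)) 2 μ ≤ eLpNorm f 2 μ := by
  have hm : Measurable fun y => ‖f y‖ₑ ^ (2 : ℝ) :=
    (Lp.stronglyMeasurable f).measurable.enorm.pow_const _
  rw [eLpNorm_eq_lintegral_rpow_enorm_toReal (by norm_num) (by norm_num),
    eLpNorm_eq_lintegral_rpow_enorm_toReal (by norm_num) (by norm_num)]
  refine ENNReal.rpow_le_rpow ?_ (by norm_num)
  simp only [ENNReal.toReal_ofNat]
  rw [← lintegral_lintegral_of_invariant hP hm]
  exact lintegral_mono fun x => enorm_integral_rpow_le f x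

lemma memLp_integral_kernel [IsMarkovKernel P] (hP : P.Invariant μ) (f : Lp ℂ 2 μ) :
    MemLp (fun x => ∫ y, f y ∂(P x)) 2 μ :=
  ⟨((Lp.stronglyMeasurable f).integral_kernel (κ := P)).aestronglyMeasurable,
    (eLpNorm_integral_kernel_le hP f).trans_lt (Lp.eLpNorm_lt_top f)⟩

lemma ae_ae_of_invariant (hP : P.Invariant μ) {p : X → Prop} (hp : ∀ᵐ y ∂μ, p y) :
    ∀ᵐ x ∂μ, ∀ᵐ y ∂(P x), p y := by
  rw [← hP.def] at hp
  exact Measure.ae_ae_of_ae_bind P.aemeasurable hp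

/-- The Markov operator `P f (x) = ∫ f(y) dP_x(y)` on the Hilbert space `L²(X, μ)`, for a Markov
kernel `P` that leaves `μ` invariant. -/
noncomputable def markovOperator (μ : Measure X) (P : Kernel X X) [IsMarkovKernel P]
    (hP : P.Invariant μ) : Lp ℂ 2 μ →L[ℂ] Lp ℂ 2 μ :=
  LinearMap.mkContinuous
    { toFun := fun f => (memLp_integral_kernel hP f).toLp (fun x => ∫ y, f y ∂(P x))
      map_add' := by
        intro f g
        rw [← MemLp.toLp_add, MemLp.toLp_eq_toLp_iff]
        filter_upwards [ae_ae_of_invariant hP (Lp.coeFn_add f g), ae_memLp_of_invariant hP f,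
          ae_memLp_of_invariant hP g] with x hx hf hg
        rw [integral_congr_ae hx]
        exact integral_add (hf.integrable (by norm_num)) (hg.integrable (by norm_num))
      map_smul' := by
        intro a f
        rw [RingHom.id_apply, ← MemLp.toLp_const_smul, MemLp.toLp_eq_toLp_iff]
        filter_upwards [ae_ae_of_invariant hP (Lp.coeFn_smul a f)] with x hx
        rw [integral_congr_ae hx]
        exact integral_smul a _ }
    1 (by
      intro f
      rw [one_mul]
      exact (Lp.norm_toLp _ (memLp_integral_kernel hP f)).trans_le
        (ENNReal.toReal_mono (Lp.eLpNorm_lt_top f).ne (eLpNorm_integral_kernel_le hP f)))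

lemma markovOperator_ae_eq [IsMarkovKernel P] (hP : P.Invariant μ) (f : Lp ℂ 2 μ) :
    markovOperator μ P hP f =ᵐ[μ] fun x => ∫ y, f y ∂(P x) :=
  (memLp_integral_kernel hP f).coeFn_toLp

end MarkovOperator

/-- The spectral radius on `L²(X, μ)` of a reversible Markov kernel. -/
noncomputable def markovSpectralRadius {X : Type*} [MeasurableSpace X] (μ : Measure X)
    (P : Kernel X X) [IsMarkovKernel P] (hP : P.IsReversible μ) : ℝ≥0∞ :=
  spectralRadius ℂ (markovOperator μ P hP.invariant)

/-- The discrete Laplacian `I - P` on `L²(X, μ)` of a reversible Markov kernel. -/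
noncomputable def markovLaplacian {X : Type*} [MeasurableSpace X] (μ : Measure X)
    (P : Kernel X X) [IsMarkovKernel P] (hP : P.IsReversible μ) : Lp ℂ 2 μ →L[ℂ] Lp ℂ 2 μ :=
  1 - markovOperator μ P hP.invariant

/-- An operator has a spectral gap around zero if its spectrum avoids a neighbourhood of `0`. -/
def HasSpectralGap {E : Type*} [NormedAddCommGroup E] [NormedSpace ℂ E] (T : E →L[ℂ] E) : Prop :=
  ∃ δ : ℝ, 0 < δ ∧ ∀ z ∈ spectrum ℂ T, δ ≤ ‖z‖

/-! ### Word metrics, quasi-isometries and the Cheeger constant -/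

/-- The word metric `d_S(g, h) = inf {n : g⁻¹ h ∈ Sⁿ}`. -/
noncomputable def wordDist {G : Type*} [Group G] (S : Set G) (g h : G) : ℝ :=
  ((sInf {n : ℕ | g⁻¹ * h ∈ S ^ n} : ℕ) : ℝ)

/-- There is a quasi-isometry `F : (X, dX) → (Y, dY)`. -/
def QuasiIsometric {X Y : Type*} (dX : X → X → ℝ) (dY : Y → Y → ℝ) : Prop :=
  ∃ F : X → Y, ∃ C : ℝ, 0 < C ∧
    (∀ x y, C⁻¹ * dX x y - C ≤ dY (F x) (F y) ∧ dY (F x) (F y) ≤ C * dX x y + C) ∧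
    ∀ z, ∃ x, dY z (F x) ≤ C

/-- The Cheeger constant of a graph: the infimum of `|∂F| / |F|` over the nonempty finite sets `F`
of vertices, where `∂F` is the set of edges between `F` and its complement. -/
noncomputable def cheegerConstant {V : Type*} (Γ : SimpleGraph V) : ℝ≥0∞ :=
  ⨅ F : {F : Finset V // F.Nonempty},
    ((({e : V × V | e.1 ∈ F.1 ∧ e.2 ∉ F.1 ∧ Γ.Adj e.1 e.2}.encard : ℕ∞) : ℝ≥0∞) /
      (F.1.card : ℝ≥0∞))

/-- A metric on a set is quasi-isometric to a connected graph of bounded degree with positive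
Cheeger constant, equipped with the graph distance. -/
def QuasiIsometricToCheegerGraph {X : Type u} (dX : X → X → ℝ) : Prop :=
  ∃ (V : Type u) (Γ : SimpleGraph V), Γ.Connected ∧
    (∃ D : ℕ, ∀ v, (Γ.neighborSet v).encard ≤ D) ∧
    0 < cheegerConstant Γ ∧
    QuasiIsometric dX (fun v w => (Γ.dist v w : ℝ))

/-! Fix a net `Γ` in `G`. Every assertion reduces to one property, `IsFolnerNet Γ`: for each compact
`Q`, some finite subsets of `Γ` grow by a factor of at most `1 + ε` when thickened by right
translations from `Q`.

This property holds exactly when `G` is unimodular and amenable (`IsGroupNet.isFolnerNet_iff`).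
Thickened Følner sets `A` in `G` have small `A q⁻¹ \ A`. Right translation by `q` scales left Haar
measure by the modular character, so this character is at most `1`, hence trivial; averages over the
sets `A⁻¹` then converge to a left-invariant mean. If instead `Γ` is not Følner, iterated expansion
and Hall's theorem give two injections `Γ → Γ` with bounded displacement and disjoint images. For an
invariant mean `m`, the functional `ψ ↦ m (x ↦ ∑ ψ (x γ))` is a multiple of the Haar integral. On a
unimodular group the integral ignores right translations of `ψ`, so bounded displacements of the
points do not change the mean (`IsContinuousMean.translateSum_displacement`). Then `Γ` would have at
least twice its own positive density.

An orbit map makes `Γ` a coarse model of `X` (`IsQuasiTransitive.exists_isCoarseModel`). Følner sets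
pull back to subsets of `X` that the walk hardly leaves, which forces spectral radius `1`. In the
doubling case spectral radius `1` would give a function `g` of small Dirichlet energy, whose local
averages of `g²` at `v` and at its two images are comparable; summing over `v` bounds twice a finite
positive sum by less than twice itself. The scale must be large for the energy to see these pairs of
points. A viewpoint at a large scale is also one at every smaller scale, which settles the statement
about all viewpoints.

The spectral statement uses positivity: for the self-adjoint `P` the radius is the norm, and
replacing `f` by `|f| + P|f|` shows that norm `1` puts `1`, and not merely `-1`, in the spectrum.
For compactly generated `G`, Følner sets pass through quasi-isometries to bounded degree graphs, and
a doubling net carries a graph with positive Cheeger constant. -/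

/-! ### Neighbourhoods of finite sets for a locally finite relation -/

section Neighbourhood

variable {V : Type*}

/-- The set of points that are related to some point of `F`. -/
def nbhdOf (E : V → V → Prop) (F : Finset V) : Set V := {w | ∃ v ∈ F, E v w}

lemma finite_nbhdOf {E : V → V → Prop} (hE : ∀ v, {w | E v w}.Finite) (F : Finset V) :
    (nbhdOf E F).Finite := by
  have : nbhdOf E F = ⋃ v ∈ F, {w | E v w} := by
    ext w; simp [nbhdOf]
  rw [this]
  exact F.finite_toSet.biUnion fun v _ => hE v

lemma nbhdOf_mono {E E' : V → V → Prop} (h : ∀ v w, E v w → E' v w) (F : Finset V) :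
    nbhdOf E F ⊆ nbhdOf E' F := fun _ ⟨v, hv, hvw⟩ => ⟨v, hv, h _ _ hvw⟩

lemma subset_nbhdOf {E : V → V → Prop} (h : ∀ v, E v v) (F : Finset V) :
    (F : Set V) ⊆ nbhdOf E F := fun v hv => ⟨v, hv, h v⟩

lemma ncard_nbhdOf_mono {E E' : V → V → Prop} (hE' : ∀ v, {w | E' v w}.Finite)
    (h : ∀ v w, E v w → E' v w) (F : Finset V) :
    (nbhdOf E F).ncard ≤ (nbhdOf E' F).ncard :=
  Set.ncard_le_ncard (nbhdOf_mono h F) (finite_nbhdOf hE' F)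

/-- Every finite set has at least twice as many neighbours as elements. -/
def IsDoubling (E : V → V → Prop) : Prop :=
  ∀ F : Finset V, 2 * F.card ≤ (nbhdOf E F).ncard

/-- Expansion iterates because it is assumed for all finite sets, in particular for the `E
k`-neighbourhood of `F`. -/
lemma pow_mul_card_le_ncard_nbhdOf {E : ℕ → V → V → Prop}
    (hfin : ∀ k v, {w | E k v w}.Finite) (h0 : ∀ v, E 0 v v)
    (hcomp : ∀ k u v w, E k u v → E 1 v w → E (k + 1) u w) {a : ℝ} (ha : 0 ≤ a)
    (h : ∀ F : Finset V, a * F.card ≤ (nbhdOf (E 1) F).ncard) (k : ℕ) (F : Finset V) :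
    a ^ k * F.card ≤ (nbhdOf (E k) F).ncard := by
  induction k with
  | zero =>
    rw [pow_zero, one_mul]
    have := Set.ncard_le_ncard (subset_nbhdOf h0 F) (finite_nbhdOf (hfin 0) F)
    rw [Set.ncard_coe_finset] at this
    exact_mod_cast this
  | succ k ih =>
    have hf := finite_nbhdOf (hfin k) F
    have h1 := h hf.toFinset
    rw [← Set.ncard_eq_toFinset_card _ hf] at h1
    have h2 : nbhdOf (E 1) hf.toFinset ⊆ nbhdOf (E (k + 1)) F := by
      rintro w ⟨v, hv, hvw⟩
      rw [Set.Finite.mem_toFinset] at hv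
      obtain ⟨u, hu, huv⟩ := hv
      exact ⟨u, hu, hcomp k u v w huv hvw⟩
    have h3 := Set.ncard_le_ncard h2 (finite_nbhdOf (hfin (k + 1)) F)
    calc a ^ (k + 1) * F.card = a * (a ^ k * F.card) := by ring
      _ ≤ a * (nbhdOf (E k) F).ncard := by gcongr
      _ ≤ _ := h1
      _ ≤ _ := by exact_mod_cast h3

/-- Hall's theorem: a doubling relation contains two injections with disjoint images. -/
lemma IsDoubling.exists_injective {E : V → V → Prop} (hE : ∀ v, {w | E v w}.Finite)
    (h : IsDoubling E) : ∃ f : V × Bool → V, Function.Injective f ∧ ∀ p, E p.1 (f p) := by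
  classical
  have := (Finset.all_card_le_biUnion_card_iff_exists_injective
    (fun p : V × Bool => (hE p.1).toFinset)).1 ?_
  · obtain ⟨f, hf, hf'⟩ := this
    exact ⟨f, hf, fun p => by simpa using hf' p⟩
  intro s
  -- Both copies of a vertex have the same neighbours, so Hall's condition follows from doubling of
  -- the projection of `s`.
  have h1 : s ⊆ (s.image Prod.fst) ×ˢ (Finset.univ : Finset Bool) := by
    intro p hp
    simp only [Finset.mem_product, Finset.mem_univ, and_true]
    exact Finset.mem_image_of_mem _ hp
  have h2 := Finset.card_le_card h1
  rw [Finset.card_product, Finset.card_univ, Fintype.card_bool] at h2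
  have h3 := h (s.image Prod.fst)
  have h4 : nbhdOf E (s.image Prod.fst) ⊆
      (s.biUnion fun p : V × Bool => (hE p.1).toFinset : Finset V) := by
    rintro w ⟨v, hv, hvw⟩
    obtain ⟨p, hp, rfl⟩ := Finset.mem_image.1 hv
    simp only [Finset.coe_biUnion, Set.mem_iUnion]
    exact ⟨p, hp, by simpa using hvw⟩
  have h5 := Set.ncard_le_ncard h4 (Finset.finite_toSet _)
  rw [Set.ncard_coe_finset] at h5
  omega

end Neighbourhood

/-! ### Nets in locally compact groups -/

section Net

variable {G : Type*} [Group G]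

/-- Two points of `Γ` are related if the right translation from the first to the second
belongs to `Q`. -/
def translRel (Γ Q : Set G) (v w : Γ) : Prop := (v : G)⁻¹ * w ∈ Q

variable [TopologicalSpace G]

/-- `Γ` is a net of `G`: its translates of `W` are disjoint and those of `W / W` cover `G`. -/
structure IsGroupNet (Γ W : Set G) : Prop where
  isCompact : IsCompact W
  mem_nhds : W ∈ nhds (1 : G)
  disjoint : ∀ γ ∈ Γ, ∀ γ' ∈ Γ, γ ≠ γ' → Disjoint (γ • W) (γ' • W)
  cover : ∀ g : G, ∃ γ ∈ Γ, γ⁻¹ * g ∈ W / W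

/-- All thickenings of suitable finite subsets of `Γ` are almost as small as the subsets. -/
def IsFolnerNet (Γ : Set G) : Prop :=
  ∀ Q : Set G, IsCompact Q → ∀ ε : ℝ, 0 < ε → ∃ F : Finset Γ, F.Nonempty ∧
    ((nbhdOf (translRel Γ Q) F).ncard : ℝ) ≤ (1 + ε) * F.card

variable [IsTopologicalGroup G] 

-- Zorn's lemma gives a maximal family with disjoint translates of `W`. Were `g` outside all the `γ
-- (W / W)`, then `g W` would be disjoint from the family and `g` could be added.
omit [IsTopologicalGroup G] in
lemma exists_isGroupNet [LocallyCompactSpace G] : ∃ Γ W : Set G, IsGroupNet Γ W := by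
  obtain ⟨W, hW, hW1⟩ := exists_compact_mem_nhds (1 : G)
  let A : Set (Set G) := {Γ | ∀ γ ∈ Γ, ∀ γ' ∈ Γ, γ ≠ γ' → Disjoint (γ • W) (γ' • W)}
  obtain ⟨Γ, hΓ⟩ : ∃ Γ, Maximal (· ∈ A) Γ := by
    refine zorn_subset A fun c hc hchain => ⟨⋃₀ c, ?_, fun s hs => Set.subset_sUnion_of_mem hs⟩
    rintro γ ⟨s, hs, hγ⟩ γ' ⟨s', hs', hγ'⟩ hne
    rcases hchain.total hs hs' with h | h
    · exact hc hs' γ (h hγ) γ' hγ' hne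
    · exact hc hs γ hγ γ' (h hγ') hne
  refine ⟨Γ, W, hW, hW1, hΓ.prop, fun g => ?_⟩
  have key : ∀ γ : G, ¬ Disjoint (γ • W) (g • W) → γ⁻¹ * g ∈ W / W := by
    intro γ h
    obtain ⟨_, ⟨u, hu, rfl⟩, v, hv, hx⟩ := Set.not_disjoint_iff.1 h
    refine Set.mem_div.2 ⟨u, hu, v, hv, ?_⟩
    simp only [smul_eq_mul] at hx
    rw [div_eq_mul_inv, eq_inv_mul_iff_mul_eq, ← mul_assoc, ← hx, mul_inv_cancel_right]
  by_cases hg : g ∈ Γ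
  · refine ⟨g, hg, ?_⟩
    rw [inv_mul_cancel, ← div_self' (1 : G)]
    exact Set.div_mem_div (mem_of_mem_nhds hW1) (mem_of_mem_nhds hW1)
  by_contra! hcon
  have hmem : insert g Γ ∈ A := by
    rintro γ (rfl | hγ) γ' (rfl | hγ') hne
    · exact absurd rfl hne
    · by_contra h
      exact hcon γ' hγ' (key _ fun h' => h h'.symm)
    · by_contra h
      exact hcon γ hγ (key _ h)
    · exact hΓ.prop γ hγ γ' hγ' hne
  exact hg (hΓ.le_of_ge hmem (Set.subset_insert _ _) (Set.mem_insert _ _))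

variable {Γ W : Set G}

/-- A packing bound: the disjoint sets `γ W` all lie in `g Q W`, whose Haar measure is finite and
independent of `g`. The interior of `W` replaces `W` to have measurable sets of positive measure
without a separation axiom. -/
lemma IsGroupNet.exists_encard_le [LocallyCompactSpace G] (h : IsGroupNet Γ W) {Q : Set G}
    (hQ : IsCompact Q) : ∃ N : ℕ, ∀ g : G, {γ : Γ | g⁻¹ * γ ∈ Q}.encard ≤ N := by
  borelize G
  let ν : Measure G := Measure.haar
  have hpos : ν (interior W) ≠ 0 :=
    (isOpen_interior.measure_pos ν ⟨1, mem_interior_iff_mem_nhds.2 h.mem_nhds⟩).ne'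
  have hfin : ν (Q * W) ≠ ∞ := (hQ.mul h.isCompact).measure_lt_top.ne
  obtain ⟨N, hN⟩ := ENNReal.exists_nat_mul_gt hpos hfin
  refine ⟨N, fun g => ?_⟩
  by_contra! hlt
  obtain ⟨t, ht, htc⟩ := Set.exists_subset_encard_eq hlt.le
  have htf : t.Finite := Set.finite_of_encard_eq_coe htc
  have hc : htf.toFinset.card = N := by
    have := htf.encard_eq_coe_toFinset_card
    rw [htc] at this
    exact_mod_cast this.symm
  have h1 : ν (⋃ γ ∈ htf.toFinset, (γ : G) • interior W) = N * ν (interior W) := by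
    rw [measure_biUnion_finset]
    · simp [hc]
    · intro γ _ γ' _ hne
      exact (h.disjoint γ γ.2 γ' γ'.2 (fun e => hne (Subtype.ext e))).mono
        (Set.smul_set_mono interior_subset) (Set.smul_set_mono interior_subset)
    · intro γ _
      exact (isOpen_interior.smul (γ : G)).measurableSet
  have h2 : ν (⋃ γ ∈ htf.toFinset, (γ : G) • interior W) ≤ ν (Q * W) := by
    rw [← measure_smul ν g (Q * W)]
    refine measure_mono (Set.iUnion₂_subset fun γ hγ => ?_)
    rintro _ ⟨w, hw, rfl⟩
    have hγ' := ht (htf.mem_toFinset.1 hγ)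
    refine ⟨(g⁻¹ * γ) * w, Set.mul_mem_mul hγ' (interior_subset hw), ?_⟩
    simp [mul_assoc]
  rw [h1] at h2
  exact absurd hN (not_lt.2 h2)

lemma IsGroupNet.finite_translRel [LocallyCompactSpace G] (h : IsGroupNet Γ W) {Q : Set G}
    (hQ : IsCompact Q) (v : Γ) : {w | translRel Γ Q v w}.Finite := by
  obtain ⟨N, hN⟩ := h.exists_encard_le hQ
  exact Set.finite_of_encard_le_coe (hN v)

lemma IsCompact.pow_set {Q : Set G} (hQ : IsCompact Q) (n : ℕ) : IsCompact (Q ^ n) := by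
  induction n with
  | zero => rw [pow_zero]; exact isCompact_singleton
  | succ n ih => rw [pow_succ]; exact ih.mul hQ

lemma IsGroupNet.exists_isDoubling [LocallyCompactSpace G] (h : IsGroupNet Γ W)
    (hΓ : ¬ IsFolnerNet Γ) : ∃ Q : Set G, IsCompact Q ∧ IsDoubling (translRel Γ Q) := by
  unfold IsFolnerNet at hΓ
  push Not at hΓ
  obtain ⟨Q, hQ, ε, hε, hF⟩ := hΓ
  -- Failure of the Følner condition is expansion by `1 + ε`; enough iterations turn it into
  -- doubling.
  obtain ⟨k, hk⟩ := pow_unbounded_of_one_lt 2 (show 1 < 1 + ε by linarith)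
  refine ⟨Q ^ k, hQ.pow_set k, fun F => ?_⟩
  have := pow_mul_card_le_ncard_nbhdOf (E := fun k => translRel Γ (Q ^ k))
    (fun k v => h.finite_translRel (hQ.pow_set k) v) (fun v => by simp [translRel])
    (fun k u v w huv hvw => by
      simp only [translRel, pow_one] at *
      rw [pow_succ]
      refine ⟨_, huv, _, hvw, by simp [mul_assoc]⟩) (a := 1 + ε) (by linarith)
    (fun F => by
      rw [pow_one]
      rcases F.eq_empty_or_nonempty with rfl | hne
      · simp
      · exact (hF F hne).le) k F
  have h2 : (2 : ℝ) * F.card ≤ (nbhdOf (translRel Γ (Q ^ k)) F).ncard :=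
    (mul_le_mul_of_nonneg_right hk.le (Nat.cast_nonneg _)).trans this
  exact_mod_cast h2

end Net

/-! ### Limits of functionals along ultrafilters -/

lemma exists_linearMap_tendsto_ultrafilter {ι E : Type*} [NormedAddCommGroup E] [NormedSpace ℝ E]
    (l : Filter ι) [l.NeBot] (m : ι → E →ₗ[ℝ] ℝ) (hm : ∀ i f, |m i f| ≤ ‖f‖) :
    ∃ (U : Ultrafilter ι) (L : E →ₗ[ℝ] ℝ), (U : Filter ι) ≤ l ∧
      ∀ f, Filter.Tendsto (fun i => m i f) U (nhds (L f)) := by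
  let U := Ultrafilter.of l
  have h : ∀ f, ∃ a, Filter.Tendsto (fun i => m i f) U (nhds a) := by
    intro f
    have := (isCompact_Icc (a := -‖f‖) (b := ‖f‖)).ultrafilter_le_nhds (U.map fun i => m i f) (by
      rw [Filter.le_principal_iff]
      exact Filter.Eventually.of_forall (f := (U : Filter ι)) fun i => abs_le.1 (hm i f))
    obtain ⟨a, -, ha⟩ := this
    exact ⟨a, ha⟩
  choose L hL using h
  exact ⟨U, { toFun := L
              map_add' := fun f g => tendsto_nhds_unique (hL (f + g))
                (by simpa only [map_add] using (hL f).add (hL g))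
              map_smul' := fun c f => tendsto_nhds_unique (hL (c • f))
                (by simpa only [map_smul, RingHom.id_apply] using (hL f).const_smul c) },
    Ultrafilter.of_le l, hL⟩

lemma abs_setIntegral_sub_setIntegral_le {α : Type*} [MeasurableSpace α] {ν : Measure α}
    {f : α → ℝ} {c : ℝ} (hf : ∀ᵐ x ∂ν, |f x| ≤ c) (hfm : AEStronglyMeasurable f ν) {A B : Set α}
    (hA : MeasurableSet A) (hB : MeasurableSet B) (hA' : ν A ≠ ∞) (hB' : ν B ≠ ∞) :
    |∫ x in A, f x ∂ν - ∫ x in B, f x ∂ν| ≤ c * (ν.real (A \ B) + ν.real (B \ A)) := by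
  have hi : ∀ {C : Set α}, ν C ≠ ∞ → IntegrableOn f C ν := fun hC =>
    Measure.integrableOn_of_bounded hC hfm (ae_restrict_of_ae hf)
  have h1 := integral_inter_add_sdiff hB (hi hA')
  have h2 := integral_inter_add_sdiff hA (hi hB')
  rw [Set.inter_comm] at h2
  have hb : ∀ {C : Set α}, ν C ≠ ∞ → |∫ x in C, f x ∂ν| ≤ c * ν.real C := fun hC =>
    norm_setIntegral_le_of_norm_le_const_ae' (f := f) hC.lt_top (hf.mono fun x hx _ => hx)
  have h3 := hb (measure_ne_top_of_subset (Set.sdiff_subset (s := A) (t := B)) hA')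
  have h4 := hb (measure_ne_top_of_subset (Set.sdiff_subset (s := B) (t := A)) hB')
  rw [← h1, ← h2, add_sub_add_left_eq_sub, mul_add]
  exact (abs_sub _ _).trans (add_le_add h3 h4)

/-! ### Følner nets yield unimodularity and an invariant mean. -/

section

variable {G : Type*} [Group G] [TopologicalSpace G] [IsTopologicalGroup G]
  [LocallyCompactSpace G] [MeasurableSpace G] [BorelSpace G]

lemma map_mul_right_haar (g : G) :
    (Measure.haar : Measure G).map (· * g) = Measure.modularCharacter g • Measure.haar := by
  have : (Measure.map (· * g) (Measure.haar : Measure G)).Regular :=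
    Measure.Regular.map (Homeomorph.mulRight g)
  change _ = Measure.modularCharacterFun g • _
  rw [Measure.modularCharacterFun_eq_haarScalarFactor Measure.haar]
  exact Measure.isMulLeftInvariant_eq_smul_of_regular _ _

lemma IsUnimodularGroup.isMulRightInvariant (hG : IsUnimodularGroup G) :
    (Measure.haar : Measure G).IsMulRightInvariant :=
  ⟨fun g => by rw [map_mul_right_haar, hG g, one_smul]⟩

/-- Inversion turns right invariance into left invariance, so the inverse measure is `c • μ` by
uniqueness. Inverting twice gives `c ^ 2 = 1`. -/
lemma isInvInvariant_of_isMulRightInvariant_of_regular (μ : Measure G) [μ.IsHaarMeasure]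
    [μ.IsMulRightInvariant] [μ.Regular] : μ.IsInvInvariant := by
  constructor
  let c : ℝ≥0∞ := Measure.haarScalarFactor μ.inv μ
  have hc : μ.inv = c • μ := Measure.isMulLeftInvariant_eq_smul_of_regular μ.inv μ
  have : Measure.map Inv.inv (Measure.map Inv.inv μ) = c ^ 2 • μ := by
    rw [← Measure.inv_def μ, hc, Measure.map_smul, ← Measure.inv_def μ, hc, smul_smul, pow_two]
  have μeq : μ = c ^ 2 • μ := by
    rw [Measure.map_map continuous_inv.measurable continuous_inv.measurable] at this
    simpa only [inv_involutive, Function.Involutive.comp_self, Measure.map_id]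
  have K : TopologicalSpace.PositiveCompacts G := Classical.arbitrary _
  have : c ^ 2 * μ K = 1 ^ 2 * μ K := by
    conv_rhs => rw [μeq]
    simp
  have : c ^ 2 = 1 ^ 2 :=
    (ENNReal.mul_left_inj (Measure.measure_pos_of_nonempty_interior _ K.interior_nonempty).ne'
          K.isCompact.measure_lt_top.ne).1 this
  have : c = 1 := (ENNReal.pow_right_strictMono two_ne_zero).injective this
  rw [hc, this, one_smul]

variable {Γ W : Set G}

/-- Take `A = F U` with `U = W / W` and `F` a Følner subset of the net. If `x q ∈ A` and `x ∉ A`, a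
net point near `x` lies in the thickening of `F` but not in `F`, and there are few such points.
Disjointness of the translates of `W` bounds the measure of `A` from below by a multiple of `|F|`.
-/
lemma IsGroupNet.exists_folner_set (h : IsGroupNet Γ W) (hΓ : IsFolnerNet Γ)
    (S : Finset G) {ε : ℝ} (hε : 0 < ε) :
    ∃ A : Set G, IsCompact A ∧ 0 < (Measure.haar : Measure G).real A ∧
      ∀ q ∈ S, (Measure.haar : Measure G).real ((· * q) ⁻¹' A \ A) ≤
        ε * (Measure.haar : Measure G).real A := by
  classical
  set ν : Measure G := Measure.haar
  set U := W / W with hU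
  have hUc : IsCompact U := by
    rw [hU, div_eq_mul_inv]; exact h.isCompact.mul h.isCompact.inv
  have h1 : (1 : G) ∈ W := mem_of_mem_nhds h.mem_nhds
  have hWU : W ⊆ U := fun w hw => ⟨w, hw, 1, h1, by simp⟩
  have h1U : (1 : G) ∈ U := hWU h1
  have hposW : 0 < ν.real (interior W) :=
    ENNReal.toReal_pos (isOpen_interior.measure_pos ν
      ⟨1, mem_interior_iff_mem_nhds.2 h.mem_nhds⟩).ne'
      (measure_ne_top_of_subset interior_subset h.isCompact.measure_lt_top.ne)
  -- For `x ∈ γ' U` and `x q ∈ γ U` one gets `γ'⁻¹ γ ∈ U q U⁻¹`; the relation from `γ` to `γ'` uses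
  -- the inverse set. Inserting `1` puts `F` inside its own thickening.
  let Q : Set G := U * (insert 1 (S : Set G)) * U⁻¹
  have hQ : IsCompact Q := (hUc.mul (S.finite_toSet.insert 1).isCompact).mul hUc.inv
  have hQinv : IsCompact Q⁻¹ := hQ.inv
  obtain ⟨F, hF, hFc⟩ := hΓ _ hQinv (ε * ν.real (interior W) / (ν.real U + 1)) (by positivity)
  have hfin := finite_nbhdOf (h.finite_translRel hQinv) F
  have hsub : (F : Set Γ) ⊆ nbhdOf (translRel Γ Q⁻¹) F := by
    refine subset_nbhdOf (fun v => ?_) F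
    simp only [translRel, inv_mul_cancel, Set.mem_inv, inv_one]
    exact ⟨1, ⟨1, h1U, 1, by simp, by simp⟩, 1, by simpa using h1U, by simp⟩
  let A : Set G := ⋃ γ ∈ F, (γ : G) • U
  have hA : IsCompact A := F.finite_toSet.isCompact_biUnion fun γ _ => hUc.smul _
  have hAlow : F.card * ν.real (interior W) ≤ ν.real A := by
    have : ν.real (⋃ γ ∈ F, (γ : G) • interior W) = F.card * ν.real (interior W) := by
      rw [measureReal_biUnion_finset (h := ?_)]
      · simp [measureReal_def]
      · intro γ _ γ' _ hne
        exact (h.disjoint γ γ.2 γ' γ'.2 (fun e => hne (Subtype.ext e))).mono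
          (Set.smul_set_mono interior_subset) (Set.smul_set_mono interior_subset)
      · intro γ _
        exact (isOpen_interior.smul (γ : G)).measurableSet
      · intro γ _
        rw [measure_smul]
        exact measure_ne_top_of_subset interior_subset h.isCompact.measure_lt_top.ne
    rw [← this]
    refine measureReal_mono (Set.iUnion₂_mono fun γ _ => ?_) hA.measure_lt_top.ne
    exact Set.smul_set_mono (interior_subset.trans hWU)
  have hFpos : (0 : ℝ) < F.card := by exact_mod_cast hF.card_pos
  refine ⟨A, hA, lt_of_lt_of_le (by positivity) hAlow, fun q hq => ?_⟩
  have hout : (hfin.toFinset \ F).card ≤ ε * ν.real (interior W) / (ν.real U + 1) * F.card := by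
    have h2 : F ⊆ hfin.toFinset := fun v hv => by
      rw [Set.Finite.mem_toFinset]; exact hsub hv
    rw [Finset.cast_card_sdiff h2, ← Set.ncard_eq_toFinset_card _ hfin]
    linarith
  have hcov : (· * q) ⁻¹' A \ A ⊆ ⋃ γ ∈ hfin.toFinset \ F, (γ : G) • U := by
    rintro x ⟨hx, hxA⟩
    simp only [A, Set.mem_preimage, Set.mem_iUnion] at hx hxA ⊢
    obtain ⟨γ, hγ, u, hu, hux⟩ := hx
    obtain ⟨γ', hγ', hx'⟩ := h.cover x
    have hxm : x ∈ γ' • U := ⟨_, hx', by simp⟩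
    refine ⟨⟨γ', hγ'⟩, ?_, hxm⟩
    rw [Finset.mem_sdiff, Set.Finite.mem_toFinset]
    refine ⟨⟨γ, hγ, ?_⟩, fun hF' => hxA ⟨_, hF', hxm⟩⟩
    simp only [translRel, Set.mem_inv, mul_inv_rev, inv_inv]
    refine ⟨(γ'⁻¹ * x) * q, ⟨_, hx', q, by simp [hq], rfl⟩, u⁻¹, by simpa using hu, ?_⟩
    simp only [smul_eq_mul] at hux
    rw [mul_assoc γ'⁻¹, ← hux]
    simp [mul_assoc]
  calc ν.real ((· * q) ⁻¹' A \ A) ≤ ν.real (⋃ γ ∈ hfin.toFinset \ F, (γ : G) • U) := by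
        refine measureReal_mono hcov ?_
        exact ((Finset.finite_toSet _).isCompact_biUnion fun γ _ => hUc.smul _).measure_lt_top.ne
    _ ≤ ∑ γ ∈ hfin.toFinset \ F, ν.real ((γ : G) • U) := measureReal_biUnion_finset_le _ _
    _ = (hfin.toFinset \ F).card * ν.real U := by simp [measureReal_def]
    _ ≤ (ε * ν.real (interior W) / (ν.real U + 1) * F.card) * ν.real U := by gcongr
    _ = ε * (F.card * ν.real (interior W)) * (ν.real U / (ν.real U + 1)) := by ring
    _ ≤ ε * (F.card * ν.real (interior W)) * 1 := by
        gcongr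
        rw [div_le_one (by positivity)]
        linarith
    _ ≤ ε * ν.real A := by rw [mul_one]; gcongr

variable [T2Space G]

/-- Right translation multiplies the measure of a Følner set by the modular character, and enlarges
it by a factor of at most `1 + ε`. Hence the character is at most `1` at `g` and at `g⁻¹`. -/
lemma IsGroupNet.isUnimodularGroup (h : IsGroupNet Γ W) (hΓ : IsFolnerNet Γ) :
    IsUnimodularGroup G := by
  have hle : ∀ g : G, (Measure.modularCharacter g : ℝ) ≤ 1 := by
    intro g
    refine le_of_forall_pos_le_add fun ε hε => ?_
    obtain ⟨A, hA, hpos, hq⟩ := h.exists_folner_set hΓ {g} hε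
    have h1 := hq g (by simp)
    have h2 : (Measure.haar : Measure G).real ((· * g) ⁻¹' A) =
        Measure.modularCharacter g * (Measure.haar : Measure G).real A := by
      have := congrArg (fun m => m.real A) (map_mul_right_haar g)
      rw [map_measureReal_apply (measurable_mul_const g) hA.measurableSet] at this
      rw [this]
      simp [measureReal_def]
    have hfin : (Measure.haar : Measure G) ((· * g) ⁻¹' A) ≠ ∞ :=
      ((Homeomorph.mulRight g).isCompact_preimage.2 hA).measure_lt_top.ne
    have h3 : (Measure.haar : Measure G).real ((· * g) ⁻¹' A) ≤
        (Measure.haar : Measure G).real ((· * g) ⁻¹' A \ A) + (Measure.haar : Measure G).real A := by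
      refine (measureReal_mono ?_ ?_).trans (measureReal_union_le _ _)
      · exact fun x hx => (em (x ∈ A)).elim Or.inr fun h' => Or.inl ⟨hx, h'⟩
      · exact (measure_union_lt_top (measure_lt_top_of_subset Set.sdiff_subset hfin)
          hA.measure_lt_top).ne
    rw [h2] at h3
    have : Measure.modularCharacter g * (Measure.haar : Measure G).real A ≤
      (1 + ε) * (Measure.haar : Measure G).real A := by linarith
    exact le_of_mul_le_mul_right this hpos
  intro g
  have h1 : (Measure.modularCharacter g : ℝ) * Measure.modularCharacter g⁻¹ = 1 := by
    rw [← NNReal.coe_mul, ← map_mul, mul_inv_cancel, map_one, NNReal.coe_one]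
  refine NNReal.coe_injective (le_antisymm (hle g) ?_)
  rw [NNReal.coe_one, ← h1]
  exact mul_le_of_le_one_right (NNReal.coe_nonneg _) (hle g⁻¹)

omit [IsTopologicalGroup G] [LocallyCompactSpace G] [BorelSpace G] [T2Space G]
  [TopologicalSpace G] [Group G] in
lemma MeasureTheory.Lp.ae_abs_le_norm {ν : Measure G} (f : Lp ℝ ∞ ν) : ∀ᵐ x ∂ν, |f x| ≤ ‖f‖ := by
  filter_upwards [enorm_ae_le_eLpNormEssSup f ν] with x hx
  rw [Lp.norm_def, eLpNorm_exponent_top, ← Real.norm_eq_abs, ← toReal_enorm]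
  refine ENNReal.toReal_mono ?_ hx
  rw [← eLpNorm_exponent_top]
  exact Lp.eLpNorm_ne_top f

/-- The average of a bounded function over a set. -/
noncomputable def averageLinearMap (B : Set G) (hB : (Measure.haar : Measure G) B ≠ ∞) :
    Lp ℝ ∞ (Measure.haar : Measure G) →ₗ[ℝ] ℝ where
  toFun f := ((Measure.haar : Measure G).real B)⁻¹ * ∫ x in B, f x ∂Measure.haar
  map_add' f g := by
    have hi : ∀ f : Lp ℝ ∞ (Measure.haar : Measure G), IntegrableOn f B Measure.haar := fun f =>
      Measure.integrableOn_of_bounded hB (Lp.aestronglyMeasurable f)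
        (ae_restrict_of_ae (Lp.ae_abs_le_norm f))
    rw [integral_congr_ae (ae_restrict_of_ae (Lp.coeFn_add f g)), ← mul_add]
    exact congrArg _ (integral_add (hi f) (hi g))
  map_smul' c f := by
    rw [integral_congr_ae (ae_restrict_of_ae (Lp.coeFn_smul c f))]
    simp only [Pi.smul_apply, smul_eq_mul, RingHom.id_apply, integral_const_mul]
    ring

omit [T2Space G] in
lemma averageLinearMap_apply (B : Set G) (hB : (Measure.haar : Measure G) B ≠ ∞)
    (f : Lp ℝ ∞ (Measure.haar : Measure G)) : averageLinearMap B hB f =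
      ((Measure.haar : Measure G).real B)⁻¹ * ∫ x in B, f x ∂Measure.haar := rfl

/-- The Følner sets `A` are almost invariant on the right, so the averages are taken over `A⁻¹`,
which is almost invariant on the left. Unimodularity enters here: inversion must preserve Haar
measure. -/
lemma IsGroupNet.isAmenableGroup (h : IsGroupNet Γ W) (hΓ : IsFolnerNet Γ) :
    IsAmenableGroup G := by
  classical
  have : (Measure.haar : Measure G).IsMulRightInvariant :=
    (h.isUnimodularGroup hΓ).isMulRightInvariant
  have : (Measure.haar : Measure G).IsInvInvariant :=
    isInvInvariant_of_isMulRightInvariant_of_regular _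
  -- The directed index prescribes a finite set of translations and a tolerance; an ultrafilter
  -- finer than `atTop` eventually meets every such demand.
  choose A hA hpos hq using fun i : Finset G × ℕ =>
    h.exists_folner_set hΓ i.1 (Nat.one_div_pos_of_nat (n := i.2) (α := ℝ))
  set ν : Measure G := Measure.haar with hν
  have hAm : ∀ i, MeasurableSet (A i)⁻¹ := fun i => (hA i).inv.measurableSet
  have hAf : ∀ i, ν (A i)⁻¹ ≠ ∞ := fun i => (hA i).inv.measure_lt_top.ne
  have hAr : ∀ i, ν.real (A i)⁻¹ = ν.real (A i) := fun i => by
    rw [measureReal_def, measureReal_def, Measure.measure_inv]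
  obtain ⟨U, L, hU, hL⟩ := exists_linearMap_tendsto_ultrafilter Filter.atTop
    (fun i => averageLinearMap (A i)⁻¹ (hAf i)) (by
      intro i f
      rw [averageLinearMap_apply, abs_mul, abs_of_nonneg (by positivity), hAr,
        inv_mul_le_iff₀ (hpos i), mul_comm, ← hAr]
      exact norm_setIntegral_le_of_norm_le_const_ae' (f := f) (hAf i).lt_top
        ((Lp.ae_abs_le_norm f).mono fun x hx _ => hx))
  refine ⟨L, fun f hf => ?_, ?_, fun g f => ?_⟩
  · refine ge_of_tendsto (hL f) (Filter.Eventually.of_forall fun i => ?_)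
    rw [averageLinearMap_apply]
    refine mul_nonneg (by positivity) (integral_nonneg_of_ae (ae_restrict_of_ae ?_))
    exact (Lp.coeFn_nonneg f).2 hf
  · refine tendsto_nhds_unique (hL _) (tendsto_const_nhds.congr fun i => ?_)
    rw [averageLinearMap_apply, integral_congr_ae (ae_restrict_of_ae (MemLp.coeFn_toLp _)), hAr]
    simp only [integral_const, measureReal_restrict_apply_univ, smul_eq_mul, mul_one]
    rw [← hν, hAr, inv_mul_cancel₀ (hpos i).ne']
  · refine eq_of_sub_eq_zero ?_
    rw [← map_sub]
    have h0 : Filter.Tendsto (fun i : Finset G × ℕ => ‖f‖ * (2 * (1 / ((i.2 : ℝ) + 1)))) U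
        (nhds 0) := by
      have h1 : Filter.Tendsto (fun i : Finset G × ℕ => i.2) U Filter.atTop :=
        Filter.Tendsto.mono_left
          (by rw [← Filter.prod_atTop_atTop_eq]; exact Filter.tendsto_snd) hU
      simpa using ((tendsto_one_div_add_atTop_nhds_zero_nat.comp h1).const_mul 2).const_mul ‖f‖
    refine tendsto_nhds_unique (hL _) (squeeze_zero_norm' ?_ h0)
    have hev : ∀ᶠ i : Finset G × ℕ in U, g ∈ i.1 := by
      refine hU ?_
      filter_upwards [Filter.eventually_ge_atTop (({g}, 0) : Finset G × ℕ)] with i hi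
      exact hi.1 (by simp)
    filter_upwards [hev] with i hi
    rw [map_sub, averageLinearMap_apply, averageLinearMap_apply, ← mul_sub,
      integral_congr_ae (ae_restrict_of_ae
        (Lp.coeFn_compMeasurePreserving f (measurePreserving_mul_left ν g)))]
    have hpre : ∫ x in (A i)⁻¹, (f ∘ fun x => g * x) x ∂ν = ∫ x in g • (A i)⁻¹, f x ∂ν := by
      have := (measurePreserving_mul_left ν g).setIntegral_preimage_emb
        (MeasurableEquiv.mulLeft g).measurableEmbedding f (g • (A i)⁻¹)
      rw [← this]
      congr 2
      ext x
      simp [Set.mem_smul_set_iff_inv_smul_mem]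
    rw [hpre, Real.norm_eq_abs, abs_mul, abs_of_nonneg (by positivity), hAr,
      inv_mul_le_iff₀ (hpos i)]
    have hgf : ν (g • (A i)⁻¹) ≠ ∞ := by rw [measure_smul]; exact hAf i
    refine (abs_setIntegral_sub_setIntegral_le (c := ‖f‖) (Lp.ae_abs_le_norm f)
      (Lp.aestronglyMeasurable f) ((hAm i).const_smul g) (hAm i) hgf (hAf i)).trans ?_
    have e1 : ν.real (g • (A i)⁻¹ \ (A i)⁻¹) = ν.real ((· * g) ⁻¹' A i \ A i) := by
      rw [measureReal_def, measureReal_def, ← Measure.measure_inv ν ((· * g) ⁻¹' A i \ A i)]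
      congr 2
      ext x
      simp [Set.mem_smul_set_iff_inv_smul_mem]
    -- Two sets of equal finite measure have differences of equal measure, so a one-sided Følner
    -- estimate suffices.
    have e2 : ν.real ((A i)⁻¹ \ g • (A i)⁻¹) = ν.real (g • (A i)⁻¹ \ (A i)⁻¹) := by
      have i1 := measureReal_inter_add_sdiff (s := (A i)⁻¹) (t := g • (A i)⁻¹) (μ := ν)
        ((hAm i).const_smul g) (hAf i)
      have i2 := measureReal_inter_add_sdiff (s := g • (A i)⁻¹) (t := (A i)⁻¹) (μ := ν) (hAm i) hgf
      have i3 : ν.real (g • (A i)⁻¹) = ν.real (A i)⁻¹ := by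
        rw [measureReal_def, measureReal_def, measure_smul]
      rw [Set.inter_comm] at i2
      linarith
    rw [e2, e1]
    have := hq i g hi
    have hfn := norm_nonneg f
    calc ‖f‖ * (ν.real ((· * g) ⁻¹' A i \ A i) + ν.real ((· * g) ⁻¹' A i \ A i))
        ≤ ‖f‖ * (1 / ((i.2 : ℝ) + 1) * ν.real (A i) + 1 / ((i.2 : ℝ) + 1) * ν.real (A i)) := by
          gcongr
      _ = _ := by ring

end

/-! ### Left-invariant functionals and sums of translates -/

section

open CompactlySupported

variable {G : Type*} [Group G] [TopologicalSpace G] [IsTopologicalGroup G]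

/-- The function `x ↦ ψ (g * x)`. -/
def leftTranslate (g : G) (ψ : C_c(G, ℝ)) : C_c(G, ℝ) where
  toFun x := ψ (g * x)
  hasCompactSupport' := ψ.hasCompactSupport.comp_homeomorph (Homeomorph.mulLeft g)

/-- The function `x ↦ ψ (x * g)`. -/
def rightTranslate (g : G) (ψ : C_c(G, ℝ)) : C_c(G, ℝ) where
  toFun x := ψ (x * g)
  hasCompactSupport' := ψ.hasCompactSupport.comp_homeomorph (Homeomorph.mulRight g)

@[simp] lemma leftTranslate_apply (g : G) (ψ : C_c(G, ℝ)) (x : G) :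
    leftTranslate g ψ x = ψ (g * x) := rfl

@[simp] lemma rightTranslate_apply (g : G) (ψ : C_c(G, ℝ)) (x : G) :
    rightTranslate g ψ x = ψ (x * g) := rfl

section Riesz

variable [LocallyCompactSpace G] [T2Space G] [MeasurableSpace G] [BorelSpace G]

/-- The Riesz measure of `Λ` inherits left invariance, so uniqueness of Haar measure applies. -/
lemma exists_eq_mul_integral_haar (Λ : C_c(G, ℝ) →ₚ[ℝ] ℝ)
    (hΛ : ∀ g ψ, Λ (leftTranslate g ψ) = Λ ψ) :
    ∃ n : ℝ, ∀ ψ : C_c(G, ℝ), Λ ψ = n * ∫ x, ψ x ∂(Measure.haar : Measure G) := by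
  let ν := RealRMK.rieszMeasure Λ
  have hν : ∀ ψ : C_c(G, ℝ), ∫ x, ψ x ∂ν = Λ ψ := RealRMK.integral_rieszMeasure Λ
  have : ν.IsMulLeftInvariant := by
    refine ⟨fun g => ?_⟩
    have : (Measure.map (g * ·) ν).Regular := Measure.Regular.map (Homeomorph.mulLeft g)
    refine Measure.ext_of_integral_eq_on_compactlySupported fun ψ => ?_
    rw [hν, ← hΛ g ψ, ← hν]
    exact integral_map (measurable_const_mul g).aemeasurable ψ.continuous.aestronglyMeasurable
  refine ⟨Measure.haarScalarFactor ν Measure.haar, fun ψ => ?_⟩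
  rw [← hν]
  refine (Measure.integral_isMulLeftInvariant_eq_smul_of_hasCompactSupport ν Measure.haar
    ψ.continuous ψ.hasCompactSupport).trans ?_
  rw [integral_smul_nnreal_measure]
  rfl

end Riesz

variable {I : Type*}

/-- Every translate of a compact set contains boundedly many values of `j`. -/
def IsUniformlyDiscrete (j : I → G) : Prop :=
  ∀ Q : Set G, IsCompact Q → ∃ N : ℕ, ∀ g : G, {γ | g⁻¹ * j γ ∈ Q}.encard ≤ N

lemma IsGroupNet.isUniformlyDiscrete [LocallyCompactSpace G] {Γ W : Set G} (h : IsGroupNet Γ W) :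
    IsUniformlyDiscrete (fun γ : Γ => (γ : G)) := fun _ hQ => h.exists_encard_le hQ

/-- If `j' γ` lies in `g K`, then `j γ` lies in `g K Q⁻¹`. -/
lemma IsUniformlyDiscrete.of_displacement {j j' : I → G} (hj : IsUniformlyDiscrete j) {Q : Set G}
    (hQ : IsCompact Q) (hjj' : ∀ γ, (j γ)⁻¹ * j' γ ∈ Q) : IsUniformlyDiscrete j' := by
  intro K hK
  obtain ⟨N, hN⟩ := hj (K * Q⁻¹) (hK.mul hQ.inv)
  refine ⟨N, fun g => (Set.encard_le_encard fun γ hγ => ?_).trans (hN g)⟩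
  exact ⟨_, hγ, _, Set.inv_mem_inv.2 (hjj' γ), by simp [mul_assoc]⟩

/-- The sum `∑ c γ * ψ (x * j γ)`. -/
noncomputable def translateSum (ψ : C_c(G, ℝ)) (c : I → ℝ) (j : I → G) (x : G) : ℝ :=
  ∑ᶠ γ, c γ * ψ (x * j γ)

omit [IsTopologicalGroup G] in
lemma IsUniformlyDiscrete.finite_setOf {j : I → G} (hj : IsUniformlyDiscrete j) {Q : Set G}
    (hQ : IsCompact Q) (x : G) : {γ | x * j γ ∈ Q}.Finite := by
  obtain ⟨N, hN⟩ := hj Q hQ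
  have := hN x⁻¹
  rw [inv_inv] at this
  exact Set.finite_of_encard_le_coe this

omit [IsTopologicalGroup G] in
lemma support_mul_translate_subset (ψ : C_c(G, ℝ)) (c : I → ℝ) (j : I → G) (x : G) :
    Function.support (fun γ => c γ * ψ (x * j γ)) ⊆ {γ | x * j γ ∈ tsupport ψ} := fun γ hγ =>
  subset_tsupport ψ (by
    simp only [Function.mem_support, ne_eq, mul_eq_zero, not_or] at hγ
    exact hγ.2)

omit [IsTopologicalGroup G] in
lemma IsUniformlyDiscrete.finite_support {j : I → G} (hj : IsUniformlyDiscrete j) (ψ : C_c(G, ℝ))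
    (c : I → ℝ) (x : G) : (Function.support fun γ => c γ * ψ (x * j γ)).Finite :=
  (hj.finite_setOf ψ.hasCompactSupport.isCompact x).subset (support_mul_translate_subset ψ c j x)

section Basic

variable {j : I → G} (hj : IsUniformlyDiscrete j)
include hj

lemma IsUniformlyDiscrete.continuous_translateSum [LocallyCompactSpace G] (ψ : C_c(G, ℝ))
    (c : I → ℝ) : Continuous (translateSum ψ c j) := by
  refine continuous_finsum (fun γ => by fun_prop) fun x => ?_
  obtain ⟨C, hC, hCx⟩ := exists_compact_mem_nhds x
  refine ⟨C, hCx, ?_⟩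
  refine (hj.finite_setOf (hC.inv.mul ψ.hasCompactSupport.isCompact) 1).subset ?_
  rintro γ ⟨y, hy, hyC⟩
  have := support_mul_translate_subset ψ c j y (by exact hy)
  simp only [one_mul, Set.mem_ofPred_eq] at this ⊢
  exact ⟨y⁻¹, Set.inv_mem_inv.2 hyC, _, this, by simp⟩

omit [IsTopologicalGroup G] in
lemma IsUniformlyDiscrete.exists_abs_translateSum_le (ψ : C_c(G, ℝ)) {c : I → ℝ}
    (hc : ∀ γ, |c γ| ≤ 1) : ∃ B : ℝ, ∀ x, |translateSum ψ c j x| ≤ B := by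
  obtain ⟨N, hN⟩ := hj _ ψ.hasCompactSupport.isCompact
  obtain ⟨M, hM⟩ := ψ.continuous.bounded_above_of_compact_support ψ.hasCompactSupport
  refine ⟨N * M, fun x => ?_⟩
  have hfin := hj.finite_setOf ψ.hasCompactSupport.isCompact x
  have hcard : hfin.toFinset.card ≤ N := by
    have := hN x⁻¹
    rw [inv_inv, hfin.encard_eq_coe_toFinset_card] at this
    exact_mod_cast this
  rw [translateSum, finsum_eq_sum_of_support_subset _ (s := hfin.toFinset)
    (by simpa using support_mul_translate_subset ψ c j x)]
  have hM0 : 0 ≤ M := (norm_nonneg _).trans (hM 1)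
  calc _ ≤ ∑ γ ∈ hfin.toFinset, |c γ * ψ (x * j γ)| := Finset.abs_sum_le_sum_abs _ _
    _ ≤ ∑ γ ∈ hfin.toFinset, M := Finset.sum_le_sum fun γ _ => by
        rw [abs_mul]
        exact (mul_le_of_le_one_left (abs_nonneg _) (hc γ)).trans (hM _)
    _ = hfin.toFinset.card * M := by simp
    _ ≤ N * M := by gcongr

omit [IsTopologicalGroup G] in
lemma IsUniformlyDiscrete.translateSum_add (ψ φ : C_c(G, ℝ)) (c : I → ℝ) (x : G) :
    translateSum (ψ + φ) c j x = translateSum ψ c j x + translateSum φ c j x := by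
  rw [translateSum, translateSum, translateSum,
    ← finsum_add_distrib (hj.finite_support ψ c x) (hj.finite_support φ c x)]
  simp [mul_add]

omit hj [IsTopologicalGroup G] in
lemma translateSum_smul (r : ℝ) (ψ : C_c(G, ℝ)) (c : I → ℝ) (x : G) :
    translateSum (r • ψ) c j x = r * translateSum ψ c j x := by
  rw [translateSum, translateSum, ← smul_eq_mul, smul_finsum]
  simp only [CompactlySupportedContinuousMap.smul_apply, smul_eq_mul]
  congr 1; ext γ; ring

omit hj in
lemma translateSum_leftTranslate (g : G) (ψ : C_c(G, ℝ)) (c : I → ℝ) (x : G) :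
    translateSum (leftTranslate g ψ) c j x = translateSum ψ c j (g * x) := by
  simp [translateSum, mul_assoc]

omit hj [IsTopologicalGroup G] in
lemma translateSum_nonneg {ψ : C_c(G, ℝ)} (hψ : 0 ≤ ψ) {c : I → ℝ} (hc : 0 ≤ c) (x : G) :
    0 ≤ translateSum ψ c j x :=
  finsum_nonneg fun γ => mul_nonneg (hc γ) (hψ _)

end Basic

end

/-! ### Invariant means on continuous functions -/

section Mean

open CompactlySupported

variable {G : Type*} [Group G] [TopologicalSpace G] [IsTopologicalGroup G]
  [LocallyCompactSpace G] [MeasurableSpace G] [BorelSpace G]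

/-- A left-invariant mean on bounded continuous functions. The values on other functions are
irrelevant. -/
structure IsContinuousMean (m : (G → ℝ) → ℝ) : Prop where
  add : ∀ f g, Continuous f → Continuous g → (∃ B, ∀ x, |f x| ≤ B) → (∃ B, ∀ x, |g x| ≤ B) →
    m (fun x => f x + g x) = m f + m g
  smul : ∀ (r : ℝ) f, Continuous f → (∃ B, ∀ x, |f x| ≤ B) → m (fun x => r * f x) = r * m f
  mono : ∀ f g, Continuous f → Continuous g → (∃ B, ∀ x, |f x| ≤ B) → (∃ B, ∀ x, |g x| ≤ B) →
    (∀ x, f x ≤ g x) → m f ≤ m g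
  one : m (fun _ => 1) = 1
  translate : ∀ (g : G) f, Continuous f → (∃ B, ∀ x, |f x| ≤ B) → m (fun x => f (g * x)) = m f

lemma IsAmenableGroup.exists_isContinuousMean (hG : IsAmenableGroup G) :
    ∃ m : (G → ℝ) → ℝ, IsContinuousMean m := by
  classical
  obtain ⟨m, hpos, hone, hinv⟩ := hG
  have hL : ∀ f : G → ℝ, Continuous f → (∃ B, ∀ x, |f x| ≤ B) →
      MemLp f ∞ (Measure.haar : Measure G) := fun f hf ⟨B, hB⟩ =>
    memLp_top_of_bound hf.aestronglyMeasurable B (Filter.Eventually.of_forall hB)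
  let m' : (G → ℝ) → ℝ := fun f =>
    if h : MemLp f ∞ (Measure.haar : Measure G) then m h.toLp else 0
  have hm' : ∀ f (h : MemLp f ∞ (Measure.haar : Measure G)), m' f = m h.toLp := fun f h =>
    dif_pos h
  refine ⟨m', ⟨fun f g hf hg bf bg => ?_, fun r f hf bf => ?_, fun f g hf hg bf bg hfg => ?_, ?_,
    fun g f hf bf => ?_⟩⟩
  · rw [hm' f (hL f hf bf), hm' g (hL g hg bg), ← map_add, ← MemLp.toLp_add]
    exact hm' _ _
  · rw [hm' f (hL f hf bf), ← smul_eq_mul, ← map_smul, ← MemLp.toLp_const_smul]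
    exact hm' _ _
  · rw [hm' f (hL f hf bf), hm' g (hL g hg bg), ← sub_nonneg, ← map_sub, ← MemLp.toLp_sub]
    refine hpos _ ((Lp.coeFn_nonneg _).1 ?_)
    filter_upwards [MemLp.coeFn_toLp ((hL g hg bg).sub (hL f hf bf))] with x hx
    rw [hx]
    exact sub_nonneg.2 (hfg x)
  · rw [hm' _ (memLp_top_const (1 : ℝ)), hone]
  · rw [hm' f (hL f hf bf), ← hinv g]
    exact hm' _ ((hL f hf bf).comp_measurePreserving (measurePreserving_mul_left _ g))

variable {m : (G → ℝ) → ℝ} {I : Type*} {j : I → G}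

/-- Translating `ψ` on the left translates the sum, which the mean ignores, so this is a positive
left-invariant functional of `ψ`. The constant `n` is the mean density of the weighted points `j γ`.
-/
lemma IsContinuousMean.exists_eq_mul_integral [T2Space G] (hm : IsContinuousMean m)
    (hj : IsUniformlyDiscrete j)
    {c : I → ℝ} (hc0 : 0 ≤ c) (hc1 : c ≤ 1) :
    ∃ n : ℝ, ∀ ψ : C_c(G, ℝ), m (translateSum ψ c j) =
      n * ∫ x, ψ x ∂(Measure.haar : Measure G) := by
  have hc : ∀ γ, |c γ| ≤ 1 := fun γ => by rw [abs_of_nonneg (hc0 γ)]; exact hc1 γ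
  have hcont := fun ψ => hj.continuous_translateSum ψ c
  have hb := fun ψ => hj.exists_abs_translateSum_le ψ hc
  have h0 : m (fun _ => 0) = 0 := by
    have := hm.smul 0 (fun _ => 0) continuous_const ⟨0, by simp⟩
    simpa using this
  let Λ : C_c(G, ℝ) →ₚ[ℝ] ℝ := PositiveLinearMap.mk₀
    { toFun := fun ψ => m (translateSum ψ c j)
      map_add' := fun ψ φ => by
        rw [← hm.add _ _ (hcont ψ) (hcont φ) (hb ψ) (hb φ)]
        exact congrArg m (funext fun x => hj.translateSum_add ψ φ c x)
      map_smul' := fun r ψ => by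
        rw [RingHom.id_apply, smul_eq_mul, ← hm.smul _ _ (hcont ψ) (hb ψ)]
        exact congrArg m (funext fun x => translateSum_smul r ψ c x) }
    (fun ψ hψ => by
      rw [← h0]
      exact hm.mono _ _ continuous_const (hcont ψ) ⟨0, by simp⟩ (hb ψ)
        fun x => translateSum_nonneg hψ hc0 x)
  refine exists_eq_mul_integral_haar Λ fun g ψ => ?_
  change m (translateSum (leftTranslate g ψ) c j) = m (translateSum ψ c j)
  rw [← hm.translate g _ (hcont ψ) (hb ψ)]
  exact congrArg m (funext fun x => translateSum_leftTranslate g ψ c x)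

omit [IsTopologicalGroup G] [LocallyCompactSpace G] [MeasurableSpace G] [BorelSpace G] in
lemma IsContinuousMean.sum (hm : IsContinuousMean m) {κ : Type*} (s : Finset κ) (f : κ → G → ℝ)
    (hf : ∀ k, Continuous (f k)) (hb : ∀ k, ∃ B, ∀ x, |f k x| ≤ B) :
    m (fun x => ∑ k ∈ s, f k x) = ∑ k ∈ s, m (f k) := by
  classical
  have h0 : m (fun _ => 0) = 0 := by
    have := hm.smul 0 (fun _ => 0) continuous_const ⟨0, by simp⟩
    simpa using this
  choose B hB using hb
  induction s using Finset.induction_on with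
  | empty => simpa using h0
  | insert a s ha ih =>
    simp only [Finset.sum_insert ha]
    rw [← ih]
    refine hm.add _ _ (hf a) (continuous_finsetSum _ fun k _ => hf k) ⟨_, hB a⟩
      ⟨∑ k ∈ s, B k, fun x => (Finset.abs_sum_le_sum_abs _ _).trans ?_⟩
    exact Finset.sum_le_sum fun k _ => hB k x

omit [LocallyCompactSpace G] [MeasurableSpace G] [BorelSpace G] in
lemma translateSum_eq_sum (hj : IsUniformlyDiscrete j) (ψ : C_c(G, ℝ)) {κ : Type*}
    [DecidableEq κ] (t : Finset κ) (k : I → κ) (hk : ∀ γ, k γ ∈ t) (q : κ → G) (x : G) :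
    translateSum ψ 1 (fun γ => j γ * q (k γ)) x =
      ∑ a ∈ t, translateSum (rightTranslate (q a) ψ) (fun γ => if k γ = a then 1 else 0) j x := by
  simp only [translateSum]
  rw [← finsum_sum_comm _ _ fun a _ => hj.finite_support _ _ x]
  refine finsum_congr fun γ => ?_
  simp [Finset.sum_ite_eq, hk, mul_assoc]

variable [T2Space G]

/-- Bounded displacements that take finitely many values do not change the mean. -/
lemma IsContinuousMean.translateSum_finite_displacement (hm : IsContinuousMean m)
    (hG : IsUnimodularGroup G) (hj : IsUniformlyDiscrete j) (ψ : C_c(G, ℝ)) {κ : Type*}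
    [DecidableEq κ] (t : Finset κ) (k : I → κ) (hk : ∀ γ, k γ ∈ t) (q : κ → G) :
    m (translateSum ψ 1 (fun γ => j γ * q (k γ))) = m (translateSum ψ 1 j) := by
  have := hG.isMulRightInvariant
  have hc : ∀ a : κ, ∀ γ : I, |(fun γ => if k γ = a then (1 : ℝ) else 0) γ| ≤ 1 := fun a γ => by
    simp only; split_ifs <;> simp
  have key : ∀ q : κ → G, m (translateSum ψ 1 (fun γ => j γ * q (k γ))) =
        ∑ a ∈ t, m (translateSum (rightTranslate (q a) ψ)
          (fun γ => if k γ = a then 1 else 0) j) := by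
    intro q
    rw [← hm.sum t _ (fun a => hj.continuous_translateSum _ _)
      (fun a => hj.exists_abs_translateSum_le _ (hc a))]
    exact congrArg m (funext fun x => translateSum_eq_sum hj ψ t k hk q x)
  -- The same partition of the indices with trivial displacements decomposes the undisplaced sum, so
  -- the two sides are compared label by label.
  have key1 := key fun _ => 1
  simp only [mul_one] at key1
  rw [key q, key1]
  refine Finset.sum_congr rfl fun a _ => ?_
  obtain ⟨n, hn⟩ := hm.exists_eq_mul_integral hj
    (c := fun γ => if k γ = a then 1 else 0) (fun γ => by
      simp only [Pi.zero_apply]; split_ifs <;> simp) (fun γ => by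
      simp only [Pi.one_apply]; split_ifs <;> simp)
  rw [hn, hn]
  congr 1
  simp only [rightTranslate_apply, mul_one]
  -- This is where unimodularity enters: the displacement `q a` becomes a right translation of `ψ`,
  -- which has the same Haar integral.
  exact integral_mul_right_eq_self ψ (q a)

/-- By the tube lemma, `ψ (x q)` depends continuously on `q` uniformly for `x` in the compact set
`tsupport ψ * Q⁻¹`. Outside this set it vanishes for all `q ∈ Q`. Compactness of `Q` gives finitely
many representatives. -/
lemma exists_finite_rightTranslate_approx {G : Type*} [Group G] [TopologicalSpace G]
    [IsTopologicalGroup G] (ψ : C_c(G, ℝ)) {Q : Set G} (hQ : IsCompact Q) {ε : ℝ} (hε : 0 < ε) :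
    ∃ t : Finset G, (t : Set G) ⊆ Q ∧ ∀ q ∈ Q, ∃ a ∈ t, ∀ x, |ψ (x * q) - ψ (x * a)| ≤ ε := by
  let C : Set G := tsupport ψ * Q⁻¹
  have hC : IsCompact C := ψ.hasCompactSupport.isCompact.mul hQ.inv
  have h1 : ∀ a ∈ Q, ∃ v : Set G, IsOpen v ∧ a ∈ v ∧
      ∀ q ∈ v, ∀ x ∈ C, |ψ (x * q) - ψ (x * a)| < ε := by
    intro a _
    have ho : IsOpen {p : G × G | |ψ (p.1 * p.2) - ψ (p.1 * a)| < ε} :=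
      isOpen_lt (by fun_prop) continuous_const
    obtain ⟨u, v, -, hv, hCu, hav, huv⟩ := generalized_tube_lemma hC (isCompact_singleton (x := a))
      ho (by rintro ⟨x, y⟩ ⟨-, rfl⟩; simpa using hε)
    exact ⟨v, hv, hav rfl, fun q hq x hx => huv (Set.mk_mem_prod (hCu hx) hq)⟩
  choose! v hvo hav hv using h1
  obtain ⟨t, htQ, htc⟩ := hQ.elim_nhds_subcover v fun a ha => (hvo a ha).mem_nhds (hav a ha)
  refine ⟨t, htQ, fun q hq => ?_⟩
  obtain ⟨a, hat, hqa⟩ := Set.mem_iUnion₂.1 (htc hq)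
  refine ⟨a, hat, fun x => ?_⟩
  by_cases hx : x ∈ C
  · exact (hv a (htQ a hat) q hqa x hx).le
  · have h0 : ∀ b ∈ Q, ψ (x * b) = 0 := fun b hb => by
      by_contra h
      exact hx ⟨_, subset_tsupport ψ h, _, Set.inv_mem_inv.2 hb, by simp⟩
    rw [h0 q hq, h0 a (htQ a hat)]
    simpa using hε.le

omit [IsTopologicalGroup G] [LocallyCompactSpace G] [MeasurableSpace G] [BorelSpace G]
  [T2Space G] in
lemma IsUniformlyDiscrete.abs_translateSum_sub_le {j₁ j₂ : I → G} (hj : IsUniformlyDiscrete j)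
    (hj₁ : IsUniformlyDiscrete j₁) (hj₂ : IsUniformlyDiscrete j₂) (ψ χ : C_c(G, ℝ)) {ε : ℝ}
    {x : G} (h : ∀ γ, |ψ (x * j₁ γ) - ψ (x * j₂ γ)| ≤ ε * χ (x * j γ)) :
    |translateSum ψ 1 j₁ x - translateSum ψ 1 j₂ x| ≤ ε * translateSum χ 1 j x := by
  classical
  simp only [translateSum]
  have h1 := hj₁.finite_support ψ 1 x
  have h2 := hj₂.finite_support ψ 1 x
  have h3 := hj.finite_support χ 1 x
  let s := h1.toFinset ∪ h2.toFinset ∪ h3.toFinset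
  have e1 := finsum_eq_sum_of_support_subset (fun γ => (1 : I → ℝ) γ * ψ (x * j₁ γ)) (s := s)
    (fun γ hγ => by simp only [s, Finset.coe_union, Set.Finite.coe_toFinset]; exact .inl (.inl hγ))
  have e2 := finsum_eq_sum_of_support_subset (fun γ => (1 : I → ℝ) γ * ψ (x * j₂ γ)) (s := s)
    (fun γ hγ => by simp only [s, Finset.coe_union, Set.Finite.coe_toFinset]; exact .inl (.inr hγ))
  have e3 := finsum_eq_sum_of_support_subset (fun γ => (1 : I → ℝ) γ * χ (x * j γ)) (s := s)
    (fun γ hγ => by simp only [s, Finset.coe_union, Set.Finite.coe_toFinset]; exact .inr hγ)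
  rw [e1, e2, e3, ← Finset.sum_sub_distrib, Finset.mul_sum]
  refine (Finset.abs_sum_le_sum_abs _ _).trans (Finset.sum_le_sum fun γ _ => ?_)
  simpa using h γ

/-- Bounded displacements do not change the mean. -/
lemma IsContinuousMean.translateSum_displacement (hm : IsContinuousMean m)
    (hG : IsUnimodularGroup G) (hj : IsUniformlyDiscrete j) {j' : I → G} {Q : Set G}
    (hQ : IsCompact Q) (hjj' : ∀ γ, (j γ)⁻¹ * j' γ ∈ Q) (ψ : C_c(G, ℝ)) :
    m (translateSum ψ 1 j') = m (translateSum ψ 1 j) := by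
  classical
  have hj'd := hj.of_displacement hQ hjj'
  let C : Set G := tsupport ψ * Q⁻¹
  have hC : IsCompact C := ψ.hasCompactSupport.isCompact.mul hQ.inv
  -- The bump `χ` localizes the error of approximating displacements by finitely many: a term errs
  -- by at most `ε`, and only where `x * j γ ∈ C`. The total error is then controlled by the finite
  -- mean of the sum for `χ`.
  obtain ⟨χ₀, hχ1, -, hχc, hχ0⟩ := exists_continuous_one_zero_of_isCompact hC isClosed_empty
    (Set.disjoint_empty C)
  let χ : C_c(G, ℝ) := ⟨χ₀, hχc⟩
  have hone : ∀ γ : I, |(1 : I → ℝ) γ| ≤ 1 := fun γ => by simp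
  have hcont := fun (φ : C_c(G, ℝ)) {j : I → G} (hj : IsUniformlyDiscrete j) =>
    hj.continuous_translateSum φ 1
  have hbdd := fun (φ : C_c(G, ℝ)) {j : I → G} (hj : IsUniformlyDiscrete j) =>
    hj.exists_abs_translateSum_le φ hone
  have key : ∀ ε : ℝ, 0 < ε → |m (translateSum ψ 1 j') - m (translateSum ψ 1 j)| ≤
      ε * m (translateSum χ 1 j) := by
    intro ε hε
    obtain ⟨t, htQ, ht⟩ := exists_finite_rightTranslate_approx ψ hQ hε
    choose k hkt hk using fun γ => ht _ (hjj' γ)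
    have hj'' : IsUniformlyDiscrete fun γ => j γ * id (k γ) :=
      hj.of_displacement hQ fun γ => by simpa using htQ (hkt γ)
    rw [← hm.translateSum_finite_displacement hG hj ψ t k hkt id]
    have hpt : ∀ x, |translateSum ψ 1 j' x - translateSum ψ 1 (fun γ => j γ * id (k γ)) x| ≤
        ε * translateSum χ 1 j x := by
      intro x
      refine hj.abs_translateSum_sub_le hj'd hj'' ψ χ fun γ => ?_
      have e : x * j' γ = x * j γ * ((j γ)⁻¹ * j' γ) := by group
      have e' : x * (j γ * id (k γ)) = x * j γ * k γ := (mul_assoc _ _ _).symm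
      rw [e, e']
      by_cases hx : x * j γ ∈ C
      · have : χ (x * j γ) = 1 := hχ1 hx
        rw [this, mul_one]
        exact hk γ _
      · have h0 : ∀ b ∈ Q, ψ (x * j γ * b) = 0 := fun b hb => by
          by_contra h
          exact hx ⟨_, subset_tsupport ψ h, _, Set.inv_mem_inv.2 hb, by simp⟩
        rw [h0 _ (hjj' γ), h0 _ (htQ (hkt γ)), sub_zero, abs_zero]
        exact mul_nonneg hε.le (hχ0 _).1
    have hεm := hm.smul ε _ (hcont χ hj) (hbdd χ hj)
    have hεc : Continuous fun x => ε * translateSum χ 1 j x := (hcont χ hj).const_mul ε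
    have hεb : ∃ B, ∀ x, |ε * translateSum χ 1 j x| ≤ B := by
      obtain ⟨B, hB⟩ := hbdd χ hj
      exact ⟨|ε| * B, fun x => by rw [abs_mul]; gcongr; exact hB x⟩
    have hle : ∀ {j₁ j₂ : I → G}, IsUniformlyDiscrete j₁ → IsUniformlyDiscrete j₂ →
        (∀ x, |translateSum ψ 1 j₁ x - translateSum ψ 1 j₂ x| ≤ ε * translateSum χ 1 j x) →
        m (translateSum ψ 1 j₁) ≤ m (translateSum ψ 1 j₂) + ε * m (translateSum χ 1 j) := by
      intro j₁ j₂ h1 h2 h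
      rw [← hεm, ← hm.add _ _ (hcont ψ h2) hεc (hbdd ψ h2) hεb]
      obtain ⟨B, hB⟩ := hbdd ψ h2
      obtain ⟨B', hB'⟩ := hεb
      refine hm.mono _ _ (hcont ψ h1) ((hcont ψ h2).add hεc) (hbdd ψ h1)
        ⟨B + B', fun x => (abs_add_le _ _).trans (add_le_add (hB x) (hB' x))⟩ fun x => ?_
      have := (abs_le.1 (h x)).2
      linarith
    have l1 := hle hj'd hj'' hpt
    have l2 := hle hj'' hj'd fun x => by rw [abs_sub_comm]; exact hpt x
    exact abs_le.2 ⟨by linarith, by linarith⟩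
  have hle0 : |m (translateSum ψ 1 j') - m (translateSum ψ 1 j)| ≤ 0 := by
    have ht : Filter.Tendsto (fun ε : ℝ => ε * m (translateSum χ 1 j)) (nhdsWithin 0 (Set.Ioi 0))
        (nhds 0) := by
      have : Filter.Tendsto (fun ε : ℝ => ε * m (translateSum χ 1 j)) (nhds 0)
        (nhds (0 * m (translateSum χ 1 j))) := Filter.tendsto_id.mul_const _
      rw [zero_mul] at this
      exact this.mono_left nhdsWithin_le_nhds
    refine ge_of_tendsto ht ?_
    filter_upwards [self_mem_nhdsWithin] with ε hε using key ε hε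
  exact sub_eq_zero.1 (abs_nonpos_iff.1 hle0)

/-- Doubling gives two disjoint copies of `Γ` inside `Γ` at bounded displacement. Each copy has the
same mean as `Γ`, so twice this mean is at most itself. The mean is at least `1`, because `ψ = 1` on
`(W / W)⁻¹` and the net covers `G`. -/
lemma IsGroupNet.not_isDoubling {Γ W : Set G} (h : IsGroupNet Γ W) (hG : IsUnimodularGroup G)
    (hG' : IsAmenableGroup G) {Q : Set G} (hQ : IsCompact Q) :
    ¬ IsDoubling (translRel Γ Q) := by
  intro hd
  obtain ⟨m, hm⟩ := hG'.exists_isContinuousMean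
  obtain ⟨f, hf, hfQ⟩ := hd.exists_injective (h.finite_translRel hQ)
  have hj := h.isUniformlyDiscrete
  have hone : ∀ γ : Γ, |(1 : Γ → ℝ) γ| ≤ 1 := fun γ => by simp
  have hU : IsCompact (W / W)⁻¹ := by
    rw [div_eq_mul_inv]; exact (h.isCompact.mul h.isCompact.inv).inv
  obtain ⟨ψ₀, hψ1, -, hψc, hψ0⟩ := exists_continuous_one_zero_of_isCompact hU isClosed_empty
    (Set.disjoint_empty _)
  let ψ : C_c(G, ℝ) := ⟨ψ₀, hψc⟩
  have hψ : ∀ x, 0 ≤ ψ x := fun x => (hψ0 x).1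
  let j : Bool → Γ → G := fun b γ => f (γ, b)
  have hjQ : ∀ b (γ : Γ), (γ : G)⁻¹ * j b γ ∈ Q := fun b γ => hfQ (γ, b)
  have hjb : ∀ b, IsUniformlyDiscrete (j b) := fun b => hj.of_displacement hQ (hjQ b)
  have e : ∀ b, m (translateSum ψ 1 (j b)) = m (translateSum ψ 1 (fun γ : Γ => (γ : G))) :=
    fun b => hm.translateSum_displacement hG hj hQ (hjQ b) ψ
  have hc := fun b => (hjb b).continuous_translateSum ψ 1
  have hb := fun b => (hjb b).exists_abs_translateSum_le ψ hone
  have hsum : ∀ x, translateSum ψ 1 (j true) x + translateSum ψ 1 (j false) x ≤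
      translateSum ψ 1 (fun γ : Γ => (γ : G)) x := by
    classical
    intro x
    have hs := hj.finite_support ψ 1 x
    have hs1 := (hjb true).finite_support ψ 1 x
    have hs2 := (hjb false).finite_support ψ 1 x
    simp only [translateSum]
    let s : Finset Γ := hs1.toFinset ∪ hs2.toFinset
    rw [finsum_eq_sum_of_support_subset _ (s := s) (by
        intro γ hγ; simp only [s, Finset.coe_union, Set.Finite.coe_toFinset]; exact .inl hγ),
      finsum_eq_sum_of_support_subset _ (s := s) (by
        intro γ hγ; simp only [s, Finset.coe_union, Set.Finite.coe_toFinset]; exact .inr hγ),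
      finsum_eq_sum_of_support_subset _ (s := hs.toFinset ∪ (s ×ˢ Finset.univ).image f) (by
        intro γ hγ
        simp only [Finset.coe_union, Set.Finite.coe_toFinset]; exact .inl hγ)]
    have : ∑ γ ∈ s, (1 : Γ → ℝ) γ * ψ (x * j true γ) + ∑ γ ∈ s, (1 : Γ → ℝ) γ * ψ (x * j false γ) =
        ∑ γ ∈ (s ×ˢ Finset.univ).image f, (1 : Γ → ℝ) γ * ψ (x * γ) := by
      rw [Finset.sum_image hf.injOn, Finset.sum_product, ← Finset.sum_add_distrib]
      refine Finset.sum_congr rfl fun γ _ => ?_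
      simp [j]
    rw [this]
    exact Finset.sum_le_sum_of_subset_of_nonneg Finset.subset_union_right fun γ _ _ =>
      mul_nonneg zero_le_one (hψ _)
  have h2 := hm.mono (fun x => translateSum ψ 1 (j true) x + translateSum ψ 1 (j false) x) _
    ((hc true).add (hc false)) (hj.continuous_translateSum ψ 1) (by
    obtain ⟨B, hB⟩ := hb true
    obtain ⟨B', hB'⟩ := hb false
    exact ⟨B + B', fun x => (abs_add_le _ _).trans (add_le_add (hB x) (hB' x))⟩)
    (hj.exists_abs_translateSum_le ψ hone) hsum
  rw [hm.add _ _ (hc true) (hc false) (hb true) (hb false), e, e] at h2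
  have h3 := hm.mono _ _ (continuous_const (y := (1 : ℝ))) (hj.continuous_translateSum ψ 1)
    ⟨1, by simp⟩ (hj.exists_abs_translateSum_le ψ hone) (fun x => by
      obtain ⟨γ, hγ, hγx⟩ := h.cover x⁻¹
      have hx : ψ (x * γ) = 1 := hψ1 (Set.mem_inv.2 (by simpa using hγx))
      have := single_le_finsum (⟨γ, hγ⟩ : Γ) (hj.finite_support ψ 1 x)
        (fun γ => mul_nonneg zero_le_one (hψ _))
      simpa [hx, translateSum] using this)
  rw [hm.one] at h3
  linarith

lemma IsGroupNet.isFolnerNet_iff {Γ W : Set G} (h : IsGroupNet Γ W) :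
    IsFolnerNet Γ ↔ IsUnimodularGroup G ∧ IsAmenableGroup G := by
  refine ⟨fun hΓ => ⟨h.isUnimodularGroup hΓ, h.isAmenableGroup hΓ⟩, fun hG => ?_⟩
  by_contra hΓ
  obtain ⟨Q, hQ, hd⟩ := h.exists_isDoubling hΓ
  exact h.not_isDoubling hG.1 hG.2 hQ hd

end Mean

/-! ### Reversible Markov operators -/

section Reversible

variable {X : Type*} [MeasurableSpace X] {μ : Measure X} [SigmaFinite μ] {P : Kernel X X}
  [IsMarkovKernel P]

lemma measurePreserving_fst_compProd : MeasurePreserving Prod.fst (μ ⊗ₘ P) μ :=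
  ⟨measurable_fst, Measure.fst_compProd μ P⟩

lemma measurePreserving_snd_compProd (hP : P.Invariant μ) :
    MeasurePreserving Prod.snd (μ ⊗ₘ P) μ :=
  ⟨measurable_snd, by
    change (μ ⊗ₘ P).snd = μ
    rw [Measure.snd_compProd, hP.def]⟩

/-- Reversibility is symmetry of the joint law on rectangles; σ-finiteness of `μ` extends it to the
product σ-algebra. -/
lemma measurePreserving_swap_compProd (hP : P.IsReversible μ) :
    MeasurePreserving Prod.swap (μ ⊗ₘ P) (μ ⊗ₘ P) := by
  refine ⟨measurable_swap, ?_⟩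
  have hrect : ∀ s t : Set X, MeasurableSet s → MeasurableSet t →
      (μ ⊗ₘ P).map Prod.swap (s ×ˢ t) = (μ ⊗ₘ P) (s ×ˢ t) := by
    intro s t hs ht
    rw [Measure.map_apply measurable_swap (hs.prod ht), Set.preimage_swap_prod,
      Measure.compProd_apply_prod ht hs, Measure.compProd_apply_prod hs ht]
    exact hP ht hs
  refine Measure.ext_of_generateFrom_of_iUnion _ (fun n => spanningSets μ n ×ˢ Set.univ)
    generateFrom_prod.symm isPiSystem_prod ?_ ?_ ?_ ?_
  · rw [← Set.iUnion_prod_const, iUnion_spanningSets, Set.univ_prod_univ]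
  · exact fun n => ⟨_, measurableSet_spanningSets μ n, _, MeasurableSet.univ, rfl⟩
  · intro n
    rw [hrect _ _ (measurableSet_spanningSets μ n) MeasurableSet.univ,
      Measure.compProd_apply_prod (measurableSet_spanningSets μ n) MeasurableSet.univ]
    simpa using (measure_spanningSets_lt_top μ n).ne
  · rintro _ ⟨s, hs, t, ht, rfl⟩
    exact hrect s t hs ht

/-- Writing the form on the joint law makes self-adjointness a swap of coordinates, and makes the
Dirichlet energy accessible. -/
lemma inner_markovOperator (hP : P.Invariant μ) (f g : Lp ℂ 2 μ) :
    inner ℂ f (markovOperator μ P hP g) =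
      ∫ p, (starRingEnd ℂ) (f p.1) * g p.2 ∂(μ ⊗ₘ P) := by
  have hf := (Lp.memLp f).comp_measurePreserving (measurePreserving_fst_compProd (P := P))
  have hg := (Lp.memLp g).comp_measurePreserving (measurePreserving_snd_compProd hP)
  have hint : Integrable (fun p : X × X => (starRingEnd ℂ) (f p.1) * g p.2) (μ ⊗ₘ P) :=
    hf.star.integrable_mul hg
  rw [Measure.integral_compProd hint, L2.inner_def]
  refine integral_congr_ae ?_
  filter_upwards [markovOperator_ae_eq hP g] with x hx
  rw [hx, RCLike.inner_apply, integral_const_mul, mul_comm]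

lemma isSelfAdjoint_markovOperator (hP : P.IsReversible μ) :
    IsSelfAdjoint (markovOperator μ P hP.invariant) := by
  rw [ContinuousLinearMap.isSelfAdjoint_iff_isSymmetric]
  intro f g
  change inner ℂ (markovOperator μ P hP.invariant f) g =
    inner ℂ f (markovOperator μ P hP.invariant g)
  rw [← inner_conj_symm, inner_markovOperator, inner_markovOperator, ← integral_conj,
    ← (measurePreserving_swap_compProd hP).integral_comp
      MeasurableEquiv.prodComm.measurableEmbedding]
  refine integral_congr_ae (Filter.Eventually.of_forall fun p => ?_)
  simp [mul_comm]

omit [SigmaFinite μ] in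
lemma norm_markovOperator_le (hP : P.Invariant μ) : ‖markovOperator μ P hP‖ ≤ 1 :=
  LinearMap.mkContinuous_norm_le _ zero_le_one _

lemma markovSpectralRadius_eq (hP : P.IsReversible μ) :
    markovSpectralRadius μ P hP = ‖markovOperator μ P hP.invariant‖₊ :=
  (isSelfAdjoint_markovOperator hP).spectralRadius_eq_nnnorm

lemma markovSpectralRadius_le_one (hP : P.IsReversible μ) : markovSpectralRadius μ P hP ≤ 1 := by
  rw [markovSpectralRadius_eq]
  exact_mod_cast norm_markovOperator_le hP.invariant

omit [SigmaFinite μ] in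
/-- Nearly invariant vectors put `1` in the spectrum. -/
lemma one_mem_spectrum_markovOperator (hP : P.Invariant μ)
    (h : ∀ ε : ℝ, 0 < ε → ∃ f : Lp ℂ 2 μ, f ≠ 0 ∧ ‖markovOperator μ P hP f - f‖ ≤ ε * ‖f‖) :
    (1 : ℂ) ∈ spectrum ℂ (markovOperator μ P hP) := by
  rw [spectrum.mem_iff, map_one]
  rintro ⟨u, hu⟩
  set T := markovOperator μ P hP
  set S : Lp ℂ 2 μ →L[ℂ] Lp ℂ 2 μ := ↑u⁻¹ with hS
  have hST : ∀ f, S (f - T f) = f := by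
    intro f
    have h1 : (↑u⁻¹ * ↑u : Lp ℂ 2 μ →L[ℂ] Lp ℂ 2 μ) f = f := by rw [u.inv_mul]; rfl
    rw [hu] at h1
    exact h1
  -- This tolerance makes the inverse `S` yield `‖f‖ ≤ ‖f‖ / 2`; the `+ 1` avoids division by zero.
  obtain ⟨f, hf, hfT⟩ := h (1 / (2 * (‖S‖ + 1))) (by positivity)
  have hf0 : 0 < ‖f‖ := norm_pos_iff.2 hf
  have h1 : ‖f‖ ≤ ‖S‖ * ‖T f - f‖ := by
    conv_lhs => rw [← hST f]
    rw [norm_sub_rev]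
    exact S.le_opNorm _
  have h2 : ‖S‖ * ‖T f - f‖ ≤ (‖S‖ + 1) * (1 / (2 * (‖S‖ + 1)) * ‖f‖) := by
    gcongr
    linarith
  have h3 : (‖S‖ + 1) * (1 / (2 * (‖S‖ + 1)) * ‖f‖) = ‖f‖ / 2 := by
    field_simp
  linarith

lemma markovSpectralRadius_eq_one_of_mem (hP : P.IsReversible μ)
    (h : (1 : ℂ) ∈ spectrum ℂ (markovOperator μ P hP.invariant)) :
    markovSpectralRadius μ P hP = 1 := by
  refine le_antisymm (markovSpectralRadius_le_one hP) ?_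
  have := le_iSup₂ (f := fun k (_ : k ∈ spectrum ℂ (markovOperator μ P hP.invariant)) =>
    (‖k‖₊ : ℝ≥0∞)) (1 : ℂ) h
  simpa [markovSpectralRadius, spectralRadius] using this

-- The spectrum is closed, so meeting every neighbourhood of `0` means containing `0`.
omit [SigmaFinite μ] in
lemma not_hasSpectralGap_markovLaplacian_iff (hP : P.IsReversible μ) :
    ¬ HasSpectralGap (markovLaplacian μ P hP) ↔
      (1 : ℂ) ∈ spectrum ℂ (markovOperator μ P hP.invariant) := by
  have hiff : (1 : ℂ) ∈ spectrum ℂ (markovOperator μ P hP.invariant) ↔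
      (0 : ℂ) ∈ spectrum ℂ (markovLaplacian μ P hP) := by
    rw [spectrum.mem_iff, spectrum.zero_mem_iff, map_one]
    rfl
  rw [hiff]
  constructor
  · intro h
    by_contra h0
    have hopen : IsOpen (spectrum ℂ (markovLaplacian μ P hP))ᶜ :=
      (spectrum.isClosed _).isOpen_compl
    obtain ⟨δ, hδ, hball⟩ := Metric.isOpen_iff.1 hopen 0 h0
    refine h ⟨δ, hδ, fun z hz => ?_⟩
    by_contra! hlt
    exact hball (by simpa using hlt) hz
  · rintro h0 ⟨δ, hδ, h⟩
    have := h 0 h0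
    rw [norm_zero] at this
    linarith

/-- The absolute value of an `L²` function. -/
noncomputable def absLp (f : Lp ℂ 2 μ) : Lp ℂ 2 μ := (Lp.memLp f).norm.ofReal.toLp

omit [SigmaFinite μ] in
lemma absLp_ae_eq (f : Lp ℂ 2 μ) : absLp f =ᵐ[μ] fun x => ((‖f x‖ : ℝ) : ℂ) :=
  MemLp.coeFn_toLp _

omit [SigmaFinite μ] in
lemma norm_absLp (f : Lp ℂ 2 μ) : ‖absLp f‖ = ‖f‖ := by
  refine le_antisymm (Lp.norm_le_norm_of_ae_le ?_) (Lp.norm_le_norm_of_ae_le ?_) <;>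
  · filter_upwards [absLp_ae_eq f] with x hx
    simp [hx]

omit [SigmaFinite μ] in
lemma markovOperator_absLp_ae_eq (hP : P.Invariant μ) (f : Lp ℂ 2 μ) :
    markovOperator μ P hP (absLp f) =ᵐ[μ] fun x => ((∫ y, ‖f y‖ ∂(P x) : ℝ) : ℂ) := by
  filter_upwards [markovOperator_ae_eq hP (absLp f), ae_ae_of_invariant hP (absLp_ae_eq f)]
    with x hx hf
  rw [hx, integral_congr_ae hf]
  exact integral_ofReal

omit [SigmaFinite μ] in
lemma norm_markovOperator_le_absLp (hP : P.Invariant μ) (f : Lp ℂ 2 μ) :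
    ‖markovOperator μ P hP f‖ ≤ ‖markovOperator μ P hP (absLp f)‖ := by
  refine Lp.norm_le_norm_of_ae_le ?_
  filter_upwards [markovOperator_ae_eq hP f, markovOperator_absLp_ae_eq hP f] with x h1 h2
  rw [h1, h2, Complex.norm_real]
  exact (norm_integral_le_integral_norm _).trans (le_abs_self _)

/-- If the spectral radius is `1`, there are nearly invariant nonnegative vectors. -/
lemma exists_nonneg_of_markovSpectralRadius_eq_one (hP : P.IsReversible μ)
    (h : markovSpectralRadius μ P hP = 1) {ε : ℝ} (hε : 0 < ε) :
    ∃ g : Lp ℂ 2 μ, g ≠ 0 ∧ (∀ᵐ x ∂μ, g x = (‖g x‖ : ℂ)) ∧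
      ‖markovOperator μ P hP.invariant g - g‖ ≤ ε * ‖g‖ := by
  set T := markovOperator μ P hP.invariant with hT
  have hn : ‖T‖ = 1 := by
    rw [markovSpectralRadius_eq] at h
    have : ‖T‖₊ = 1 := by exact_mod_cast h
    rw [← coe_nnnorm, this, NNReal.coe_one]
  -- The solution of `2 - 2 r ^ 2 = ε ^ 2 * r ^ 2`, the balance needed at the end.
  set r := Real.sqrt (2 / (2 + ε ^ 2)) with hr
  have hr0 : 0 < r := Real.sqrt_pos.2 (by positivity)
  have hr2 : r ^ 2 = 2 / (2 + ε ^ 2) := Real.sq_sqrt (by positivity)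
  have hr1 : r < ‖T‖ := by
    rw [hn, ← abs_of_pos hr0, ← sq_lt_one_iff_abs_lt_one, hr2, div_lt_one (by positivity)]
    linarith [sq_pos_of_pos hε]
  obtain ⟨x, hx1, hxr⟩ := T.exists_lt_apply_of_lt_opNorm hr1
  set f := absLp x with hf
  have hf1 : ‖f‖ < 1 := by rw [norm_absLp]; exact hx1
  have hfr : r < ‖T f‖ := hxr.trans_le (norm_markovOperator_le_absLp _ x)
  have hTle : ∀ y, ‖T y‖ ≤ ‖y‖ := fun y => by simpa [hn] using T.le_opNorm y
  have hfm : ∀ᵐ y ∂μ, f y = ((‖x y‖ : ℝ) : ℂ) := absLp_ae_eq x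
  have hTfm : ∀ᵐ y ∂μ, T f y = ((∫ z, ‖x z‖ ∂(P y) : ℝ) : ℂ) :=
    markovOperator_absLp_ae_eq hP.invariant x
  have hgm : ∀ᵐ y ∂μ, (f + T f) y = ((‖x y‖ + ∫ z, ‖x z‖ ∂(P y) : ℝ) : ℂ) := by
    filter_upwards [hfm, hTfm, Lp.coeFn_add f (T f)] with y h1 h2 h3
    rw [h3, Pi.add_apply, h1, h2, Complex.ofReal_add]
  have hint : ∀ y, 0 ≤ ∫ z, ‖x z‖ ∂(P y) := fun y => integral_nonneg fun z => norm_nonneg _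
  have hfg : ‖f‖ ≤ ‖f + T f‖ := by
    refine Lp.norm_le_norm_of_ae_le ?_
    filter_upwards [hfm, hgm] with y h1 h2
    rw [h1, h2, Complex.norm_real, Complex.norm_real, norm_norm]
    exact (le_add_of_nonneg_right (hint y)).trans (le_abs_self _)
  have hrg : r < ‖f + T f‖ := hfr.trans_le ((hTle f).trans hfg)
  -- Near-maximality of `‖T f‖` only gives `T (T f) ≈ f`, which allows the eigenvalue `-1`. For `g =
  -- f + T f` one has `T g - g = T (T f) - f`, and nonnegativity prevents cancellation in `g`.
  refine ⟨f + T f, norm_pos_iff.1 (hr0.trans hrg), ?_, ?_⟩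
  · filter_upwards [hgm] with y hy
    rw [hy, Complex.norm_real, Real.norm_of_nonneg]
    exact add_nonneg (norm_nonneg _) (hint y)
  · have e : T (f + T f) - (f + T f) = T (T f) - f := by rw [map_add]; abel
    have hsym : RCLike.re (inner ℂ (T (T f)) f) = ‖T f‖ ^ 2 := by
      have := (ContinuousLinearMap.isSelfAdjoint_iff_isSymmetric.1
        (isSelfAdjoint_markovOperator hP)) (T f) f
      change inner ℂ (T (T f)) f = inner ℂ (T f) (T f) at this
      rw [this]
      exact inner_self_eq_norm_sq (T f)
    have h2 : ‖T (T f) - f‖ ^ 2 ≤ (ε * ‖f + T f‖) ^ 2 := by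
      rw [@norm_sub_sq ℂ, hsym]
      have h3 : ‖T (T f)‖ ≤ 1 := ((hTle _).trans (hTle _)).trans hf1.le
      have h4 : ‖T (T f)‖ ^ 2 ≤ 1 := pow_le_one₀ (norm_nonneg _) h3
      have h5 : ‖f‖ ^ 2 ≤ 1 := pow_le_one₀ (norm_nonneg _) hf1.le
      have h6 : r ^ 2 ≤ ‖T f‖ ^ 2 := by gcongr
      have h7 : r ^ 2 ≤ ‖f + T f‖ ^ 2 := by gcongr
      have h8 : 2 - 2 * r ^ 2 = ε ^ 2 * r ^ 2 := by rw [hr2]; field_simp; ring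
      have h9 : ε ^ 2 * r ^ 2 ≤ ε ^ 2 * ‖f + T f‖ ^ 2 := by gcongr
      rw [mul_pow]
      linarith
    rw [e]
    exact (sq_le_sq₀ (norm_nonneg _) (by positivity)).1 h2

theorem markovSpectralRadius_eq_one_iff_not_hasSpectralGap (hP : P.IsReversible μ) :
    markovSpectralRadius μ P hP = 1 ↔ ¬ HasSpectralGap (markovLaplacian μ P hP) := by
  rw [not_hasSpectralGap_markovLaplacian_iff]
  refine ⟨fun h => one_mem_spectrum_markovOperator _ fun ε hε => ?_,
    markovSpectralRadius_eq_one_of_mem hP⟩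
  obtain ⟨g, hg, -, hgT⟩ := exists_nonneg_of_markovSpectralRadius_eq_one hP h hε
  exact ⟨g, hg, hgT⟩

/-- Sets that the Markov chain hardly leaves force the spectral radius to be `1`. -/
lemma markovSpectralRadius_eq_one_of_sets (hP : P.IsReversible μ)
    (h : ∀ ε : ℝ≥0, 0 < ε → ∃ E : Set X, MeasurableSet E ∧ μ E ≠ 0 ∧ μ E ≠ ∞ ∧
      ∫⁻ x in E, P x Eᶜ ∂μ ≤ ε * μ E) :
    markovSpectralRadius μ P hP = 1 := by
  refine markovSpectralRadius_eq_one_of_mem hP (one_mem_spectrum_markovOperator _ fun ε hε => ?_)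
  -- For the indicator `f` of `E`, `‖T f - f‖ ^ 2 ≤ 2 (‖f‖ ^ 2 - ⟪f, T f⟫)`, which is twice the mass
  -- escaping from `E`.
  obtain ⟨E, hE, hE0, hEtop, hEP⟩ := h (ε ^ 2 / 2).toNNReal
    (Real.toNNReal_pos.2 (by positivity))
  set T := markovOperator μ P hP.invariant
  set f : Lp ℂ 2 μ := indicatorConstLp 2 hE hEtop 1 with hf
  have hμE : 0 < μ.real E := ENNReal.toReal_pos hE0 hEtop
  have hnf : ‖f‖ ^ 2 = μ.real E := by
    rw [hf, norm_indicatorConstLp (by norm_num) (by norm_num), norm_one, one_mul,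
      ENNReal.toReal_ofNat, ← Real.sqrt_eq_rpow, Real.sq_sqrt measureReal_nonneg]
  have hfpos : 0 < ‖f‖ := by
    refine lt_of_le_of_ne (norm_nonneg _) fun h0 => ?_
    rw [← h0] at hnf
    simp at hnf
    exact hμE.ne hnf
  refine ⟨f, norm_pos_iff.1 hfpos, ?_⟩
  have hJtop : (μ ⊗ₘ P) (E ×ˢ Set.univ) ≠ ∞ := by
    rw [Measure.compProd_apply_prod hE MeasurableSet.univ]
    simpa using hEtop
  have hinner : inner ℂ f (T f) = ((μ ⊗ₘ P).real (E ×ˢ E) : ℂ) := by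
    have hfm : ∀ᵐ x ∂μ, f x = E.indicator (fun _ => (1 : ℂ)) x := indicatorConstLp_coeFn
    rw [inner_markovOperator]
    have : (fun p : X × X => (starRingEnd ℂ) (f p.1) * f p.2) =ᵐ[μ ⊗ₘ P]
        (E ×ˢ E).indicator fun _ => (1 : ℂ) := by
      filter_upwards [measurePreserving_fst_compProd.quasiMeasurePreserving.ae hfm,
        (measurePreserving_snd_compProd hP.invariant).quasiMeasurePreserving.ae hfm] with p h1 h2
      rw [h1, h2]
      by_cases hp1 : p.1 ∈ E <;> by_cases hp2 : p.2 ∈ E <;> simp [Set.indicator, hp1, hp2]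
    rw [integral_congr_ae this, integral_indicator_const _ (hE.prod hE)]
    simp
  have hsplit : μ.real E ≤ (μ ⊗ₘ P).real (E ×ˢ E) + ε ^ 2 / 2 * μ.real E := by
    have h1 : (μ ⊗ₘ P).real (E ×ˢ Set.univ) = μ.real E := by
      rw [measureReal_def, Measure.compProd_apply_prod hE MeasurableSet.univ]
      simp [measureReal_def]
    have h2 : (μ ⊗ₘ P).real (E ×ˢ Eᶜ) ≤ ε ^ 2 / 2 * μ.real E := by
      rw [measureReal_def, Measure.compProd_apply_prod hE hE.compl]
      refine (ENNReal.toReal_mono (ENNReal.mul_ne_top ENNReal.coe_ne_top hEtop) hEP).trans ?_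
      rw [ENNReal.toReal_mul, ENNReal.coe_toReal, Real.coe_toNNReal _ (by positivity)]
      rfl
    have h3 : (E ×ˢ Set.univ : Set (X × X)) = E ×ˢ E ∪ E ×ˢ Eᶜ := by
      rw [← Set.prod_union, Set.union_compl_self]
    have h4 := measureReal_union_le (μ := μ ⊗ₘ P) (E ×ˢ E) (E ×ˢ Eᶜ)
    rw [← h3, h1] at h4
    linarith
  have hTf : ‖T f‖ ≤ ‖f‖ :=
    (T.le_opNorm f).trans (mul_le_of_le_one_left (norm_nonneg _) (norm_markovOperator_le _))
  refine (sq_le_sq₀ (norm_nonneg _) (by positivity)).1 ?_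
  rw [norm_sub_rev, @norm_sub_sq ℂ, hinner, mul_pow, hnf]
  have h1 : ‖T f‖ ^ 2 ≤ μ.real E := by rw [← hnf]; gcongr
  have h2 : RCLike.re (((μ ⊗ₘ P).real (E ×ˢ E) : ℝ) : ℂ) = (μ ⊗ₘ P).real (E ×ˢ E) :=
    Complex.ofReal_re _
  rw [h2]
  linarith

/-- If the spectral radius is `1`, there are nonnegative functions with small Dirichlet energy. -/
lemma exists_small_energy_of_markovSpectralRadius_eq_one (hP : P.IsReversible μ)
    (h : markovSpectralRadius μ P hP = 1) {ε : ℝ≥0} (hε : 0 < ε) :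
    ∃ g : X → ℝ, Measurable g ∧ ∫⁻ x, ENNReal.ofReal (g x ^ 2) ∂μ ≠ 0 ∧
      ∫⁻ x, ENNReal.ofReal (g x ^ 2) ∂μ ≠ ∞ ∧
      ∫⁻ x, ∫⁻ y, ENNReal.ofReal ((g x - g y) ^ 2) ∂(P x) ∂μ ≤
        ε * ∫⁻ x, ENNReal.ofReal (g x ^ 2) ∂μ := by
  obtain ⟨f, hf0, hfpos, hfT⟩ := exists_nonneg_of_markovSpectralRadius_eq_one hP h
    -- The energy equals `2 ⟪f, f - T f⟫`, whence the half.
    (show (0 : ℝ) < ε / 2 by positivity)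
  set T := markovOperator μ P hP.invariant
  have hgm : Measurable fun x => ‖f x‖ := (Lp.stronglyMeasurable f).measurable.norm
  have hfpos0 : 0 < ‖f‖ := norm_pos_iff.2 hf0
  have hmem : MemLp (fun x => ‖f x‖) 2 μ := (Lp.memLp f).norm
  have hint : Integrable (fun x => ‖f x‖ ^ 2) μ := hmem.integrable_sq
  have hnf : ‖f‖ ^ 2 = ∫ x, ‖f x‖ ^ 2 ∂μ := by
    have h1 : inner ℂ f f = ((‖f‖ ^ 2 : ℝ) : ℂ) := by
      rw [inner_self_eq_norm_sq_to_K]; simp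
    rw [L2.inner_def] at h1
    have h2 : ∫ x, inner ℂ (f x) (f x) ∂μ = ((∫ x, ‖f x‖ ^ 2 ∂μ : ℝ) : ℂ) := by
      refine Eq.trans ?_ integral_ofReal
      refine integral_congr_ae (Filter.Eventually.of_forall fun x => ?_)
      simp [inner_self_eq_norm_sq_to_K]
    rw [h2] at h1
    exact_mod_cast h1.symm
  have hlin : ∫⁻ x, ENNReal.ofReal (‖f x‖ ^ 2) ∂μ = ENNReal.ofReal (‖f‖ ^ 2) := by
    rw [hnf, ofReal_integral_eq_lintegral_ofReal hint
      (Filter.Eventually.of_forall fun x => by positivity)]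
  refine ⟨fun x => ‖f x‖, hgm, ?_, ?_, ?_⟩
  · rw [hlin]
    simpa using hfpos0.ne'
  · rw [hlin]
    exact ENNReal.ofReal_ne_top
  have m1 := hmem.comp_measurePreserving (measurePreserving_fst_compProd (P := P))
  have m2 := hmem.comp_measurePreserving (measurePreserving_snd_compProd hP.invariant)
  have hmeas : Measurable fun p : X × X => ENNReal.ofReal ((‖f p.1‖ - ‖f p.2‖) ^ 2) := by
    fun_prop
  have e1 : ∫⁻ x, ∫⁻ y, ENNReal.ofReal ((‖f x‖ - ‖f y‖) ^ 2) ∂(P x) ∂μ =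
      ∫⁻ p, ENNReal.ofReal ((‖f p.1‖ - ‖f p.2‖) ^ 2) ∂(μ ⊗ₘ P) := by
    rw [Measure.lintegral_compProd hmeas]
  have i1 : Integrable (fun p : X × X => ‖f p.1‖ ^ 2) (μ ⊗ₘ P) := m1.integrable_sq
  have i2 : Integrable (fun p : X × X => ‖f p.2‖ ^ 2) (μ ⊗ₘ P) := m2.integrable_sq
  have i3 : Integrable (fun p : X × X => ‖f p.1‖ * ‖f p.2‖) (μ ⊗ₘ P) := m1.integrable_mul m2
  have v1 : ∫ p, ‖f p.1‖ ^ 2 ∂(μ ⊗ₘ P) = ‖f‖ ^ 2 := by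
    rw [hnf]
    have := integral_map (μ := μ ⊗ₘ P) measurable_fst.aemeasurable (f := fun x => ‖f x‖ ^ 2)
      (hgm.pow_const 2).aestronglyMeasurable
    rw [← this, (measurePreserving_fst_compProd (P := P)).map_eq]
  have v2 : ∫ p, ‖f p.2‖ ^ 2 ∂(μ ⊗ₘ P) = ‖f‖ ^ 2 := by
    rw [hnf]
    have := integral_map (μ := μ ⊗ₘ P) measurable_snd.aemeasurable (f := fun x => ‖f x‖ ^ 2)
      (hgm.pow_const 2).aestronglyMeasurable
    rw [← this, (measurePreserving_snd_compProd hP.invariant).map_eq]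
  have v3 : inner ℂ f (T f) = ((∫ p, ‖f p.1‖ * ‖f p.2‖ ∂(μ ⊗ₘ P) : ℝ) : ℂ) := by
    rw [inner_markovOperator]
    refine Eq.trans ?_ integral_ofReal
    refine integral_congr_ae ?_
    filter_upwards [measurePreserving_fst_compProd.quasiMeasurePreserving.ae hfpos,
      (measurePreserving_snd_compProd hP.invariant).quasiMeasurePreserving.ae hfpos] with p h1 h2
    rw [h1, h2]
    simp
  have hE : ∫ p, (‖f p.1‖ - ‖f p.2‖) ^ 2 ∂(μ ⊗ₘ P) ≤ ε * ‖f‖ ^ 2 := by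
    have e2 : ∀ p : X × X, (‖f p.1‖ - ‖f p.2‖) ^ 2 =
        (‖f p.1‖ ^ 2 + ‖f p.2‖ ^ 2) - 2 * (‖f p.1‖ * ‖f p.2‖) := fun p => by ring
    simp only [e2]
    have i12 : Integrable (fun p : X × X => ‖f p.1‖ ^ 2 + ‖f p.2‖ ^ 2) (μ ⊗ₘ P) := i1.add i2
    rw [integral_sub i12 (i3.const_mul 2), integral_add i1 i2, v1, v2,
      integral_const_mul]
    have h1 : ∫ p, ‖f p.1‖ * ‖f p.2‖ ∂(μ ⊗ₘ P) = ‖f‖ ^ 2 - RCLike.re (inner ℂ f (f - T f)) := by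
      rw [inner_sub_right, v3, map_sub, inner_self_eq_norm_sq]
      simp
    have h2 : RCLike.re (inner ℂ f (f - T f)) ≤ ‖f‖ * (ε / 2 * ‖f‖) := by
      refine (re_inner_le_norm _ _).trans ?_
      gcongr
      rwa [norm_sub_rev]
    rw [h1]
    linarith
  rw [e1, hlin, ← ofReal_integral_eq_lintegral_ofReal]
  · rw [← ENNReal.ofReal_coe_nnreal, ← ENNReal.ofReal_mul (NNReal.coe_nonneg _)]
    exact ENNReal.ofReal_le_ofReal hE
  · have : (fun p : X × X => (‖f p.1‖ - ‖f p.2‖) ^ 2) = fun p =>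
        (‖f p.1‖ ^ 2 + ‖f p.2‖ ^ 2) - 2 * (‖f p.1‖ * ‖f p.2‖) := by ext p; ring
    rw [this]
    exact (i1.add i2).sub (i3.const_mul 2)
  · exact Filter.Eventually.of_forall fun p => by positivity

end Reversible

/-! ### Discrete models of quasi-transitive spaces -/

/-- `π` identifies `(X, d, μ)` up to bounded errors with a uniformly discrete space `(V, δ)`. -/
structure IsCoarseModel {X V : Type*} [MeasurableSpace X] (d : X → X → ℝ) (μ : Measure X)
    (π : X → V) (δ : V → V → ℝ) : Prop where
  measurableSet_preimage : ∀ S : Set V, MeasurableSet (π ⁻¹' S)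
  self : ∀ v, δ v v = 0
  symm : ∀ v w, δ v w = δ w v
  triangle : ∀ u v w, δ u w ≤ δ u v + δ v w
  abs_sub_le : ∃ D : ℝ, ∀ x y, |d x y - δ (π x) (π y)| ≤ D
  fiber_le : ∃ M : ℝ≥0, ∀ v, μ (π ⁻¹' {v}) ≤ M
  le_ball : ∃ (R : ℝ) (c : ℝ≥0), 0 < c ∧ ∀ v, c ≤ μ (π ⁻¹' {w | δ v w ≤ R})
  card_ball : ∀ R : ℝ, ∃ N : ℕ, ∀ v, {w | δ v w ≤ R}.encard ≤ N

lemma IsMetricOn.nonneg {X : Type*} {d : X → X → ℝ} (hd : IsMetricOn d) (x y : X) : 0 ≤ d x y := by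
  have h1 := hd.triangle x y x
  rw [hd.symm y x, (hd.eq_zero_iff x x).2 rfl] at h1
  linarith

lemma IsMetricOn.self {X : Type*} {d : X → X → ℝ} (hd : IsMetricOn d) (x : X) : d x x = 0 :=
  (hd.eq_zero_iff x x).2 rfl

section

variable {G : Type*} [Group G] [TopologicalSpace G] [IsTopologicalGroup G]
  [LocallyCompactSpace G] [T2Space G] [MeasurableSpace G] [BorelSpace G]
  {X : Type*} [TopologicalSpace X] [T2Space X]
  [MeasurableSpace X] [BorelSpace X] [MulAction G X]
  {d : X → X → ℝ} {μ : Measure X} 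

omit [IsTopologicalGroup G] [LocallyCompactSpace G] [T2Space G] [BorelSpace G] [T2Space X]
  [BorelSpace X] in
lemma IsQuasiTransitive.sigmaFinite [IsFiniteMeasureOnCompacts μ] (hX : IsQuasiTransitive G d μ) :
    SigmaFinite μ := by
  rcases isEmpty_or_nonempty X with hX' | ⟨⟨x₀⟩⟩
  · rw [Measure.eq_zero_of_isEmpty μ]
    infer_instance
  refine ⟨⟨⟨fun n : ℕ => closure {y | d x₀ y ≤ n}, fun _ => trivial,
    fun n => (hX.proper_metric x₀ n).measure_lt_top, ?_⟩⟩⟩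
  refine Set.eq_univ_of_forall fun x => ?_
  obtain ⟨n, hn⟩ := exists_nat_ge (d x₀ x)
  exact Set.mem_iUnion.2 ⟨n, subset_closure hn⟩

omit [IsTopologicalGroup G] [LocallyCompactSpace G] [T2Space G] [BorelSpace G] [T2Space X]
  [BorelSpace X] in
lemma IsQuasiTransitive.exists_dist_le (hX : IsQuasiTransitive G d μ) (x₀ : X) {K : Set X}
    (hK : IsCompact K) : ∃ C : ℝ, ∀ x ∈ K, d x₀ x ≤ C := by
  obtain ⟨C, hC⟩ := hX.finite_on_compacts _ (hK.insert x₀)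
  exact ⟨C, fun x hx => hC _ (Set.mem_insert _ _) _ (Set.mem_insert_of_mem _ hx)⟩

-- A Steinhaus argument replaces continuity of the orbit map. The sets of `u` near `1` with `u⁻¹ •
-- x₀` in a fixed compact set exhaust a neighbourhood, so one of them, `E n`, has positive Haar
-- measure and `E n / E n` is a neighbourhood of `1`. By invariance, `u / v` moves `x₀` by the
-- distance from `u⁻¹ • x₀` to `v⁻¹ • x₀`.
omit [T2Space G] in
lemma IsQuasiTransitive.exists_nhds_displacement_le (hX : IsQuasiTransitive G d μ) (x₀ : X) :
    ∃ N ∈ nhds (1 : G), ∃ C : ℝ, ∀ g ∈ N, d x₀ (g • x₀) ≤ C := by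
  have := hX.measurable_action
  let ν : Measure G := Measure.haar
  obtain ⟨U, hU, hU1⟩ := exists_compact_mem_nhds (1 : G)
  let K : ℕ → Set X := fun n => closure {y | d x₀ y ≤ n}
  have hK : ∀ n, IsCompact (K n) := fun n => hX.proper_metric x₀ n
  let E : ℕ → Set G := fun n => interior U ∩ {u | u⁻¹ • x₀ ∈ K n}
  have hE : ∀ n, MeasurableSet (E n) := fun n => isOpen_interior.measurableSet.inter
    (((measurable_smul_const x₀).comp measurable_inv) (hK n).measurableSet)
  have hEU : ⋃ n, E n = interior U := by
    refine Set.Subset.antisymm (Set.iUnion_subset fun n => Set.inter_subset_left) fun u hu => ?_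
    obtain ⟨n, hn⟩ := exists_nat_ge (d x₀ (u⁻¹ • x₀))
    exact Set.mem_iUnion.2 ⟨n, hu, subset_closure hn⟩
  have hpos : ν (⋃ n, E n) ≠ 0 := by
    rw [hEU]
    exact (isOpen_interior.measure_pos ν ⟨1, mem_interior_iff_mem_nhds.2 hU1⟩).ne'
  obtain ⟨n, hn⟩ : ∃ n, ν (E n) ≠ 0 := by
    by_contra! h
    exact hpos (measure_iUnion_null h)
  have hfin : ν (E n) ≠ ∞ := measure_ne_top_of_subset
    (Set.inter_subset_left.trans interior_subset) hU.measure_lt_top.ne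
  obtain ⟨C, hC⟩ := hX.finite_on_compacts _ (hK n)
  refine ⟨_, Measure.div_mem_nhds_one_of_haar_pos_ne_top ν (E n) (hE n) (pos_iff_ne_zero.2 hn) hfin,
    C, ?_⟩
  rintro _ ⟨u, hu, v, hv, rfl⟩
  have := hX.invariant_metric u⁻¹ x₀ ((u / v) • x₀)
  rw [← this, smul_smul, div_eq_mul_inv, inv_mul_cancel_left]
  exact hC _ hu.2 _ hv.2

omit [T2Space G] in
lemma IsQuasiTransitive.exists_displacement_le (hX : IsQuasiTransitive G d μ) (x₀ : X) {Q : Set G}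
    (hQ : IsCompact Q) : ∃ R : ℝ, ∀ g ∈ Q, d x₀ (g • x₀) ≤ R := by
  obtain ⟨N, hN, C, hC⟩ := hX.exists_nhds_displacement_le x₀
  obtain ⟨t, -, ht⟩ := hQ.elim_nhds_subcover (fun q => q • N) fun q _ => by
    simpa using smul_mem_nhds_smul q hN
  refine ⟨∑ q ∈ t, d x₀ (q • x₀) + C, fun g hg => ?_⟩
  obtain ⟨q, hq, n, hn, rfl⟩ := Set.mem_iUnion₂.1 (ht hg)
  have h1 := hX.isMetric.triangle x₀ (q • x₀) ((q • n) • x₀)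
  rw [smul_assoc, hX.invariant_metric] at h1
  have h2 := Finset.single_le_sum (f := fun q : G => d x₀ (q • x₀))
    (fun q _ => hX.isMetric.nonneg _ _) hq
  have h3 := hC n hn
  simp only [smul_assoc] at h2 ⊢
  linarith

omit [IsTopologicalGroup G] [LocallyCompactSpace G] [T2Space G] [BorelSpace G] [T2Space X]
  [BorelSpace X] in
lemma IsQuasiTransitive.isCompact_closure_displacement (hX : IsQuasiTransitive G d μ) (x₀ : X)
    (R : ℝ) : IsCompact (closure {g : G | d x₀ (g • x₀) ≤ R}) := by
  refine (hX.proper_action _ ((hX.proper_metric x₀ R).insert x₀)).of_isClosed_subset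
    isClosed_closure (closure_mono fun g hg => ⟨g • x₀, ?_, ?_⟩)
  · exact Set.smul_mem_smul_set (Set.mem_insert _ _)
  · exact Set.mem_insert_of_mem _ (subset_closure hg)

omit [T2Space G] in
/-- A net of `G` is a coarse model of a quasi-`G`-transitive space. -/
lemma IsQuasiTransitive.exists_isCoarseModel [IsFiniteMeasureOnCompacts μ] (hμ : μ ≠ 0)
    (hX : IsQuasiTransitive G d μ) {Γ W : Set G} (hΓ : IsGroupNet Γ W) :
    Countable Γ ∧ ∃ (π : X → Γ) (δ : Γ → Γ → ℝ), IsCoarseModel d μ π δ ∧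
      (∀ Q : Set G, IsCompact Q → ∃ R : ℝ, ∀ v w, translRel Γ Q v w → δ v w ≤ R) ∧
      ∀ R : ℝ, ∃ Q : Set G, IsCompact Q ∧ ∀ v w, δ v w ≤ R → translRel Γ Q v w := by
  have := hX.measurable_action
  have hd := hX.isMetric
  have hne : Nonempty X := by
    by_contra h
    rw [not_nonempty_iff] at h
    exact hμ (Measure.eq_zero_of_isEmpty μ)
  obtain ⟨x₀⟩ := hne
  -- In general only a pseudometric, since `x₀` may have a nontrivial stabilizer.
  let δ : Γ → Γ → ℝ := fun v w => d ((v : G) • x₀) ((w : G) • x₀)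
  have hδ : ∀ v w : Γ, δ v w = d x₀ (((v : G)⁻¹ * w) • x₀) := fun v w => by
    change d _ _ = _
    rw [← hX.invariant_metric (v : G)⁻¹, inv_smul_smul, smul_smul]
  have hprop : ∀ R : ℝ, ∃ Q : Set G, IsCompact Q ∧ ∀ v w, δ v w ≤ R → translRel Γ Q v w :=
    fun R => ⟨_, hX.isCompact_closure_displacement x₀ R, fun v w h =>
      subset_closure (by rwa [hδ] at h)⟩
  have hcard : ∀ R : ℝ, ∃ N : ℕ, ∀ v, {w | δ v w ≤ R}.encard ≤ N := by
    intro R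
    obtain ⟨Q, hQ, hQR⟩ := hprop R
    obtain ⟨N, hN⟩ := hΓ.exists_encard_le hQ
    exact ⟨N, fun v => (Set.encard_le_encard fun w hw => hQR v w hw).trans (hN v)⟩
  obtain ⟨γ₀, hγ₀, -⟩ := hΓ.cover 1
  have hcount : Countable Γ := by
    rw [← Set.countable_univ_iff]
    have : (Set.univ : Set Γ) = ⋃ n : ℕ, {w | δ ⟨γ₀, hγ₀⟩ w ≤ n} := by
      refine (Set.eq_univ_of_forall fun w => ?_).symm
      obtain ⟨n, hn⟩ := exists_nat_ge (δ ⟨γ₀, hγ₀⟩ w)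
      exact Set.mem_iUnion.2 ⟨n, hn⟩
    rw [this]
    refine Set.countable_iUnion fun n => Set.Finite.countable ?_
    obtain ⟨N, hN⟩ := hcard n
    exact Set.finite_of_encard_le_coe (hN _)
  have : Nonempty Γ := ⟨⟨γ₀, hγ₀⟩⟩
  obtain ⟨K₀, hK₀, hK₀X⟩ := hX.cocompact_action
  obtain ⟨C₀, hC₀⟩ := hX.exists_dist_le x₀ hK₀
  have hU : IsCompact (W / W) := by
    rw [div_eq_mul_inv]; exact hΓ.isCompact.mul hΓ.isCompact.inv
  obtain ⟨RU, hRU⟩ := hX.exists_displacement_le x₀ hU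
  let B : Set X := closure {y | d x₀ y ≤ C₀ + RU}
  have hB : IsCompact B := hX.proper_metric x₀ _
  obtain ⟨R₂, hR₂⟩ := hX.exists_dist_le x₀ hB
  have hcov : ∀ x : X, ∃ γ : Γ, (γ : G)⁻¹ • x ∈ B := by
    intro x
    have hx : x ∈ ⋃ g : G, g • K₀ := by rw [hK₀X]; trivial
    obtain ⟨g, k, hk, rfl⟩ := Set.mem_iUnion.1 hx
    obtain ⟨γ, hγ, hγg⟩ := hΓ.cover g
    refine ⟨⟨γ, hγ⟩, subset_closure ?_⟩
    change d x₀ (γ⁻¹ • g • k) ≤ C₀ + RU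
    have h1 := hd.triangle x₀ ((γ⁻¹ * g) • x₀) (γ⁻¹ • g • k)
    rw [smul_smul, hX.invariant_metric] at h1
    rw [smul_smul]
    linarith [hRU _ hγg, hC₀ k hk]
  obtain ⟨e, he⟩ := exists_surjective_nat Γ
  have hex : ∀ x : X, ∃ n, (e n : G)⁻¹ • x ∈ B := fun x => by
    obtain ⟨γ, hγ⟩ := hcov x
    obtain ⟨n, rfl⟩ := he γ
    exact ⟨n, hγ⟩
  classical
  -- Taking the first admissible index of an enumeration makes the choice of a nearby net point
  -- measurable.
  let π : X → Γ := fun x => e (Nat.find (hex x))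
  have hπ : ∀ x, (π x : G)⁻¹ • x ∈ B := fun x => Nat.find_spec (hex x)
  have hmeasB : ∀ γ : G, MeasurableSet {x : X | γ⁻¹ • x ∈ B} := fun γ =>
    measurable_const_smul γ⁻¹ hB.measurableSet
  have hπm : ∀ S : Set Γ, MeasurableSet (π ⁻¹' S) := fun S =>
    measurable_find hex (fun n => hmeasB (e n)) (t := e ⁻¹' S) trivial
  have hπd : ∀ x, d ((π x : G) • x₀) x ≤ R₂ := fun x => by
    have := hR₂ _ (hπ x)
    rwa [← hX.invariant_metric (π x : G), smul_inv_smul] at this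
  obtain ⟨C, hC⟩ := hX.almost_preserving
  refine ⟨hcount, π, δ, ⟨hπm, fun v => hd.self _, fun v w => hd.symm _ _,
    fun u v w => hd.triangle _ _ _, ⟨2 * R₂, fun x y => ?_⟩, ?_, ?_, hcard⟩, fun Q hQ => ?_, hprop⟩
  · have h1 := hd.triangle x ((π x : G) • x₀) y
    have h2 := hd.triangle ((π x : G) • x₀) ((π y : G) • x₀) y
    have h3 := hd.triangle ((π x : G) • x₀) x ((π y : G) • x₀)
    have h4 := hd.triangle x y ((π y : G) • x₀)
    have h5 := hπd x
    have h6 := hπd y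
    rw [hd.symm x ((π x : G) • x₀)] at h1
    rw [hd.symm y ((π y : G) • x₀)] at h4
    change |d x y - d ((π x : G) • x₀) ((π y : G) • x₀)| ≤ _
    exact abs_le.2 ⟨by linarith, by linarith⟩
  · have hfin : C * μ B ≠ ∞ := ENNReal.mul_ne_top ENNReal.coe_ne_top hB.measure_lt_top.ne
    refine ⟨(C * μ B).toNNReal, fun v => ?_⟩
    rw [ENNReal.coe_toNNReal hfin]
    calc μ (π ⁻¹' {v}) ≤ μ ((fun x => (v : G)⁻¹ • x) ⁻¹' B) := measure_mono fun x hx => by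
          have := hπ x
          rwa [Set.mem_singleton_iff.1 hx] at this
      _ = μ.map (fun x => (v : G)⁻¹ • x) B :=
          (Measure.map_apply (measurable_const_smul _) hB.measurableSet).symm
      _ ≤ C * μ B := hC _ B
  · have : ∃ n : ℕ, μ (closure {y | d x₀ y ≤ n}) ≠ 0 := by
      by_contra! h
      refine hμ (Measure.measure_univ_eq_zero.1 (measure_mono_null ?_ (measure_iUnion_null h)))
      intro x _
      obtain ⟨n, hn⟩ := exists_nat_ge (d x₀ x)
      exact Set.mem_iUnion.2 ⟨n, subset_closure hn⟩
    obtain ⟨n, hn⟩ := this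
    set K : Set X := closure {y | d x₀ y ≤ n} with hKdef
    have hK : IsCompact K := hX.proper_metric x₀ n
    obtain ⟨r, hr⟩ := hX.exists_dist_le x₀ hK
    -- An upper bound on `v · μ` is also a lower bound on `μ` of translates, because `(v · μ) (v K)
    -- = μ K`.
    have hle : ∀ v : G, μ K ≤ C * μ {x | v⁻¹ • x ∈ K} := fun v => by
      have hm : MeasurableSet {x : X | v⁻¹ • x ∈ K} := measurable_const_smul v⁻¹ hK.measurableSet
      refine le_trans (le_of_eq ?_) (hC v _)
      rw [Measure.map_apply (measurable_const_smul v) hm]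
      congr 1
      ext x
      simp
    have hC0 : C ≠ 0 := by
      rintro rfl
      have := hle 1
      simp at this
      exact hn this
    have hKtop : μ K ≠ ∞ := hK.measure_lt_top.ne
    refine ⟨r + R₂, (μ K).toNNReal / C, ?_, fun v => ?_⟩
    · exact div_pos (ENNReal.toNNReal_pos hn hKtop) (pos_iff_ne_zero.2 hC0)
    · rw [ENNReal.coe_div hC0, ENNReal.coe_toNNReal hKtop]
      refine ENNReal.div_le_of_le_mul' ((hle v).trans ?_)
      gcongr
      intro x hx
      change d ((v : G) • x₀) ((π x : G) • x₀) ≤ r + R₂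
      have h1 := hr _ hx
      rw [← hX.invariant_metric (v : G), smul_inv_smul] at h1
      have h2 := hd.triangle ((v : G) • x₀) x ((π x : G) • x₀)
      have h3 := hπd x
      rw [hd.symm] at h3
      linarith
  · obtain ⟨R, hR⟩ := hX.exists_displacement_le x₀ hQ
    exact ⟨R, fun v w h => by rw [hδ]; exact hR _ h⟩

end

/-! ### Følner sets in the discrete model -/

section

variable {X : Type*} [MeasurableSpace X] {d : X → X → ℝ} {μ : Measure X} [SigmaFinite μ]
  {P : Kernel X X} {h : ℝ}

lemma IsViewpoint.exists_ae_dist_le (hP : IsViewpoint d μ h P) :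
    ∃ r : ℝ, ∀ᵐ x ∂μ, ∀ᵐ y ∂(P x), d x y ≤ r := by
  obtain ⟨hM, A, -, c, -, hx⟩ := hP
  refine ⟨A * h, ?_⟩
  filter_upwards [hx] with x ⟨h1, h2, _⟩
  rw [← Measure.withDensity_rnDeriv_eq _ _ h1,
    ae_withDensity_iff (Measure.measurable_rnDeriv _ _)]
  exact h2

/-- The lower density bound lets the Dirichlet energy dominate plain integrals over pairs of points
at distance at most `h`. -/
lemma IsViewpoint.exists_le_lintegral (hP : IsViewpoint d μ h P) :
    ∃ c : ℝ≥0, 0 < c ∧ ∀ᵐ x ∂μ, ∀ K : X → ℝ≥0∞, Measurable K → ∀ S : Set X, MeasurableSet S →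
      (∀ y ∈ S, d x y ≤ h) → c * ∫⁻ y in S, K y ∂μ ≤ ∫⁻ y, K y ∂(P x) := by
  obtain ⟨hM, A, -, c, hc, hx⟩ := hP
  refine ⟨c, hc, ?_⟩
  filter_upwards [hx] with x ⟨h1, _, h2⟩ K hK S hS hSd
  rw [← Measure.withDensity_rnDeriv_eq _ _ h1,
    lintegral_withDensity_eq_lintegral_mul _ (Measure.measurable_rnDeriv _ _) hK,
    ← lintegral_const_mul _ hK]
  refine le_trans ?_ (setLIntegral_le_lintegral S _)
  refine lintegral_mono_ae ?_
  filter_upwards [ae_restrict_of_ae h2, ae_restrict_mem hS] with y hy hyS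
  exact mul_le_mul_left (hy (hSd y hyS)) _

variable {V : Type*} {π : X → V} {δ : V → V → ℝ}

omit [SigmaFinite μ] in
lemma IsCoarseModel.finite_ball (hm : IsCoarseModel d μ π δ) (R : ℝ) (v : V) :
    {w | δ v w ≤ R}.Finite := by
  obtain ⟨N, hN⟩ := hm.card_ball R
  exact Set.finite_of_encard_le_coe (hN v)

omit [SigmaFinite μ] in
lemma IsCoarseModel.measure_preimage_finset (hm : IsCoarseModel d μ π δ) (F : Finset V) :
    μ (π ⁻¹' F) = ∑ v ∈ F, μ (π ⁻¹' {v}) := by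
  rw [← measure_biUnion_finset]
  · congr 1; ext x; simp
  · intro v _ w _ hvw
    exact Disjoint.preimage _ (Set.disjoint_singleton.2 hvw)
  · exact fun v _ => hm.measurableSet_preimage _

lemma mul_mul_le_of_le_div_mul {η N M F m B c : ℝ} (hη : 0 ≤ η) (hN : 0 ≤ N) (hM : 0 ≤ M)
    (hF : 0 ≤ F) (hm : 0 ≤ m) (hc : 0 < c)
    (h1 : B ≤ η * c / (2 * (M + 1) * (N + 1) ^ 2) * F) (h2 : F / 2 * c ≤ N * m) :
    B * N * M ≤ η * m := by
  calc B * N * M ≤ (η * c / (2 * (M + 1) * (N + 1) ^ 2) * F) * (N + 1) * (M + 1) := by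
        gcongr <;> linarith
    _ = η / (N + 1) * (F / 2 * c) := by field_simp
    _ ≤ η / (N + 1) * (N * m) := by gcongr
    _ = η * m * (N / (N + 1)) := by ring
    _ ≤ η * m * 1 := by
        gcongr
        rw [div_le_one (by positivity)]; linarith
    _ = η * m := mul_one _

/-- The walk can leave `π ⁻¹' F` only from fibres over `bad` points, those within `R` of the few
outer neighbours `B` of `F`. Fibres may be null, so the measure of `π ⁻¹' F` is bounded below by
balls: those around points that are not bad lie over `F`, and they overlap at most `N` times. -/
theorem IsCoarseModel.markovSpectralRadius_eq_one (hm : IsCoarseModel d μ π δ)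
    (hF : ∀ R ε : ℝ, 0 < ε → ∃ F : Finset V, F.Nonempty ∧
      ((nbhdOf (fun v w => δ v w ≤ R) F).ncard : ℝ) ≤ (1 + ε) * F.card)
    [IsMarkovKernel P] (hP : IsReversibleViewpoint d μ h P) :
    markovSpectralRadius μ P hP.isReversible = 1 := by
  classical
  refine markovSpectralRadius_eq_one_of_sets _ fun η hη => ?_
  obtain ⟨r, hr⟩ := hP.isViewpoint.exists_ae_dist_le
  obtain ⟨D, hD⟩ := hm.abs_sub_le
  obtain ⟨M, hM⟩ := hm.fiber_le
  obtain ⟨R₀, c, hc, hball⟩ := hm.le_ball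
  set R : ℝ := max (max (r + D) R₀) 0 with hR
  have hR1 : r + D ≤ R := (le_max_left _ _).trans (le_max_left _ _)
  have hR2 : R₀ ≤ R := (le_max_right _ _).trans (le_max_left _ _)
  have hR3 : 0 ≤ R := le_max_right _ _
  obtain ⟨N, hN⟩ := hm.card_ball R
  have hcardN : ∀ v, (hm.finite_ball R v).toFinset.card ≤ N := fun v => by
    have := hN v
    rw [(hm.finite_ball R v).encard_eq_coe_toFinset_card] at this
    exact_mod_cast this
  -- The first bound keeps at least half of `F` away from `B`; the second makes the escaping mass at
  -- most `η * μ E`.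
  obtain ⟨F, hFne, hFc⟩ := hF R (min (1 / (2 * (N + 1))) (η * c / (2 * (M + 1) * (N + 1) ^ 2)))
    (by have : (0 : ℝ) < η := hη
        have : (0 : ℝ) < c := hc
        positivity)
  set ε := min (1 / (2 * ((N : ℝ) + 1))) (η * c / (2 * (M + 1) * (N + 1) ^ 2)) with hε
  have hfin := finite_nbhdOf (hm.finite_ball R) F
  have hsub : F ⊆ hfin.toFinset := fun v hv => by
    rw [Set.Finite.mem_toFinset]
    exact subset_nbhdOf (fun v => by rw [hm.self]; exact hR3) F hv
  set B := hfin.toFinset \ F with hB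
  have hBc : (B.card : ℝ) ≤ ε * F.card := by
    rw [hB, Finset.cast_card_sdiff hsub, ← Set.ncard_eq_toFinset_card _ hfin]
    linarith
  have hmemB : ∀ v ∈ F, ∀ w, w ∉ F → δ v w ≤ R → w ∈ B := fun v hv w hw hvw => by
    rw [hB, Finset.mem_sdiff, Set.Finite.mem_toFinset]
    exact ⟨⟨v, hv, hvw⟩, hw⟩
  set bad := F.filter fun v => ∃ w ∈ B, δ v w ≤ R with hbad
  have hbadc : bad.card ≤ B.card * N := by
    have : bad ⊆ B.biUnion fun w => (hm.finite_ball R w).toFinset := by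
      intro v hv
      obtain ⟨-, w, hw, hvw⟩ := Finset.mem_filter.1 hv
      refine Finset.mem_biUnion.2 ⟨w, hw, ?_⟩
      rw [Set.Finite.mem_toFinset, Set.mem_ofPred_eq, hm.symm]
      exact hvw
    exact (Finset.card_le_card this).trans (Finset.card_biUnion_le_card_mul _ _ _ fun w _ => hcardN w)
  set E := π ⁻¹' (F : Set V) with hE
  have hEm : MeasurableSet E := hm.measurableSet_preimage _
  have hEsum : μ E = ∑ v ∈ F, μ (π ⁻¹' {v}) := hm.measure_preimage_finset F
  have hlow : (F \ bad).card * (c : ℝ≥0∞) ≤ N * μ E := by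
    calc (F \ bad).card * (c : ℝ≥0∞) = ∑ v ∈ F \ bad, (c : ℝ≥0∞) := by simp
      _ ≤ ∑ v ∈ F \ bad, ∑ w ∈ F, if δ v w ≤ R then μ (π ⁻¹' {w}) else 0 := by
        refine Finset.sum_le_sum fun v hv => (hball v).trans ?_
        rw [← Finset.sum_filter, ← hm.measure_preimage_finset]
        refine measure_mono fun x hx => ?_
        have hx' : δ v (π x) ≤ R := le_trans hx hR2
        simp only [Finset.mem_sdiff, hbad, Finset.mem_filter, not_and] at hv
        simp only [Set.mem_preimage, Finset.mem_coe, Finset.mem_filter]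
        refine ⟨?_, hx'⟩
        by_contra hxF
        exact hv.2 hv.1 ⟨_, hmemB v hv.1 _ hxF hx', hx'⟩
      _ = ∑ w ∈ F, ∑ v ∈ F \ bad, if δ v w ≤ R then μ (π ⁻¹' {w}) else 0 := Finset.sum_comm
      _ ≤ ∑ w ∈ F, N * μ (π ⁻¹' {w}) := by
        refine Finset.sum_le_sum fun w _ => ?_
        rw [← Finset.sum_filter, Finset.sum_const, nsmul_eq_mul]
        gcongr
        refine (Finset.card_le_card fun v hv => ?_).trans (hcardN w)
        rw [Set.Finite.mem_toFinset, Set.mem_ofPred_eq, hm.symm]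
        exact (Finset.mem_filter.1 hv).2
      _ = N * μ E := by rw [← Finset.mul_sum, hEsum]
  have hEtop : μ E ≠ ∞ := by
    rw [hEsum]
    exact ENNReal.sum_ne_top.2 fun v _ => ((hM v).trans_lt ENNReal.coe_lt_top).ne
  have hup : ∫⁻ x in E, P x Eᶜ ∂μ ≤ B.card * N * (M : ℝ≥0∞) := by
    calc ∫⁻ x in E, P x Eᶜ ∂μ ≤ ∫⁻ x, (π ⁻¹' (bad : Set V)).indicator 1 x ∂μ := by
          rw [← lintegral_indicator hEm]
          refine lintegral_mono_ae ?_
          filter_upwards [hr] with x hx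
          by_cases hxE : x ∈ E
          · rw [Set.indicator_of_mem hxE]
            by_cases hxb : x ∈ π ⁻¹' (bad : Set V)
            · rw [Set.indicator_of_mem hxb]
              exact prob_le_one
            · rw [Set.indicator_of_notMem hxb, nonpos_iff_eq_zero]
              refine measure_mono_null (t := {y | ¬ d x y ≤ r}) (fun y hy hyr => hxb ?_) hx
              have h1 : δ (π x) (π y) ≤ R := by
                have := (abs_le.1 (hD x y)).1
                have h2 : d x y ≤ r := hyr
                linarith
              exact Finset.mem_coe.2 (Finset.mem_filter.2 ⟨hxE, _, hmemB _ hxE _ hy h1, h1⟩)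
          · rw [Set.indicator_of_notMem hxE]
            exact zero_le
      _ = μ (π ⁻¹' (bad : Set V)) := lintegral_indicator_one (hm.measurableSet_preimage _)
      _ ≤ ∑ v ∈ bad, (M : ℝ≥0∞) := by
          rw [hm.measure_preimage_finset]
          exact Finset.sum_le_sum fun v _ => hM v
      _ = bad.card * (M : ℝ≥0∞) := by simp
      _ ≤ B.card * N * (M : ℝ≥0∞) := by gcongr; exact_mod_cast hbadc
  have hFpos : (0 : ℝ) < F.card := by exact_mod_cast hFne.card_pos
  have hN0 : (0 : ℝ) ≤ N := Nat.cast_nonneg _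
  have hcpos : (0 : ℝ) < c := hc
  have hηpos : (0 : ℝ) < η := hη
  have hhalf : (F.card : ℝ) / 2 ≤ (F \ bad).card := by
    rw [Finset.cast_card_sdiff (Finset.filter_subset _ _)]
    have h1 : (bad.card : ℝ) ≤ B.card * N := by exact_mod_cast hbadc
    have h2 : (B.card : ℝ) * N ≤ (1 / (2 * ((N : ℝ) + 1)) * F.card) * N := by
      gcongr
      refine hBc.trans ?_
      gcongr
      exact min_le_left _ _
    have h3 : (1 / (2 * ((N : ℝ) + 1)) * F.card) * N = F.card / 2 * (N / (N + 1)) := by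
      field_simp
    have h4 : (N : ℝ) / (N + 1) ≤ 1 := by rw [div_le_one (by positivity)]; linarith
    have h5 : F.card / 2 * ((N : ℝ) / (N + 1)) ≤ F.card / 2 * 1 := by gcongr
    linarith
  obtain ⟨m, hmE⟩ : ∃ m : ℝ≥0, μ E = m := ⟨_, (ENNReal.coe_toNNReal hEtop).symm⟩
  have hlow' : (F.card : ℝ) / 2 * c ≤ N * m := by
    have h1 : ((F \ bad).card : ℝ≥0) * c ≤ N * m := by
      rw [hmE] at hlow
      exact_mod_cast hlow
    have h2 : ((F \ bad).card : ℝ) * c ≤ N * m := by exact_mod_cast h1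
    exact (by gcongr : (F.card : ℝ) / 2 * c ≤ (F \ bad).card * c).trans h2
  have hmpos : (0 : ℝ) < m := by
    by_contra! h0
    have : (N : ℝ) * m ≤ 0 := mul_nonpos_of_nonneg_of_nonpos hN0 h0
    have : 0 < (F.card : ℝ) / 2 * c := by positivity
    linarith
  refine ⟨E, hEm, ?_, hEtop, hup.trans ?_⟩
  · rw [hmE]
    exact_mod_cast (NNReal.coe_pos.1 hmpos).ne'
  · rw [hmE]
    have : (B.card : ℝ≥0) * N * M ≤ η * m := by
      rw [← NNReal.coe_le_coe]
      push_cast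
      exact mul_mul_le_of_le_div_mul hηpos.le hN0 M.2 (Nat.cast_nonneg _) m.2
        hcpos (hBc.trans (mul_le_mul_of_nonneg_right (min_le_right _ _) hFpos.le)) hlow'
    exact_mod_cast this

end

/-! ### Doubling models have spectral radius less than one -/

lemma ENNReal.tsum_le_mul_of_encard_le {V : Type*} {φ : V → ℝ≥0∞} {S : Set V} {N : ℕ}
    (hS : S.encard ≤ N) (h0 : ∀ v, v ∉ S → φ v = 0) {B : ℝ≥0∞} (hB : ∀ v ∈ S, φ v ≤ B) :
    ∑' v, φ v ≤ N * B := by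
  have hfin : S.Finite := Set.finite_of_encard_le_coe hS
  rw [tsum_eq_sum (s := hfin.toFinset) fun v hv => h0 v (by simpa using hv)]
  refine (Finset.sum_le_card_nsmul _ _ B fun v hv => hB v (by simpa using hv)).trans ?_
  rw [nsmul_eq_mul]
  gcongr
  rw [hfin.encard_eq_coe_toFinset_card] at hS
  exact_mod_cast hS

/-- Any coefficient of `b ^ 2` in the interval `(1, 2)` would do: below `2`, it loses against
doubling. -/
lemma ENNReal.ofReal_sq_le_add (a b : ℝ) :
    ENNReal.ofReal (a ^ 2) ≤ 3 / 2 * ENNReal.ofReal (b ^ 2) + 3 * ENNReal.ofReal ((a - b) ^ 2) := by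
  have h1 : (3 / 2 : ℝ≥0∞) = ENNReal.ofReal (3 / 2) := by
    rw [ENNReal.ofReal_div_of_pos (by norm_num)]; norm_num
  have h2 : (3 : ℝ≥0∞) = ENNReal.ofReal 3 := by norm_num
  rw [h1, h2, ← ENNReal.ofReal_mul (by norm_num), ← ENNReal.ofReal_mul (by norm_num),
    ← ENNReal.ofReal_add (by positivity) (by positivity)]
  refine ENNReal.ofReal_le_ofReal ?_
  nlinarith [sq_nonneg (2 * (a - b) - b)]

lemma ENNReal.div_le_of_mul_le {a a' t t' e c : ℝ≥0∞} (hc : c ≠ 0) (ht : c ≤ t) (ht' : c ≤ t')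
    (httop : t ≠ ∞) (httop' : t' ≠ ∞) (h : a * t' ≤ 3 / 2 * (t * a') + 3 * e) :
    a / t ≤ 3 / 2 * (a' / t') + 3 * (e / (c * c)) := by
  have ht0 : t ≠ 0 := fun h0 => hc (by simpa [h0] using ht)
  have ht0' : t' ≠ 0 := fun h0 => hc (by simpa [h0] using ht')
  have h1 : a / t = a * t' / (t * t') := by
    rw [ENNReal.mul_div_mul_right _ _ ht0' httop']
  have h2 : (3 / 2 * (t * a') + 3 * e) / (t * t') = 3 / 2 * (a' / t') + 3 * (e / (t * t')) := by
    rw [ENNReal.add_div, mul_div_assoc (3 / 2), mul_div_assoc 3, ENNReal.mul_div_mul_left _ _ ht0 httop]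
  rw [h1]
  refine (ENNReal.div_le_div_right h _).trans ?_
  rw [h2]
  gcongr

section

variable {X : Type*} [MeasurableSpace X] {d : X → X → ℝ} {μ : Measure X} [SigmaFinite μ]
  {V : Type*} [Countable V] {π : X → V} {δ : V → V → ℝ}

omit [SigmaFinite μ] in
/-- Integrals over the balls of the model add up to at most a multiple of the whole integral. -/
lemma IsCoarseModel.tsum_setLIntegral_le (hm : IsCoarseModel d μ π δ) {R : ℝ} {N : ℕ}
    (hN : ∀ v, {w | δ v w ≤ R}.encard ≤ N) {F : V → X → ℝ≥0∞} (hF : ∀ v, Measurable (F v))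
    {B : X → ℝ≥0∞} (hFB : ∀ᵐ x ∂μ, ∀ v, δ v (π x) ≤ R → F v x ≤ B x) :
    ∑' v, ∫⁻ x in π ⁻¹' {w | δ v w ≤ R}, F v x ∂μ ≤ N * ∫⁻ x, B x ∂μ := by
  have hT : ∀ v, MeasurableSet (π ⁻¹' {w | δ v w ≤ R}) := fun v => hm.measurableSet_preimage _
  simp_rw [← lintegral_indicator (hT _)]
  rw [← lintegral_tsum fun v => ((hF v).indicator (hT v)).aemeasurable,
    ← lintegral_const_mul' _ _ (ENNReal.natCast_ne_top N)]
  refine lintegral_mono_ae ?_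
  filter_upwards [hFB] with x hx
  refine ENNReal.tsum_le_mul_of_encard_le (S := {v | δ v (π x) ≤ R}) ?_ ?_ ?_
  · convert hN (π x) using 3
    ext v
    exact hm.symm _ _ ▸ Iff.rfl
  · intro v hv
    exact Set.indicator_of_notMem (show x ∉ π ⁻¹' {w | δ v w ≤ R} from hv) (F v)
  · intro v hv
    rw [Set.indicator_of_mem (show x ∈ π ⁻¹' {w | δ v w ≤ R} from hv)]
    exact hx v hv

omit [SigmaFinite μ] in
lemma IsCoarseModel.lintegral_le_tsum_setLIntegral (hm : IsCoarseModel d μ π δ) {R : ℝ}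
    (hR : 0 ≤ R) {F : X → ℝ≥0∞} (hF : Measurable F) :
    ∫⁻ x, F x ∂μ ≤ ∑' v, ∫⁻ x in π ⁻¹' {w | δ v w ≤ R}, F x ∂μ := by
  have hT : ∀ v, MeasurableSet (π ⁻¹' {w | δ v w ≤ R}) := fun v => hm.measurableSet_preimage _
  simp_rw [← lintegral_indicator (hT _)]
  rw [← lintegral_tsum fun v => (hF.indicator (hT v)).aemeasurable]
  refine lintegral_mono fun x => ?_
  refine le_trans ?_ (ENNReal.le_tsum (π x))
  rw [Set.indicator_of_mem]
  change δ (π x) (π x) ≤ R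
  rwa [hm.self]

/-- Let `S` be the sum over `v` of the averages of `g ^ 2` on balls, where `g` has small energy.
Each average is at most `3 / 2` of the average at either image of `v`, plus a local energy. Summing
over both injections, whose images are disjoint, gives `2 * S ≤ 3 / 2 * S` plus a small multiple of
`S`. -/
theorem IsCoarseModel.exists_markovSpectralRadius_ne_one (hm : IsCoarseModel d μ π δ) {R : ℝ}
    (hd : IsDoubling fun v w => δ v w ≤ R) :
    ∃ h₀ : ℝ, 0 < h₀ ∧ ∀ h, h₀ ≤ h → ∀ (P : Kernel X X) [IsMarkovKernel P]
      (hP : IsReversibleViewpoint d μ h P), markovSpectralRadius μ P hP.isReversible ≠ 1 := by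
  classical
  obtain ⟨f, hf, hfR⟩ := hd.exists_injective (hm.finite_ball R)
  obtain ⟨D, hD⟩ := hm.abs_sub_le
  obtain ⟨M, hM⟩ := hm.fiber_le
  obtain ⟨R₀', c₀, hc₀, hball'⟩ := hm.le_ball
  set R₀ := max R₀' 0 with hR₀def
  have hR₀ : 0 ≤ R₀ := le_max_right _ _
  obtain ⟨N, hN⟩ := hm.card_ball R₀
  -- Points of `T v` and `T' v` are at distance at most `R₀ + (R₀ + R) + D`, so at this scale the
  -- density bound covers all these pairs.
  refine ⟨max (2 * R₀ + R + D) 1, by positivity, fun h hh P _ hP hρ => ?_⟩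
  have hhR : 2 * R₀ + R + D ≤ h := (le_max_left _ _).trans hh
  obtain ⟨c, hc, hcP⟩ := hP.isViewpoint.exists_le_lintegral
  let T : V → Set X := fun v => π ⁻¹' {w | δ v w ≤ R₀}
  have hT : ∀ v, MeasurableSet (T v) := fun v => hm.measurableSet_preimage _
  let T' : V → Set X := fun v => π ⁻¹' {w | δ v w ≤ R₀ + R}
  have hT' : ∀ v, MeasurableSet (T' v) := fun v => hm.measurableSet_preimage _
  have hTT' : ∀ v b, T (f (v, b)) ⊆ T' v := fun v b x hx => by
    have h1 := hm.triangle v (f (v, b)) (π x)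
    have h2 : δ v (f (v, b)) ≤ R := hfR (v, b)
    have h3 : δ (f (v, b)) (π x) ≤ R₀ := hx
    change δ v (π x) ≤ R₀ + R
    linarith
  have htlow : ∀ v, (c₀ : ℝ≥0∞) ≤ μ (T v) := fun v =>
    (hball' v).trans (measure_mono fun x hx => le_trans (show δ v (π x) ≤ R₀' from hx)
      (le_max_left _ _))
  have htup : ∀ v, μ (T v) ≤ N * M := fun v => by
    have h1 := hm.measure_preimage_finset (hm.finite_ball R₀ v).toFinset
    rw [Set.Finite.coe_toFinset] at h1
    rw [h1]
    refine (Finset.sum_le_card_nsmul _ _ (M : ℝ≥0∞) fun w _ => hM w).trans ?_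
    rw [nsmul_eq_mul]
    gcongr
    have := hN v
    rw [(hm.finite_ball R₀ v).encard_eq_coe_toFinset_card] at this
    exact_mod_cast this
  have httop : ∀ v, μ (T v) ≠ ∞ := fun v =>
    ((htup v).trans_lt (ENNReal.mul_lt_top (ENNReal.natCast_lt_top N) ENNReal.coe_lt_top)).ne
  have hc₀' : (c₀ : ℝ≥0∞) ≠ 0 := by exact_mod_cast hc₀.ne'
  have hc' : (c : ℝ≥0∞) ≠ 0 := by exact_mod_cast hc.ne'
  -- Chosen so that the total error is at most `S / 4`.
  set ε : ℝ≥0 := c₀ * c₀ * c / (24 * (N + 1) ^ 2 * (M + 1)) with hε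
  have hεpos : 0 < ε := by positivity
  obtain ⟨g, hg, hg0, hgtop, hgE⟩ :=
    exists_small_energy_of_markovSpectralRadius_eq_one hP.isReversible hρ hεpos
  set Γ : X → ℝ≥0∞ := fun x => ENNReal.ofReal (g x ^ 2) with hΓ
  have hΓm : Measurable Γ := (hg.pow_const 2).ennreal_ofReal
  set K : X → X → ℝ≥0∞ := fun x y => ENNReal.ofReal ((g x - g y) ^ 2) with hK
  have hKm : Measurable (Function.uncurry K) := by
    change Measurable fun p : X × X => ENNReal.ofReal ((g p.1 - g p.2) ^ 2)
    fun_prop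
  let a : V → ℝ≥0∞ := fun v => ∫⁻ x in T v, Γ x ∂μ
  let e : V → ℝ≥0∞ := fun v => ∫⁻ x in T v, ∫⁻ y in T' v, K x y ∂μ ∂μ
  have hstep : ∀ p : V × Bool, a p.1 / μ (T p.1) ≤
      3 / 2 * (a (f p) / μ (T (f p))) + 3 * (e p.1 / (c₀ * c₀)) := by
    rintro ⟨v, b⟩
    refine ENNReal.div_le_of_mul_le hc₀' (htlow _) (htlow _) (httop _) (httop _) ?_
    have h1 : ∫⁻ x in T v, ∫⁻ _ in T (f (v, b)), Γ x ∂μ ∂μ = a v * μ (T (f (v, b))) := by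
      simp only [setLIntegral_const]
      rw [lintegral_mul_const _ hΓm]
    have h2 : ∫⁻ x in T v, ∫⁻ y in T (f (v, b)), (3 / 2 * Γ y + 3 * K x y) ∂μ ∂μ =
        3 / 2 * (μ (T v) * a (f (v, b))) +
          3 * ∫⁻ x in T v, ∫⁻ y in T (f (v, b)), K x y ∂μ ∂μ := by
      have hKx : ∀ x, Measurable (K x) := fun x => hKm.comp measurable_prodMk_left
      have h3 : ∀ x, ∫⁻ y in T (f (v, b)), (3 / 2 * Γ y + 3 * K x y) ∂μ =
          3 / 2 * a (f (v, b)) + 3 * ∫⁻ y in T (f (v, b)), K x y ∂μ := fun x => by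
        rw [lintegral_add_left (hΓm.const_mul _), lintegral_const_mul _ hΓm,
          lintegral_const_mul _ (hKx x)]
      simp only [h3]
      rw [lintegral_add_left measurable_const, setLIntegral_const, lintegral_const_mul]
      · ring
      · exact hKm.lintegral_prod_right'
    rw [← h1]
    refine (lintegral_mono fun x => lintegral_mono fun y =>
      ENNReal.ofReal_sq_le_add (g x) (g y)).trans (h2.le.trans ?_)
    gcongr
    exact lintegral_mono fun x => lintegral_mono_set (hTT' v b)
  have hsuma : ∑' v, a v ≤ N * ∫⁻ x, Γ x ∂μ :=
    hm.tsum_setLIntegral_le hN (fun _ => hΓm) (Filter.Eventually.of_forall fun x v _ => le_rfl)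
  have hsumb : ∫⁻ x, Γ x ∂μ ≤ ∑' v, a v := hm.lintegral_le_tsum_setLIntegral hR₀ hΓm
  have hsume : ∑' v, e v ≤ N * ((c : ℝ≥0∞)⁻¹ * (ε * ∫⁻ x, Γ x ∂μ)) := by
    have h1 : ∑' v, e v ≤ N * ∫⁻ x, (c : ℝ≥0∞)⁻¹ * ∫⁻ y, K x y ∂(P x) ∂μ := by
      refine hm.tsum_setLIntegral_le hN (F := fun v x => ∫⁻ y in T' v, K x y ∂μ)
        (fun v => hKm.lintegral_prod_right') ?_
      filter_upwards [hcP] with x hx v hv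
      rw [← ENNReal.div_eq_inv_mul, ENNReal.le_div_iff_mul_le (.inl hc') (.inl ENNReal.coe_ne_top),
        mul_comm]
      refine hx _ (hKm.comp measurable_prodMk_left) _ (hT' v) fun y hy => ?_
      have h1 := (abs_le.1 (hD x y)).2
      have h2 := hm.triangle (π x) v (π y)
      rw [hm.symm (π x) v] at h2
      have h3 : δ v (π y) ≤ R₀ + R := hy
      linarith
    refine h1.trans ?_
    rw [lintegral_const_mul' _ _ (ENNReal.inv_ne_top.2 hc')]
    gcongr
  let S : ℝ≥0∞ := ∑' v, a v / μ (T v)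
  have hSlow : ∫⁻ x, Γ x ∂μ ≤ N * M * S := by
    refine hsumb.trans ?_
    rw [← ENNReal.tsum_mul_left]
    refine ENNReal.tsum_le_tsum fun v => ?_
    have h0 : μ (T v) ≠ 0 := fun h0 => hc₀' (by simpa [h0] using htlow v)
    calc a v = μ (T v) * (a v / μ (T v)) := (ENNReal.mul_div_cancel h0 (httop v)).symm
      _ ≤ N * M * (a v / μ (T v)) := by gcongr; exact htup v
  have hStop : S ≠ ∞ := by
    have : S ≤ (N * ∫⁻ x, Γ x ∂μ) / c₀ := by
      calc S ≤ ∑' v, a v / c₀ := ENNReal.tsum_le_tsum fun v => ENNReal.div_le_div_left (htlow v) _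
        _ = (∑' v, a v) / c₀ := by simp only [div_eq_mul_inv, ENNReal.tsum_mul_right]
        _ ≤ _ := ENNReal.div_le_div_right hsuma _
    exact (this.trans_lt (ENNReal.div_lt_top
      (ENNReal.mul_ne_top (ENNReal.natCast_ne_top N) hgtop) hc₀')).ne
  have hS0 : S ≠ 0 := by
    intro h0
    rw [h0, mul_zero] at hSlow
    exact hg0 (nonpos_iff_eq_zero.1 hSlow)
  have hmain : 2 * S ≤ 3 / 2 * S + 3 * (2 * ((∑' v, e v) / (c₀ * c₀))) := by
    have htwo : ∀ φ : V → ℝ≥0∞, ∑' p : V × Bool, φ p.1 = 2 * ∑' v, φ v := fun φ => by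
      rw [ENNReal.tsum_prod', ← ENNReal.tsum_mul_left]
      simp [two_mul]
    calc 2 * S = ∑' p : V × Bool, a p.1 / μ (T p.1) := (htwo fun v => a v / μ (T v)).symm
      _ ≤ ∑' p : V × Bool, (3 / 2 * (a (f p) / μ (T (f p))) + 3 * (e p.1 / (c₀ * c₀))) :=
          ENNReal.tsum_le_tsum hstep
      _ = 3 / 2 * (∑' p : V × Bool, a (f p) / μ (T (f p))) +
          3 * ∑' p : V × Bool, e p.1 / (c₀ * c₀) := by
          rw [ENNReal.tsum_add, ENNReal.tsum_mul_left, ENNReal.tsum_mul_left]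
      _ ≤ _ := by
          rw [htwo fun v => e v / (c₀ * c₀)]
          gcongr
          · exact ENNReal.tsum_comp_le_tsum_of_injective hf fun v => a v / μ (T v)
          · simp only [div_eq_mul_inv, ENNReal.tsum_mul_right, le_refl]
  have hfinal : 2 * S ≤ 3 / 2 * S + 3 * (2 * (N * ((c : ℝ≥0∞)⁻¹ * (ε * (N * M * S))) /
      (c₀ * c₀))) := by
    refine hmain.trans ?_
    gcongr
    refine hsume.trans ?_
    gcongr
  obtain ⟨s, hs⟩ : ∃ s : ℝ≥0, S = s := ⟨_, (ENNReal.coe_toNNReal hStop).symm⟩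
  rw [hs] at hfinal hS0
  have hs0 : 0 < s := pos_iff_ne_zero.2 (by exact_mod_cast hS0)
  have hfinal' : 2 * s ≤ 3 / 2 * s + 3 * (2 * (N * (c⁻¹ * (ε * (N * M * s))) / (c₀ * c₀))) := by
    have h32 : ((3 / 2 : ℝ≥0) : ℝ≥0∞) = 3 / 2 := by
      rw [ENNReal.coe_div (by norm_num)]; norm_num
    rw [← h32, ← ENNReal.coe_inv hc.ne'] at hfinal
    have h0 : c₀ * c₀ ≠ 0 := (mul_pos hc₀ hc₀).ne'
    rw [← ENNReal.coe_le_coe]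
    push_cast [ENNReal.coe_div h0]
    push_cast at hfinal
    exact hfinal
  have hκ : 3 * (2 * (N * (c⁻¹ * (ε * (N * M * s))) / (c₀ * c₀))) ≤ 1 / 4 * s := by
    rw [hε]
    have e1 : 3 * (2 * (N * (c⁻¹ * (c₀ * c₀ * c / (24 * (N + 1) ^ 2 * (M + 1)) * (N * M * s))) /
        (c₀ * c₀))) = 1 / 4 * s * ((N ^ 2 * M) / ((N + 1) ^ 2 * (M + 1))) := by
      field_simp
      ring
    rw [e1]
    refine mul_le_of_le_one_right zero_le ?_
    rw [div_le_one (by positivity)]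
    gcongr <;> exact le_self_add
  have h1 : 2 * s ≤ 3 / 2 * s + 1 / 4 * s := hfinal'.trans (by gcongr)
  have h2 : (2 : ℝ) * s ≤ 3 / 2 * s + 1 / 4 * s := by exact_mod_cast h1
  have h3 : (0 : ℝ) < s := hs0
  linarith

end

/-! ### Existence of reversible viewpoints -/

/-- Uniform jumps `a` to related points need not be reversible, as the masses `t v` vary. Composing
`a` with its time reversal, whose density is `a w z / A z`, gives a symmetric kernel of total mass
`1`; the bounds on `t` and `A` give the lower estimate. -/
lemma exists_symmetric_weights {V : Type*} (m : V → ℝ≥0∞) (r : V → V → Prop)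
    (hr : ∀ v w, r v w → r w v) {c C : ℝ≥0∞} (hc : c ≠ 0) (hC : C ≠ ∞)
    (hlow : ∀ v, c ≤ ∑' w, {w | r v w}.indicator m w)
    (hup : ∀ v, ∑' w, {w | r v w}.indicator m w ≤ C) :
    ∃ κ : V → V → ℝ≥0∞, (∀ v w, κ v w = κ w v) ∧ (∀ v, ∑' w, κ v w * m w = 1) ∧
      (∀ v w, κ v w ≠ 0 → ∃ z, r v z ∧ r w z) ∧
      ∀ v w, C⁻¹ * C⁻¹ * (C / c)⁻¹ * ∑' z, {z | r v z ∧ r w z}.indicator m z ≤ κ v w := by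
  classical
  let t : V → ℝ≥0∞ := fun v => ∑' w, {w | r v w}.indicator m w
  have ht0 : ∀ v, t v ≠ 0 := fun v h => hc (nonpos_iff_eq_zero.1 ((hlow v).trans h.le))
  have htt : ∀ v, t v ≠ ∞ := fun v => ((hup v).trans_lt hC.lt_top).ne
  let a : V → V → ℝ≥0∞ := fun v z => if r v z then (t v)⁻¹ else 0
  let A : V → ℝ≥0∞ := fun z => ∑' w, a w z * m w
  have haind : ∀ v z, a v z * m z = (t v)⁻¹ * {w | r v w}.indicator m z := fun v z => by
    by_cases h : r v z <;> simp [a, h]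
  have haind' : ∀ w z, a w z * m w = (t w)⁻¹ * {w | r z w}.indicator m w := fun w z => by
    by_cases h : r w z
    · simp [a, h, hr w z h]
    · have h' : ¬ r z w := fun h' => h (hr z w h')
      simp [a, h, h']
  have hAup : ∀ z, A z ≤ C / c := fun z => by
    calc A z ≤ ∑' w, c⁻¹ * {w | r z w}.indicator m w := ENNReal.tsum_le_tsum fun w => by
          rw [haind']
          gcongr
          exact hlow w
      _ = c⁻¹ * t z := ENNReal.tsum_mul_left
      _ ≤ C / c := by
          rw [ENNReal.div_eq_inv_mul]
          gcongr
          exact hup z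
  have hAlow : ∀ z, C⁻¹ * c ≤ A z := fun z => by
    calc C⁻¹ * c ≤ C⁻¹ * t z := by gcongr; exact hlow z
      _ = ∑' w, C⁻¹ * {w | r z w}.indicator m w := ENNReal.tsum_mul_left.symm
      _ ≤ A z := ENNReal.tsum_le_tsum fun w => by
          rw [haind']
          gcongr
          exact hup w
  have hA0 : ∀ z, A z ≠ 0 := fun z h => by
    have := nonpos_iff_eq_zero.1 ((hAlow z).trans h.le)
    exact (mul_ne_zero (ENNReal.inv_ne_zero.2 hC) hc) this
  have hAt : ∀ z, A z ≠ ∞ := fun z => ((hAup z).trans_lt (ENNReal.div_lt_top hC hc)).ne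
  refine ⟨fun v w => ∑' z, a v z * a w z * (m z / A z), fun v w => ?_, fun v => ?_, fun v w h => ?_,
    fun v w => ?_⟩
  · simp only [mul_comm (a v _)]
  · simp only [← ENNReal.tsum_mul_right]
    rw [ENNReal.tsum_comm]
    calc ∑' z, ∑' w, a v z * a w z * (m z / A z) * m w
        = ∑' z, (t v)⁻¹ * {w | r v w}.indicator m z := by
          refine tsum_congr fun z => ?_
          rw [← haind]
          calc ∑' w, a v z * a w z * (m z / A z) * m w
              = ∑' w, a v z * (m z / A z) * (a w z * m w) := tsum_congr fun w => by ring
            _ = a v z * (m z / A z) * A z := ENNReal.tsum_mul_left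
            _ = a v z * m z := by rw [mul_assoc, ENNReal.div_mul_cancel (hA0 z) (hAt z)]
      _ = (t v)⁻¹ * t v := ENNReal.tsum_mul_left
      _ = 1 := ENNReal.inv_mul_cancel (ht0 v) (htt v)
  · obtain ⟨z, hz⟩ : ∃ z, a v z * a w z * (m z / A z) ≠ 0 := by
      by_contra! h0
      exact h (ENNReal.tsum_eq_zero.2 h0)
    refine ⟨z, ?_, ?_⟩ <;> by_contra h' <;> simp [a, h'] at hz
  · rw [← ENNReal.tsum_mul_left]
    refine ENNReal.tsum_le_tsum fun z => ?_
    by_cases hz : r v z ∧ r w z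
    · rw [Set.indicator_of_mem (show z ∈ {z | r v z ∧ r w z} from hz)]
      simp only [a, hz.1, hz.2, if_true]
      have e : m z / A z = (A z)⁻¹ * m z := ENNReal.div_eq_inv_mul
      rw [e, mul_assoc (C⁻¹ * C⁻¹)]
      gcongr
      · exact hup v
      · exact hup w
      · exact hAup z
    · rw [Set.indicator_of_notMem (show z ∉ {z | r v z ∧ r w z} from hz), mul_zero]
      exact zero_le

section

variable {X : Type*} [MeasurableSpace X] {d : X → X → ℝ} {μ : Measure X} [SigmaFinite μ]
  {V : Type*} [Countable V] {π : X → V} {δ : V → V → ℝ}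

omit [SigmaFinite μ] in
lemma IsCoarseModel.lintegral_comp (hm : IsCoarseModel d μ π δ) (ν : Measure X) (F : V → ℝ≥0∞) :
    ∫⁻ x, F (π x) ∂ν = ∑' v, F v * ν (π ⁻¹' {v}) := by
  let : MeasurableSpace V := ⊤
  have hπ : Measurable π := fun S _ => hm.measurableSet_preimage S
  have h1 := lintegral_map (μ := ν) (f := F) (g := π) (fun _ _ => trivial) hπ
  rw [← h1, lintegral_countable']
  refine tsum_congr fun v => ?_
  rw [Measure.map_apply hπ trivial]

theorem IsCoarseModel.exists_isReversibleViewpoint (hm : IsCoarseModel d μ π δ) {h : ℝ}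
    (hh : 0 < h) :
    ∃ (P : Kernel X X) (_ : IsMarkovKernel P), IsReversibleViewpoint d μ h P := by
  obtain ⟨D', hD'⟩ := hm.abs_sub_le
  obtain ⟨M, hM⟩ := hm.fiber_le
  obtain ⟨R₀, c₀, hc₀, hball⟩ := hm.le_ball
  set D := max D' 0
  have hD0 : 0 ≤ D := le_max_right _ _
  have hD : ∀ x y, |d x y - δ (π x) (π y)| ≤ D := fun x y => (hD' x y).trans (le_max_left _ _)
  -- If `d x y ≤ h`, the `R₀`-ball about `π x` lies in the `R`-balls about both `π x` and `π y`, so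
  -- the lower bound on `κ` is uniform.
  set R := h + D + R₀ with hR
  obtain ⟨N, hN⟩ := hm.card_ball R
  let m : V → ℝ≥0∞ := fun v => μ (π ⁻¹' {v})
  have hsum : ∀ S : Set V, ∑' v, S.indicator m v = μ (π ⁻¹' S) := fun S => by
    have h1 := hm.lintegral_comp μ (S.indicator 1)
    have h2 : ∀ v, S.indicator 1 v * μ (π ⁻¹' {v}) = S.indicator m v := fun v => by
      by_cases hv : v ∈ S <;> simp [hv, m]
    simp only [h2] at h1
    rw [← h1]
    exact lintegral_indicator_one (hm.measurableSet_preimage S)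
  have hlow : ∀ v, (c₀ : ℝ≥0∞) ≤ ∑' w, {w | δ v w ≤ R}.indicator m w := fun v => by
    rw [hsum]
    refine (hball v).trans (measure_mono fun x hx => ?_)
    have : δ v (π x) ≤ R₀ := hx
    change δ v (π x) ≤ R
    linarith
  have hup : ∀ v, ∑' w, {w | δ v w ≤ R}.indicator m w ≤ N * M + 1 := fun v =>
    (ENNReal.tsum_le_mul_of_encard_le (hN v) (fun w hw => Set.indicator_of_notMem hw _)
      fun w hw => by rw [Set.indicator_of_mem hw]; exact hM w).trans le_self_add
  have hCtop : (N * M + 1 : ℝ≥0∞) ≠ ∞ := by finiteness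
  obtain ⟨κ, hκs, hκ1, hκ0, hκc⟩ := exists_symmetric_weights m (fun v w => δ v w ≤ R)
    (fun v w => by rw [hm.symm]; exact id) (c := c₀) (C := N * M + 1)
    (by exact_mod_cast hc₀.ne') hCtop hlow hup
  have hmeas : ∀ {Y : Type _} [MeasurableSpace Y] (F : V → Y), Measurable fun x => F (π x) :=
    fun F S _ => hm.measurableSet_preimage (F ⁻¹' S)
  let P : Kernel X X := ⟨fun x => μ.withDensity fun y => κ (π x) (π y),
    fun S _ => hm.measurableSet_preimage ((fun v => μ.withDensity fun y => κ v (π y)) ⁻¹' S)⟩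
  have hPx : ∀ x, P x = μ.withDensity fun y => κ (π x) (π y) := fun x => rfl
  have hPM : IsMarkovKernel P := ⟨fun x => ⟨by
    rw [hPx, withDensity_apply _ MeasurableSet.univ, Measure.restrict_univ, hm.lintegral_comp]
    exact hκ1 _⟩⟩
  refine ⟨P, hPM, ⟨⟨hPM, max 1 ((2 * R + D) / h), le_max_left _ _, ?_⟩, ?_⟩⟩
  · set C : ℝ≥0 := N * M + 1 with hC
    have hC0 : C ≠ 0 := by positivity
    have hCC : (N * M + 1 : ℝ≥0∞) = C := by push_cast [hC]; rfl
    rw [hCC] at hκc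
    refine ⟨C⁻¹ * C⁻¹ * (C / c₀)⁻¹ * c₀, by positivity, Filter.Eventually.of_forall fun x => ?_⟩
    have hrn : (P x).rnDeriv μ =ᵐ[μ] fun y => κ (π x) (π y) := by
      rw [hPx]
      exact Measure.rnDeriv_withDensity μ (hmeas fun v => κ (π x) v)
    refine ⟨withDensity_absolutelyContinuous _ _, ?_, ?_⟩
    · filter_upwards [hrn] with y hy hne
      rw [hy] at hne
      obtain ⟨z, hz1, hz2⟩ := hκ0 _ _ hne
      have h1 := (abs_le.1 (hD x y)).2
      have h2 := hm.triangle (π x) z (π y)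
      rw [hm.symm z] at h2
      have h3 : (2 * R + D) / h * h = 2 * R + D := div_mul_cancel₀ _ hh.ne'
      have h4 : (2 * R + D) / h * h ≤ max 1 ((2 * R + D) / h) * h := by
        gcongr
        exact le_max_right _ _
      linarith
    · filter_upwards [hrn] with y hy hdxy
      rw [hy]
      refine le_trans ?_ (hκc _ _)
      rw [hsum, ENNReal.coe_mul, ENNReal.coe_mul, ENNReal.coe_mul, ENNReal.coe_inv hC0,
        ENNReal.coe_inv (div_pos (pos_iff_ne_zero.2 hC0) hc₀).ne', ENNReal.coe_div hc₀.ne']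
      gcongr
      refine (hball (π x)).trans (measure_mono fun z hz => ?_)
      have h1 : δ (π x) (π z) ≤ R₀ := hz
      have h2 := (abs_le.1 (hD x y)).1
      have h3 := hm.triangle (π y) (π x) (π z)
      rw [hm.symm (π y) (π x)] at h3
      exact ⟨by linarith, by linarith⟩
  · have key : ∀ S T : Set X, MeasurableSet S → MeasurableSet T → ∫⁻ x in S, P x T ∂μ =
        ∑' v, ∑' w, κ v w * μ.restrict T (π ⁻¹' {w}) * μ.restrict S (π ⁻¹' {v}) := by
      intro S T hS hT
      have h1 : ∀ x, P x T = ∑' w, κ (π x) w * μ.restrict T (π ⁻¹' {w}) := fun x => by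
        rw [hPx, withDensity_apply _ hT, hm.lintegral_comp]
      simp only [h1]
      rw [hm.lintegral_comp _ fun v => ∑' w, κ v w * μ.restrict T (π ⁻¹' {w})]
      simp only [ENNReal.tsum_mul_right]
    intro S T hS hT
    rw [key S T hS hT, key T S hT hS, ENNReal.tsum_comm]
    refine tsum_congr fun v => tsum_congr fun w => ?_
    rw [hκs]
    ring

-- Shrinking the scale weakens the lower bound on the density, and the support condition survives
-- with `A * h' / h` for `A`.
omit [SigmaFinite μ] in
lemma IsReversibleViewpoint.of_le {P : Kernel X X} {h h' : ℝ} (hP : IsReversibleViewpoint d μ h' P)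
    (hh : 0 < h) (hhh' : h ≤ h') : IsReversibleViewpoint d μ h P := by
  obtain ⟨⟨hM, A, hA, c, hc, hx⟩, hr⟩ := hP
  refine ⟨⟨hM, A * h' / h, ?_, c, hc, ?_⟩, hr⟩
  · rw [le_div_iff₀ hh, one_mul]
    exact hhh'.trans (le_mul_of_one_le_left (hh.le.trans hhh') hA)
  · filter_upwards [hx] with x ⟨h1, h2, h3⟩
    refine ⟨h1, ?_, ?_⟩
    · rwa [div_mul_cancel₀ _ hh.ne']
    · filter_upwards [h3] with y hy hd
      exact hy (hd.trans hhh')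

end

/-! ### Word metrics -/

section WordMetric

variable {G : Type*} [Group G] {S : Set G}

lemma pow_insert_one_mono {m n : ℕ} (h : m ≤ n) : (insert 1 S) ^ m ⊆ (insert 1 S) ^ n :=
  Set.pow_subset_pow_right (Set.mem_insert _ _) h

lemma inv_pow_insert_one (hS : S⁻¹ = S) (n : ℕ) : ((insert 1 S) ^ n)⁻¹ = (insert 1 S) ^ n := by
  rw [← inv_pow, Set.inv_insert, hS, inv_one]

lemma mem_pow_insert_one_iff {x : G} {n : ℕ} : x ∈ (insert 1 S) ^ n ↔ ∃ k ≤ n, x ∈ S ^ k := by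
  constructor
  · induction n generalizing x with
    | zero => exact fun hx => ⟨0, le_rfl, by simpa using hx⟩
    | succ n ih =>
      rw [pow_succ]
      rintro ⟨y, hy, z, hz, rfl⟩
      obtain ⟨k, hk, hyk⟩ := ih hy
      rcases hz with rfl | hz
      · exact ⟨k, by omega, by simpa using hyk⟩
      · exact ⟨k + 1, by omega, by rw [pow_succ]; exact Set.mul_mem_mul hyk hz⟩
  · rintro ⟨k, hk, hx⟩
    exact pow_insert_one_mono hk (Set.pow_subset_pow_left (Set.subset_insert _ _) hx)

lemma exists_mem_pow_insert_one (hS : S⁻¹ = S) (hgen : Subgroup.closure S = ⊤) (x : G) :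
    ∃ n : ℕ, x ∈ (insert 1 S) ^ n := by
  have hx : x ∈ Subgroup.closure S := by rw [hgen]; trivial
  induction hx using Subgroup.closure_induction with
  | mem x hx => exact ⟨1, by rw [pow_one]; exact Set.mem_insert_of_mem _ hx⟩
  | one => exact ⟨0, by simp⟩
  | mul x y _ _ hx hy =>
    obtain ⟨m, hm⟩ := hx
    obtain ⟨n, hn⟩ := hy
    exact ⟨m + n, by rw [pow_add]; exact Set.mul_mem_mul hm hn⟩
  | inv x _ hx =>
    obtain ⟨n, hn⟩ := hx
    exact ⟨n, by rw [← inv_pow_insert_one hS]; exact Set.inv_mem_inv.2 hn⟩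

lemma wordDist_le_iff (hS : S⁻¹ = S) (hgen : Subgroup.closure S = ⊤) (g h : G) (n : ℕ) :
    wordDist S g h ≤ n ↔ g⁻¹ * h ∈ (insert 1 S) ^ n := by
  rw [wordDist, Nat.cast_le, mem_pow_insert_one_iff]
  constructor
  · intro hle
    -- Generation makes the set nonempty, so the infimum is attained and is not the default `0`.
    refine ⟨_, hle, Nat.sInf_mem (s := {n : ℕ | g⁻¹ * h ∈ S ^ n}) ?_⟩
    obtain ⟨m, hm⟩ := exists_mem_pow_insert_one hS hgen (g⁻¹ * h)
    obtain ⟨k, -, hk⟩ := mem_pow_insert_one_iff.1 hm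
    exact ⟨k, hk⟩
  · rintro ⟨k, hk, hx⟩
    exact (Nat.sInf_le hx).trans hk

/-- By Baire, some closed power of `insert 1 S` has an interior point, so its double power is a
neighbourhood of `1`. Finitely many translates of it cover `Q`. -/
lemma exists_compact_subset_pow_insert_one [TopologicalSpace G] [IsTopologicalGroup G]
    [LocallyCompactSpace G] [T2Space G] (hSc : IsCompact S) (hS : S⁻¹ = S)
    (hgen : Subgroup.closure S = ⊤) {Q : Set G} (hQ : IsCompact Q) :
    ∃ n : ℕ, Q ⊆ (insert 1 S) ^ n := by
  have hT : IsCompact (insert 1 S) := hSc.insert 1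
  have hU : ⋃ n : ℕ, (insert 1 S) ^ n = Set.univ :=
    Set.eq_univ_of_forall fun x => Set.mem_iUnion.2 (exists_mem_pow_insert_one hS hgen x)
  obtain ⟨n, g, hg⟩ := nonempty_interior_of_iUnion_of_closed
    (fun n => (hT.pow_set n).isClosed) hU
  have hN : (insert 1 S) ^ (n + n) ∈ nhds (1 : G) := by
    have h1 : g⁻¹ • (insert 1 S) ^ n ∈ nhds (1 : G) := by
      have := smul_mem_nhds_smul g⁻¹ (mem_interior_iff_mem_nhds.1 hg)
      simpa using this
    refine Filter.mem_of_superset h1 ?_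
    rintro _ ⟨y, hy, rfl⟩
    rw [pow_add]
    refine Set.mul_mem_mul ?_ hy
    rw [← inv_pow_insert_one hS]
    exact Set.inv_mem_inv.2 (interior_subset hg)
  obtain ⟨t, -, ht⟩ := hQ.elim_nhds_subcover (fun q => q • (insert 1 S) ^ (n + n)) fun q _ => by
    simpa using smul_mem_nhds_smul q hN
  choose k hk using exists_mem_pow_insert_one hS hgen
  refine ⟨∑ q ∈ t, k q + (n + n), fun x hx => ?_⟩
  obtain ⟨q, hq, y, hy, rfl⟩ := Set.mem_iUnion₂.1 (ht hx)
  rw [pow_add]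
  exact Set.mul_mem_mul
    (pow_insert_one_mono (Finset.single_le_sum (fun _ _ => Nat.zero_le _) hq) (hk q)) hy

end WordMetric

/-! ### Expansion in graphs -/

section Graph

variable {V : Type*} {Γ : SimpleGraph V}

lemma SimpleGraph.Connected.exists_adj_of_dist_le_succ (hΓ : Γ.Connected) {u w : V} {k : ℕ}
    (h : Γ.dist u w ≤ k + 1) : ∃ v, Γ.dist u v ≤ k ∧ (v = w ∨ Γ.Adj v w) := by
  obtain ⟨p, hp⟩ := hΓ.exists_walk_length_eq_dist w u
  cases p with
  | nil => exact ⟨u, by simp, .inl rfl⟩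
  | cons hadj q =>
    rename_i v
    refine ⟨v, ?_, .inr hadj.symm⟩
    rw [SimpleGraph.Walk.length_cons, SimpleGraph.dist_comm] at hp
    rw [SimpleGraph.dist_comm]
    have := SimpleGraph.dist_le q
    omega

lemma SimpleGraph.Connected.encard_ball_le (hΓ : Γ.Connected) {D : ℕ}
    (hD : ∀ v, (Γ.neighborSet v).encard ≤ D) (k : ℕ) (v : V) :
    {w | Γ.dist v w ≤ k}.encard ≤ ((D + 1) ^ k : ℕ) := by
  classical
  induction k with
  | zero =>
    have : {w | Γ.dist v w ≤ 0} ⊆ {v} := fun w hw => by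
      have h0 : Γ.dist v w = 0 := Nat.le_zero.1 hw
      exact ((hΓ.dist_eq_zero_iff).1 h0).symm
    exact (Set.encard_le_encard this).trans (by simp)
  | succ k ih =>
    have hfin : {w | Γ.dist v w ≤ k}.Finite := Set.finite_of_encard_le_coe ih
    have hN : ∀ u, (insert u (Γ.neighborSet u)).encard ≤ (D + 1 : ℕ) := fun u =>
      (Set.encard_insert_le _ _).trans (by push_cast; gcongr; exact hD u)
    have hNf : ∀ u, (insert u (Γ.neighborSet u)).Finite := fun u =>
      Set.finite_of_encard_le_coe (hN u)
    have hsub : {w | Γ.dist v w ≤ k + 1} ⊆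
        (hfin.toFinset.biUnion fun u => (hNf u).toFinset : Finset V) := by
      intro w hw
      obtain ⟨u, hu, huw⟩ := hΓ.exists_adj_of_dist_le_succ hw
      simp only [Finset.coe_biUnion, Set.mem_iUnion, Set.Finite.coe_toFinset]
      refine ⟨u, hu, ?_⟩
      rcases huw with rfl | huw
      · exact Set.mem_insert _ _
      · exact Set.mem_insert_of_mem _ huw
    refine (Set.encard_le_encard hsub).trans ?_
    rw [Set.encard_coe_eq_coe_finsetCard, Nat.cast_le, pow_succ]
    refine (Finset.card_biUnion_le_card_mul _ _ (D + 1) fun u _ => ?_).trans ?_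
    · have := hN u
      rw [(hNf u).encard_eq_coe_toFinset_card] at this
      exact_mod_cast this
    · rw [hfin.encard_eq_coe_toFinset_card] at ih
      gcongr
      exact_mod_cast ih

lemma SimpleGraph.Connected.finite_ball (hΓ : Γ.Connected) {D : ℕ}
    (hD : ∀ v, (Γ.neighborSet v).encard ≤ D) (k : ℕ) (v : V) : {w | Γ.dist v w ≤ k}.Finite :=
  Set.finite_of_encard_le_coe (hΓ.encard_ball_le hD k v)

/-- A graph of bounded degree with positive Cheeger constant has exponential expansion. -/
lemma SimpleGraph.Connected.exists_expansion (hΓ : Γ.Connected) {D : ℕ}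
    (hD : ∀ v, (Γ.neighborSet v).encard ≤ D) (hc : 0 < cheegerConstant Γ) (L : ℝ) :
    ∃ k : ℕ, ∀ F : Finset V, F.Nonempty →
      L * F.card < (nbhdOf (fun v w => Γ.dist v w ≤ k) F).ncard := by
  classical
  obtain ⟨κ, hκ0, hκ⟩ := ENNReal.lt_iff_exists_nnreal_btwn.1 hc
  have hκpos : (0 : ℝ) < κ := by exact_mod_cast hκ0
  have hfin := hΓ.finite_ball hD
  -- At most `D` boundary edges end at each outer neighbour of `F`, so many edges mean many
  -- neighbours; `D + 1` guards against `D = 0`.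
  have hstep : ∀ F : Finset V, (1 + κ / (D + 1) : ℝ) * F.card ≤
      (nbhdOf (fun v w => Γ.dist v w ≤ 1) F).ncard := by
    intro F
    rcases F.eq_empty_or_nonempty with rfl | hF
    · simp
    have hnf := finite_nbhdOf (hfin 1) F
    have hsub : F ⊆ hnf.toFinset := fun v hv => by
      rw [Set.Finite.mem_toFinset]
      exact ⟨v, hv, by simp⟩
    set B := hnf.toFinset \ F with hB
    have hNf : ∀ u, (Γ.neighborSet u).Finite := fun u => Set.finite_of_encard_le_coe (hD u)
    have hNc : ∀ u, (hNf u).toFinset.card ≤ D := fun u => by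
      have := hD u
      rw [(hNf u).encard_eq_coe_toFinset_card] at this
      exact_mod_cast this
    have hedge : {e : V × V | e.1 ∈ F ∧ e.2 ∉ F ∧ Γ.Adj e.1 e.2} ⊆
        (B.biUnion fun w => (hNf w).toFinset.image fun v => (v, w) : Finset (V × V)) := by
      rintro ⟨v, w⟩ ⟨hv, hw, hvw⟩
      simp only [Finset.coe_biUnion, Set.mem_iUnion]
      refine ⟨w, ?_, ?_⟩
      · rw [hB, Finset.mem_coe, Finset.mem_sdiff, Set.Finite.mem_toFinset]
        exact ⟨⟨v, hv, (SimpleGraph.dist_eq_one_iff_adj.2 hvw).le⟩, hw⟩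
      · simpa using hvw.symm
    have h1 : {e : V × V | e.1 ∈ F ∧ e.2 ∉ F ∧ Γ.Adj e.1 e.2}.encard ≤ (B.card * D : ℕ) := by
      refine (Set.encard_le_encard hedge).trans ?_
      rw [Set.encard_coe_eq_coe_finsetCard, Nat.cast_le]
      exact Finset.card_biUnion_le_card_mul _ _ _ fun w _ => Finset.card_image_le.trans (hNc w)
    have h2 : (κ : ℝ≥0∞) ≤ (B.card * D : ℕ) / F.card := by
      refine hκ.le.trans ((iInf_le _ (⟨F, hF⟩ : {F : Finset V // F.Nonempty})).trans ?_)
      refine ENNReal.div_le_div_right ?_ _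
      exact_mod_cast h1
    have hF0 : (F.card : ℝ≥0∞) ≠ 0 := by exact_mod_cast hF.card_pos.ne'
    rw [ENNReal.le_div_iff_mul_le (.inl hF0) (.inl (ENNReal.natCast_ne_top _))] at h2
    have h3 : (κ : ℝ) * F.card ≤ B.card * D := by
      have : κ * F.card ≤ ((B.card * D : ℕ) : ℝ≥0) := by exact_mod_cast h2
      exact_mod_cast this
    have h4 : (κ : ℝ) / (D + 1) * F.card ≤ B.card := by
      rw [div_mul_eq_mul_div, div_le_iff₀ (by positivity)]
      refine h3.trans ?_
      gcongr
      linarith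
    have h5 : (B.card : ℝ) = (nbhdOf (fun v w => Γ.dist v w ≤ 1) F).ncard - F.card := by
      rw [hB, Finset.cast_card_sdiff hsub, ← Set.ncard_eq_toFinset_card _ hnf]
    rw [add_mul, one_mul]
    linarith
  obtain ⟨k, hk⟩ := pow_unbounded_of_one_lt L
    (show (1 : ℝ) < 1 + κ / (D + 1) by have : 0 < (κ : ℝ) / (D + 1) := by positivity
                                       linarith)
  refine ⟨k, fun F hF => ?_⟩
  have hF' : (0 : ℝ) < F.card := by exact_mod_cast hF.card_pos
  refine (mul_lt_mul_of_pos_right hk hF').trans_le ?_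
  refine pow_mul_card_le_ncard_nbhdOf (E := fun k v w => Γ.dist v w ≤ k) (fun k v => hfin k v)
    (by simp) (fun k u v w h1 h2 => ?_) (by positivity) hstep k F
  exact hΓ.dist_triangle.trans (add_le_add h1 h2)

end Graph

/-! ### Quasi-isometries between groups and graphs -/

section QuasiIsometry

variable {G : Type u} [Group G] [TopologicalSpace G] [IsTopologicalGroup G]
  [LocallyCompactSpace G] [T2Space G] {Γ W S : Set G}

lemma Set.ncard_le_card_mul {V I : Type*} {A : Set V} {s : Set I} (hs : s.Finite) {B : I → Set V}
    {M : ℕ} (hB : ∀ i, (B i).encard ≤ M) (hA : A ⊆ ⋃ i ∈ s, B i) : A.ncard ≤ s.ncard * M := by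
  classical
  have hf : ∀ i, (B i).Finite := fun i => Set.finite_of_encard_le_coe (hB i)
  have h1 : A ⊆ (hs.toFinset.biUnion fun i => (hf i).toFinset : Finset V) := by
    simpa using hA
  have h2 := Set.ncard_le_ncard h1 (Finset.finite_toSet _)
  rw [Set.ncard_coe_finset] at h2
  rw [Set.ncard_eq_toFinset_card _ hs]
  refine h2.trans (Finset.card_biUnion_le_card_mul _ _ _ fun i _ => ?_)
  have := hB i
  rw [(hf i).encard_eq_coe_toFinset_card] at this
  exact_mod_cast this

/-- The image of a Følner set `A` would not expand. Its `k`-neighbourhood in the graph is covered by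
`ρ`-balls around images of the `r`-thickening of `A`, while `A` maps to the graph with fibres of
size at most `N`. -/
lemma IsGroupNet.not_quasiIsometricToCheegerGraph (hΓ : IsGroupNet Γ W) (hF : IsFolnerNet Γ)
    (hSc : IsCompact S) (hS : S⁻¹ = S) (hgen : Subgroup.closure S = ⊤) :
    ¬ QuasiIsometricToCheegerGraph (wordDist S) := by
  classical
  rintro ⟨V, Δ, hΔ, ⟨D, hD⟩, hc, f, C, hC, hf, hdense⟩
  have hT : ∀ n, IsCompact ((insert 1 S) ^ n) := fun n => (hSc.insert 1).pow_set n
  have hU : IsCompact (W / W) := by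
    rw [div_eq_mul_inv]; exact hΓ.isCompact.mul hΓ.isCompact.inv
  obtain ⟨k₀, hk₀⟩ := exists_compact_subset_pow_insert_one hSc hS hgen hU
  obtain ⟨N, hN⟩ := hΓ.exists_encard_le (hT ⌈C * C⌉₊)
  let ρ : ℕ := ⌈C + (C * k₀ + C)⌉₊
  -- The factor combines the growth `2` of the thickened `A`, the fibre size `N` and the size of a
  -- `ρ`-ball. The numbers `N` and `ρ` are fixed before `k`, and `r` depends on `k`.
  obtain ⟨k, hk⟩ := hΔ.exists_expansion hD hc (2 * (N * ((D + 1) ^ ρ : ℕ)))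
  let r : ℕ := ⌈C * (k + ρ + C)⌉₊
  obtain ⟨A, hA, hAc⟩ := hF _ (hT r) 1 one_pos
  have hword : ∀ (g h : G) (a : ℝ), wordDist S g h ≤ a → g⁻¹ * h ∈ (insert 1 S) ^ ⌈a⌉₊ :=
    fun g h a ha => (wordDist_le_iff hS hgen g h _).1 (ha.trans (Nat.le_ceil a))
  have hlower : ∀ g h : G, wordDist S g h ≤ C * (Δ.dist (f g) (f h) + C) := fun g h => by
    have h1 := (hf g h).1
    have h2 : C⁻¹ * wordDist S g h ≤ Δ.dist (f g) (f h) + C := by linarith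
    rwa [inv_mul_le_iff₀ hC] at h2
  let φ : Γ → V := fun v => f v
  -- the fibres of `φ` are bounded
  have hfib : A.card ≤ (A.image φ).card * N := by
    have h1 : ∀ v ∈ A.image φ, ∃ γ : Γ, φ γ = v := fun v hv => by
      obtain ⟨γ, -, h⟩ := Finset.mem_image.1 hv
      exact ⟨γ, h⟩
    refine Finset.card_le_mul_card_image_of_maps_to (f := φ) (s := A) (t := A.image φ)
      (fun γ hγ => Finset.mem_image_of_mem φ hγ) N (fun v hv => ?_) |>.trans_eq (mul_comm _ _)
    obtain ⟨γ, hγ⟩ := h1 v hv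
    have h2 : ((A.filter fun x => φ x = v : Finset Γ) : Set Γ) ⊆
        {w : Γ | (γ : G)⁻¹ * w ∈ (insert 1 S) ^ ⌈C * C⌉₊} := by
      intro w hw
      refine hword _ _ _ ((hlower _ _).trans ?_)
      have h3 : f w = f γ := ((Finset.mem_filter.1 hw).2).trans hγ.symm
      rw [h3, SimpleGraph.dist_self]
      simp
    have h3 := (Set.encard_le_encard h2).trans (hN γ)
    rw [Set.encard_coe_eq_coe_finsetCard] at h3
    exact_mod_cast h3
  have hnb : nbhdOf (fun v w => Δ.dist v w ≤ k) (A.image φ) ⊆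
      ⋃ γ ∈ nbhdOf (translRel Γ ((insert 1 S) ^ r)) A, {y | Δ.dist (φ γ) y ≤ ρ} := by
    rintro y ⟨v, hv, hvy⟩
    obtain ⟨γ₁, hγ₁, rfl⟩ := Finset.mem_image.1 hv
    obtain ⟨g, hg⟩ := hdense y
    obtain ⟨γ, hγ, hγg⟩ := hΓ.cover g
    have h1 : (Δ.dist (f γ) (f g) : ℝ) ≤ C * k₀ + C := by
      refine (hf γ g).2.trans ?_
      gcongr
      exact (wordDist_le_iff hS hgen _ _ _).2 (hk₀ hγg)
    have h2 : Δ.dist (f γ) y ≤ ρ := by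
      have h3 : (Δ.dist (f γ) y : ℝ) ≤ Δ.dist (f γ) (f g) + Δ.dist (f g) y := by
        exact_mod_cast hΔ.dist_triangle
      have hg' : (Δ.dist y (f g) : ℝ) ≤ C := hg
      rw [SimpleGraph.dist_comm (u := y)] at hg'
      have h4 : (Δ.dist (f γ) y : ℝ) ≤ ρ := by
        refine le_trans ?_ (Nat.le_ceil _)
        linarith
      exact_mod_cast h4
    refine Set.mem_iUnion₂.2 ⟨⟨γ, hγ⟩, ⟨γ₁, hγ₁, ?_⟩, h2⟩
    refine hword _ _ _ ((hlower _ _).trans ?_)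
    have h3 : (Δ.dist (f γ₁) (f γ) : ℝ) ≤ Δ.dist (f γ₁) y + Δ.dist (f γ) y := by
      rw [SimpleGraph.dist_comm (u := f γ)]
      exact_mod_cast hΔ.dist_triangle
    have h4 : (Δ.dist (f γ₁) y : ℝ) ≤ k := by exact_mod_cast hvy
    have h5 : (Δ.dist (f γ) y : ℝ) ≤ ρ := by exact_mod_cast h2
    have h6 : (Δ.dist (f γ₁) (f γ) : ℝ) + C ≤ k + ρ + C := by linarith
    exact mul_le_mul_of_nonneg_left h6 hC.le
  have hcount := Set.ncard_le_card_mul (finite_nbhdOf (hΓ.finite_translRel (hT r)) A)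
    (fun γ => hΔ.encard_ball_le hD ρ (φ γ)) hnb
  have h1 := hk (A.image φ) (hA.image φ)
  have h2 : ((nbhdOf (fun v w => Δ.dist v w ≤ k) (A.image φ)).ncard : ℝ) ≤
      (nbhdOf (translRel Γ ((insert 1 S) ^ r)) A).ncard * ((D + 1) ^ ρ : ℕ) := by
    exact_mod_cast hcount
  have h3 : (A.card : ℝ) ≤ (A.image φ).card * N := by exact_mod_cast hfib
  have h4 : ((nbhdOf (translRel Γ ((insert 1 S) ^ r)) A).ncard : ℝ) * ((D + 1) ^ ρ : ℕ) ≤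
      (1 + 1) * ((A.image φ).card * N) * ((D + 1) ^ ρ : ℕ) := by
    gcongr
    exact hAc.trans (by gcongr)
  linarith

/-- The graph on a net whose edges join the points at word distance at most `n`. -/
def netGraph (Γ S : Set G) (hS : S⁻¹ = S) (n : ℕ) : SimpleGraph Γ where
  Adj v w := v ≠ w ∧ (v : G)⁻¹ * w ∈ (insert 1 S) ^ n
  symm := ⟨fun v w h => ⟨h.1.symm, by
    rw [← inv_pow_insert_one hS]
    simpa using h.2⟩⟩
  loopless := ⟨fun v h => h.1 rfl⟩

lemma IsGroupNet.quasiIsometricToCheegerGraph (hΓ : IsGroupNet Γ W) (hF : ¬ IsFolnerNet Γ)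
    (hSc : IsCompact S) (hS : S⁻¹ = S) (hgen : Subgroup.closure S = ⊤) :
    QuasiIsometricToCheegerGraph (wordDist S) := by
  classical
  have hT : ∀ n, IsCompact ((insert 1 S) ^ n) := fun n => (hSc.insert 1).pow_set n
  have hU : IsCompact (W / W) := by
    rw [div_eq_mul_inv]; exact hΓ.isCompact.mul hΓ.isCompact.inv
  obtain ⟨k, hk⟩ := exists_compact_subset_pow_insert_one hSc hS hgen hU
  obtain ⟨Q, hQ, hd⟩ := hΓ.exists_isDoubling hF
  obtain ⟨n₀, hn₀⟩ := exists_compact_subset_pow_insert_one hSc hS hgen hQ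
  -- `n₀` makes doubling pairs adjacent, and `k + 1 + k` joins the net approximations of `g` and `g
  -- * s` by at most one edge.
  set n := max n₀ (k + 1 + k) with hn
  have hn1 : n₀ ≤ n := le_max_left _ _
  have hn2 : k + 1 + k ≤ n := le_max_right _ _
  let Δ := netGraph Γ S hS n
  choose φ hφΓ hφ using hΓ.cover
  let f : G → Γ := fun g => ⟨φ g, hφΓ g⟩
  have hfk : ∀ g, (f g : G)⁻¹ * g ∈ (insert 1 S) ^ k := fun g => hk (hφ g)
  have hfk' : ∀ g, g⁻¹ * f g ∈ (insert 1 S) ^ k := fun g => by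
    rw [← inv_pow_insert_one hS]
    simpa using hfk g
  have hadj : ∀ v w : Γ, (v : G)⁻¹ * w ∈ (insert 1 S) ^ n → Δ.Reachable v w ∧ Δ.dist v w ≤ 1 := by
    intro v w h
    by_cases hvw : v = w
    · subst hvw; simp
    · have : Δ.Adj v w := ⟨hvw, h⟩
      exact ⟨this.reachable, (SimpleGraph.dist_eq_one_iff_adj.2 this).le⟩
  have hstep : ∀ (g : G) (s : G), s ∈ insert 1 S →
      Δ.Reachable (f g) (f (g * s)) ∧ Δ.dist (f g) (f (g * s)) ≤ 1 := by
    intro g s hs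
    refine hadj _ _ (pow_insert_one_mono hn2 ?_)
    rw [pow_add, pow_add, pow_one]
    refine ⟨_, ⟨_, hfk g, s, hs, rfl⟩, _, hfk' (g * s), ?_⟩
    simp [mul_assoc]
  have hpath : ∀ (j : ℕ) (g x : G), x ∈ (insert 1 S) ^ j →
      Δ.Reachable (f g) (f (g * x)) ∧ Δ.dist (f g) (f (g * x)) ≤ j := by
    intro j
    induction j with
    | zero =>
      intro g x hx
      have : x = 1 := by simpa using hx
      subst this
      simp
    | succ j ih =>
      intro g x hx
      rw [pow_succ] at hx
      obtain ⟨y, hy, s, hs, rfl⟩ := hx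
      obtain ⟨h1, h2⟩ := ih g y hy
      obtain ⟨h3, h4⟩ := hstep (g * y) s hs
      simp only [← mul_assoc]
      refine ⟨h1.trans h3, ?_⟩
      have := h1.dist_triangle_left (f (g * y * s))
      omega
  have hfself : ∀ v : Γ, Δ.Reachable v (f v) ∧ Δ.dist v (f v) ≤ 1 := fun v =>
    hadj v (f v) (pow_insert_one_mono (by omega) (hfk' v))
  have hreach : ∀ g h : G, Δ.Reachable (f g) (f h) := fun g h => by
    obtain ⟨j, hj⟩ := exists_mem_pow_insert_one hS hgen (g⁻¹ * h)
    have := (hpath j g _ hj).1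
    rwa [mul_inv_cancel_left] at this
  have hconn : Δ.Connected := by
    have : Nonempty Γ := ⟨f 1⟩
    exact ⟨fun v w => (hfself v).1.trans ((hreach v w).trans (hfself w).1.symm)⟩
  have hwalk : ∀ (v w : Γ) (p : Δ.Walk v w), (v : G)⁻¹ * w ∈ (insert 1 S) ^ (n * p.length) := by
    intro v w p
    induction p with
    | nil => simp
    | cons h p ih =>
      rw [SimpleGraph.Walk.length_cons, mul_add, mul_one, add_comm, pow_add]
      exact ⟨_, h.2, _, ih, by simp [mul_assoc]⟩
  obtain ⟨N, hN⟩ := hΓ.exists_encard_le (hT n)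
  refine ⟨Γ, Δ, hconn, ⟨N, fun v => (Set.encard_le_encard fun w hw => ?_).trans (hN v)⟩, ?_, f,
    n + 2 * k + 1, by positivity, fun g h => ⟨?_, ?_⟩, fun v => ⟨v, ?_⟩⟩
  · exact hw.2
  · refine lt_of_lt_of_le one_pos (le_iInf fun ⟨F, hF⟩ => ?_)
    have hF0 : (F.card : ℝ≥0∞) ≠ 0 := by exact_mod_cast hF.card_pos.ne'
    rw [ENNReal.le_div_iff_mul_le (.inl hF0) (.inl (ENNReal.natCast_ne_top _)), one_mul]
    have hnf := finite_nbhdOf (hΓ.finite_translRel hQ) F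
    have h1 : ((hnf.toFinset \ F : Finset Γ) : Set Γ) ⊆
        Prod.snd '' {e : Γ × Γ | e.1 ∈ F ∧ e.2 ∉ F ∧ Δ.Adj e.1 e.2} := by
      intro w hw
      rw [Finset.mem_coe, Finset.mem_sdiff, Set.Finite.mem_toFinset] at hw
      obtain ⟨⟨v, hv, hvw⟩, hwF⟩ := hw
      refine ⟨(v, w), ⟨hv, hwF, ?_, pow_insert_one_mono hn1 (hn₀ hvw)⟩, rfl⟩
      intro hvw'
      obtain rfl : v = w := hvw'
      exact hwF hv
    have h2 := (Set.encard_le_encard h1).trans (Set.encard_image_le _ _)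
    rw [Set.encard_coe_eq_coe_finsetCard] at h2
    -- Doubling leaves at least `|F|` neighbours outside `F`, which are endpoints of distinct
    -- boundary edges; the Cheeger constant is at least `1`.
    have h3 : F.card ≤ (hnf.toFinset \ F).card := by
      have h4 := hd F
      rw [Set.ncard_eq_toFinset_card _ hnf] at h4
      have h5 := Finset.le_card_sdiff F hnf.toFinset
      omega
    have h4 : (F.card : ℕ∞) ≤ {e : Γ × Γ | e.1 ∈ F ∧ e.2 ∉ F ∧ Δ.Adj e.1 e.2}.encard :=
      le_trans (by exact_mod_cast h3) h2
    have h5 := ENat.toENNReal_le.2 h4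
    simpa using h5
  · obtain ⟨p, hp⟩ := hconn.exists_walk_length_eq_dist (f g) (f h)
    have h1 := hwalk _ _ p
    rw [hp] at h1
    have h2 : g⁻¹ * h ∈ (insert 1 S) ^ (k + n * Δ.dist (f g) (f h) + k) := by
      rw [pow_add, pow_add]
      refine ⟨_, ⟨_, hfk' g, _, h1, rfl⟩, _, hfk h, ?_⟩
      simp [mul_assoc]
    have h3 := (wordDist_le_iff hS hgen g h _).2 h2
    push_cast at h3
    have h4 : (0 : ℝ) < n + 2 * k + 1 := by positivity
    have h5 : wordDist S g h ≤ (n + 2 * k + 1) * (Δ.dist (f g) (f h) + (n + 2 * k + 1)) := by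
      have h6 : (0 : ℝ) ≤ Δ.dist (f g) (f h) := Nat.cast_nonneg _
      have h7 : (0 : ℝ) ≤ n := Nat.cast_nonneg _
      have h8 : (0 : ℝ) ≤ k := Nat.cast_nonneg _
      nlinarith [mul_nonneg h8 h6, mul_nonneg h7 h8]
    rw [sub_le_iff_le_add, inv_mul_le_iff₀ h4]
    exact h5
  · have h1 := (wordDist_le_iff hS hgen g h (sInf {n : ℕ | g⁻¹ * h ∈ S ^ n})).1 le_rfl
    have h2 := (hpath _ g _ h1).2
    rw [mul_inv_cancel_left] at h2
    have h3 : (Δ.dist (f g) (f h) : ℝ) ≤ wordDist S g h := by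
      rw [wordDist]
      exact_mod_cast h2
    have h4 : 0 ≤ wordDist S g h := by
      rw [wordDist]
      positivity
    have h7 : (0 : ℝ) ≤ n := Nat.cast_nonneg _
    have h8 : (0 : ℝ) ≤ k := Nat.cast_nonneg _
    nlinarith [mul_nonneg h7 h4, mul_nonneg h8 h4]
  · have h1 : (Δ.dist v (f v) : ℝ) ≤ 1 := by exact_mod_cast (hfself v).2
    have h7 : (0 : ℝ) ≤ n := Nat.cast_nonneg _
    have h8 : (0 : ℝ) ≤ k := Nat.cast_nonneg _
    linarith

end QuasiIsometry

/-! ### The main theorem -/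

theorem mainTheorem2 {G : Type u} [Group G] [TopologicalSpace G] [IsTopologicalGroup G]
    [LocallyCompactSpace G] [T2Space G] [MeasurableSpace G] [BorelSpace G]
    {X : Type*} [TopologicalSpace X] [LocallyCompactSpace X] [T2Space X]
    [MeasurableSpace X] [BorelSpace X] [MulAction G X]
    (d : X → X → ℝ) (μ : Measure X) [IsFiniteMeasureOnCompacts μ] (hμ : μ ≠ 0)
    (hX : IsQuasiTransitive G d μ) :
    -- at every scale, the condition on all reversible viewpoints characterizes the group
    (∀ h : ℝ, 0 < h →
      ((IsUnimodularGroup G ∧ IsAmenableGroup G) ↔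
        ∀ (P : Kernel X X) [IsMarkovKernel P] (hP : IsReversibleViewpoint d μ h P),
          markovSpectralRadius μ P hP.isReversible = 1)) ∧
    -- at large scale, each single reversible viewpoint characterizes the group
    (∃ h₀ : ℝ, 0 < h₀ ∧ ∀ h : ℝ, h₀ ≤ h →
      ∀ (P : Kernel X X) [IsMarkovKernel P] (hP : IsReversibleViewpoint d μ h P),
        ((IsUnimodularGroup G ∧ IsAmenableGroup G) ↔
          markovSpectralRadius μ P hP.isReversible = 1)) ∧
    -- spectral radius `1` means that the Laplacian has no spectral gap
    (∀ h : ℝ, 0 < h →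
      ∀ (P : Kernel X X) [IsMarkovKernel P] (hP : IsReversibleViewpoint d μ h P),
        markovSpectralRadius μ P hP.isReversible ≤ 1 ∧
        (markovSpectralRadius μ P hP.isReversible = 1 ↔
          ¬ HasSpectralGap (markovLaplacian μ P hP.isReversible))) ∧
    -- the geometric characterization for compactly generated groups
    (∀ S : Set G, IsCompact S → S⁻¹ = S → Subgroup.closure S = ⊤ →
      ((IsUnimodularGroup G ∧ IsAmenableGroup G) ↔
        ¬ QuasiIsometricToCheegerGraph (wordDist S))) := by
  obtain ⟨Γ, W, hΓ⟩ := exists_isGroupNet (G := G)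
  have := hX.sigmaFinite
  obtain ⟨_, π, δ, hm, hδ, hδ'⟩ := hX.exists_isCoarseModel hμ hΓ
  have hone (hF : IsFolnerNet Γ) (h : ℝ) (P : Kernel X X) [IsMarkovKernel P]
      (hP : IsReversibleViewpoint d μ h P) : markovSpectralRadius μ P hP.isReversible = 1 := by
    refine hm.markovSpectralRadius_eq_one (fun R ε hε => ?_) hP
    obtain ⟨Q, hQ, hRQ⟩ := hδ' R
    obtain ⟨F, hF₀, hFQ⟩ := hF Q hQ ε hε
    exact ⟨F, hF₀, le_trans (mod_cast ncard_nbhdOf_mono (hΓ.finite_translRel hQ) hRQ F) hFQ⟩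
  have hne (hF : ¬ IsFolnerNet Γ) : ∃ h₀ : ℝ, 0 < h₀ ∧ ∀ h : ℝ, h₀ ≤ h →
      ∀ (P : Kernel X X) [IsMarkovKernel P] (hP : IsReversibleViewpoint d μ h P),
        markovSpectralRadius μ P hP.isReversible ≠ 1 := by
    obtain ⟨Q, hQ, hQd⟩ := hΓ.exists_isDoubling hF
    obtain ⟨R, hR⟩ := hδ Q hQ
    exact hm.exists_markovSpectralRadius_ne_one (R := R)
      fun F => (hQd F).trans (ncard_nbhdOf_mono (hm.finite_ball R) hR F)
  rw [← hΓ.isFolnerNet_iff]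
  refine ⟨fun h hh => ⟨fun hF P _ hP => hone hF h P hP, fun hall => ?_⟩, ?_,
    fun h _ P _ hP => ⟨markovSpectralRadius_le_one _,
      markovSpectralRadius_eq_one_iff_not_hasSpectralGap _⟩,
    fun S hSc hS hgen => ⟨fun hF => hΓ.not_quasiIsometricToCheegerGraph hF hSc hS hgen,
      not_imp_comm.1 fun hF => hΓ.quasiIsometricToCheegerGraph hF hSc hS hgen⟩⟩
  · by_contra hF
    obtain ⟨h₀, hh₀, hgap⟩ := hne hF
    -- A viewpoint at a scale above the threshold is viewed at scale `h`, where its spectral radius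
    -- contradicts the hypothesis.
    obtain ⟨P, _, hP⟩ := hm.exists_isReversibleViewpoint (h := max h h₀) (lt_max_of_lt_left hh)
    exact hgap _ (le_max_right _ _) P hP (hall P (hP.of_le hh (le_max_left _ _)))
  · by_cases hF : IsFolnerNet Γ
    · exact ⟨1, one_pos, fun h _ P _ hP => iff_of_true hF (hone hF h P hP)⟩
    · obtain ⟨h₀, hh₀, hgap⟩ := hne hF
      exact ⟨h₀, hh₀, fun h hh P _ hP => iff_of_false hF (hgap h hh P hP)⟩
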